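/- Let $M=(M_n)_{n\ge 0}$ be a sequence of strictly positive real numbers. The Carleman class $C_M\{\mathbb{R}\}$ is the set of all $C^\infty$ functions $f:\mathbb{R}\to\mathbb{C}$ such that for every compact interval $I\subset\mathbb{R}$ there are constants $C_I,\rho_I>0$ with $\sup_{I}|f^{(n)}|\le C_I\rho_I^{\,n}M_n$ for all $n\ge 0$. Assume that the class is regular, that is, $$\Big(\frac{M_{n+1}}{(n+1)!}\Big)^2\le \frac{M_n}{n!}\,\frac{M_{n+2}}{(n+2)!}\ (n\ge 0),\qquad \sup_{n\ge 1}\Big(\frac{M_{n+1}}{(n+1)M_n}\Big)^{1/n}<+\infty,\qquad \lim_{n\to\infty}M_n^{1/n}=+\infty,$$ and quasianalytic, that is, every $f\in C_M\{\mathbb{R}\}$ for which there is a point $u\in\mathbb{R}$ with $f^{(n)}(u)=0$ for all $n\ge 0$ is identically $0$. Let $q\ge 3$ be an integer, $\alpha_1<\dots<\alpha_q$ real numbers, $\delta>0$, $\mathbb{R}_\delta:=\{z\in\mathbb{C}:|\operatorname{Im}z|<\delta\}$, $\chi\in C_M\{\mathbb{R}\}$, and let $a_1,\dots,a_q$ be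 holomorphic functions on $\mathbb{R}_\delta$ such that $a_1$ and $a_q$ vanish nowhere on $\mathbb{R}_\delta$. Assume that for some constant $C>0$ $$\sup_{z\in\mathbb{R}_\delta}\Big(\sum_{j=2}^{q}\Big|\frac{a_j(z)}{a_1(z)}\Big|+\sum_{j=1}^{q-1}\Big|\frac{a_j(z)}{a_q(z)}\Big|+\frac{1}{|a_1(z)|}+\frac{1}{|a_q(z)|}\Big)e^{-e^{C|\operatorname{Re}z|}}<+\infty.$$ Then there is a function $\varphi\in C_M\{\mathbb{R}\}$ such that $$\sum_{j=1}^{q}a_j(x)\,\varphi(x+\alpha_j)=\chi(x)\qquad\text{for all }x\in\mathbb{R}.$$ -/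

import Mathlib

open Filter
open scoped ContDiff

/-- The open horizontal strip `{z : |Im z| < δ}`. -/
def strip (δ : ℝ) : Set ℂ := {z : ℂ | |z.im| < δ}

/-- The Carleman class `C_M{ℝ}`: smooth functions `f : ℝ → ℂ` such that for every compact interval
`I = [a, b]` there are constants `C, ρ > 0` with `|f^(n)| ≤ C ρ ^ n M_n` on `I` for all `n`. -/
def carlemanClass (M : ℕ → ℝ) : Set (ℝ → ℂ) :=
  {f | ContDiff ℝ ∞ f ∧ ∀ a b : ℝ, ∃ C > 0, ∃ ρ > 0,
    ∀ n : ℕ, ∀ x ∈ Set.Icc a b, ‖iteratedDeriv n f x‖ ≤ C * ρ ^ n * M n}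

/-- `C_M{ℝ}` is quasianalytic: a member all of whose derivatives vanish at some point is zero. -/
def IsQuasianalytic (M : ℕ → ℝ) : Prop :=
  ∀ f ∈ carlemanClass M, (∃ u : ℝ, ∀ n : ℕ, iteratedDeriv n f u = 0) → ∀ x : ℝ, f x = 0

/-- The class `C_M{ℝ}` is regular. -/
structure IsRegularCarleman (M : ℕ → ℝ) : Prop where
  logConvex : ∀ n : ℕ, (M (n + 1) / (n + 1).factorial) ^ 2 ≤
    M n / n.factorial * (M (n + 2) / (n + 2).factorial)
  bddAbove_ratio : BddAbove
    ((fun n : ℕ => (M (n + 1) / (((n : ℝ) + 1) * M n)) ^ (1 / (n : ℝ))) '' {n : ℕ | 1 ≤ n})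
  tendsto_root : Tendsto (fun n : ℕ => (M n) ^ (1 / (n : ℝ))) atTop atTop

/-! The equation is triangular when the right-hand side lives on one side. Suppose that near `-∞` it
is the restriction of a holomorphic function which is double exponentially small in a half strip.
Dividing by `a_q` and solving for the value at the largest shift gives `φ(y) = g(y) + ∑ c_j(y) φ(y -
β_j)` with `β_j = α_q - α_j > 0`. Measure functions against the weight `exp(-θ e^{-B Re z})` with `B
> C`. A step `β_j` to the left gains `exp(-θ (e^{B β_j} - 1) e^{-B Re z})`, which beats the growth
`e^{e^{C|Re z|}}` of the coefficients far to the left, so the Neumann series converges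
(`exists_holomorphic_fixedPoint`, `exp_exp_growth`). Its sum is holomorphic, hence in the class, and
the equation itself continues it to the right, because the class is stable under sums, products and
translations (`exists_carlemanAt_fixedPoint`). This is `exists_solution_of_left_decay`. The
reflection `x ↦ -x` exchanges the roles of `a_q` and `a_1` and treats decay near `+∞`.

It remains to split `χ` into two members of the class, one decaying holomorphically at each end
(`exists_cellSeries_decomposition`). On a cell `[k, k+1]`, `χ` is the jump across the real line of
the Cauchy integral of an almost holomorphic extension. That extension is a Taylor polynomial whose
order rises as the height `τ` decreases. `exists_truncation_orders` picks, in each layer `R_{j+1} <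
τ ≤ R_j`, an order whose first omitted term is dominated by `C ρ^k m_k 2^{-j} R_j^k` for every `k`
at once, where `m_k = M_k / k!`. Green's formula (`green_taylorExt`), applied layer by layer, and a
Plemelj relation (`tendsto_taylorCurveIntegral_jump`) give `IsTaylorCell.jump`. The contribution of
layer `j` is holomorphic in a strip of width comparable to `R_{j+1}`, and Cauchy's estimates turn
the choice of orders into membership in the class (`carlemanAt_tsum_of_holomorphic`,
`IsTaylorCell.carlemanAt_cellIntegral`).

The Cauchy kernel is multiplied by `exp(-λ (cosh(B(z - ζ)) - 1))`, which leaves its residue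
unchanged and makes it double exponentially small at horizontal distance at least `1`. Taking `λ =
λ_k` large on cell `k` makes the series over the cells converge. The vertical sides of the cells
carry different kernels, but the difference of two such kernels is entire, and the remaining edge
integrals telescope (`IsCellSystem.cellFun_eq`, `IsCellSystem.tsum_add_tsum`). Cells with `k ≥ 0`
form the summand that decays on the left, cells with `k < 0` the one that decays on the right. -/

open scoped Topology
open MeasureTheory

/-! ### Regular weight sequences -/

/-- The normalized weights `M_n / n!`. -/
noncomputable def normWeight (M : ℕ → ℝ) (n : ℕ) : ℝ := M n / n.factorial

/-- The quotients of consecutive normalized weights. -/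
noncomputable def weightRatio (M : ℕ → ℝ) (n : ℕ) : ℝ := normWeight M (n + 1) / normWeight M n

lemma normWeight_pos {M : ℕ → ℝ} (hM : ∀ n, 0 < M n) (n : ℕ) : 0 < normWeight M n :=
  div_pos (hM n) (by positivity)

lemma weightRatio_pos {M : ℕ → ℝ} (hM : ∀ n, 0 < M n) (n : ℕ) : 0 < weightRatio M n :=
  div_pos (normWeight_pos hM _) (normWeight_pos hM _)

lemma normWeight_succ {M : ℕ → ℝ} (hM : ∀ n, 0 < M n) (n : ℕ) :
    normWeight M (n + 1) = normWeight M n * weightRatio M n := by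
  have := (normWeight_pos hM n).ne'
  unfold weightRatio; field_simp

lemma weight_eq (M : ℕ → ℝ) (n : ℕ) : M n = n.factorial * normWeight M n := by
  unfold normWeight; field_simp

lemma weightRatio_mono {M : ℕ → ℝ} (hM : ∀ n, 0 < M n) (hreg : IsRegularCarleman M) :
    Monotone (weightRatio M) := by
  refine monotone_nat_of_le_succ fun n => ?_
  have h := hreg.logConvex n
  change normWeight M (n + 1) ^ 2 ≤ normWeight M n * normWeight M (n + 2) at h
  unfold weightRatio
  rw [div_le_div_iff₀ (normWeight_pos hM _) (normWeight_pos hM _)]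
  nlinarith [h]

/-- Regularity bounds the `n`-th root of the quotient only for `n ≥ 1`; monotonicity of the
quotients covers `n = 0`, and the exponent `n + 1` gives one formula for both. -/
lemma exists_weightRatio_le {M : ℕ → ℝ} (hM : ∀ n, 0 < M n) (hreg : IsRegularCarleman M) :
    ∃ A : ℝ, 1 ≤ A ∧ ∀ n, weightRatio M n ≤ A ^ (n + 1) := by
  obtain ⟨K, hK⟩ := hreg.bddAbove_ratio
  have key : ∀ n : ℕ, 1 ≤ n → weightRatio M n ≤ (max K 1) ^ n := by
    intro n hn
    have h1 : (M (n + 1) / (((n : ℝ) + 1) * M n)) ^ (1 / (n : ℝ)) ≤ K := hK ⟨n, hn, rfl⟩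
    have h2 : M (n + 1) / (((n : ℝ) + 1) * M n) = weightRatio M n := by
      unfold weightRatio normWeight
      rw [Nat.factorial_succ]
      have := (hM n).ne'
      push_cast
      field_simp
    rw [h2] at h1
    have h3 := weightRatio_pos hM n
    calc weightRatio M n = (weightRatio M n ^ (1 / (n : ℝ))) ^ n := by
          rw [one_div, Real.rpow_inv_natCast_pow h3.le (by omega)]
      _ ≤ (max K 1) ^ n := by
          gcongr
          exact h1.trans (le_max_left _ _)
  refine ⟨max K 1, le_max_right _ _, fun n => ?_⟩
  rcases Nat.eq_zero_or_pos n with rfl | hn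
  · exact (weightRatio_mono hM hreg (Nat.zero_le 1)).trans (key 1 le_rfl)
  · exact (key n hn).trans (pow_le_pow_right₀ (le_max_right _ _) (Nat.le_succ n))

/-- If `t * μ_j ≤ 1` for `j < n` and `t * μ_j ≥ 1` for `j ≥ n`, then `n` minimizes `m_i t ^ i`. -/
lemma normWeight_mul_pow_le {M : ℕ → ℝ} (hM : ∀ n, 0 < M n) {t : ℝ} (ht : 0 < t) {n : ℕ}
    (h1 : ∀ j < n, t * weightRatio M j ≤ 1) (h2 : ∀ j, n ≤ j → 1 ≤ t * weightRatio M j) (i : ℕ) :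
    normWeight M n * t ^ n ≤ normWeight M i * t ^ i := by
  have hs : ∀ j, normWeight M (j + 1) * t ^ (j + 1)
      = normWeight M j * t ^ j * (t * weightRatio M j) := by
    intro j; rw [normWeight_succ hM]; ring
  have hp : ∀ j, 0 < normWeight M j * t ^ j := fun j => mul_pos (normWeight_pos hM j) (pow_pos ht j)
  rcases le_total i n with hin | hin
  · have h : ∀ j, i ≤ j → j ≤ n → normWeight M j * t ^ j ≤ normWeight M i * t ^ i := by
      intro j hij
      induction j, hij using Nat.le_induction with
      | base => exact fun _ => le_rfl
      | succ j hij ih =>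
        intro hj
        rw [hs]
        exact (mul_le_of_le_one_right (hp j).le (h1 j hj)).trans (ih (by omega))
    exact h n hin le_rfl
  · induction i, hin using Nat.le_induction with
    | base => exact le_rfl
    | succ k hk ih =>
      rw [hs]
      exact ih.trans (le_mul_of_one_le_right (hp k).le (h2 k hk))

/-- Since the quotients increase, `m_{i+j} / m_j` is at least `m_i / m_0`. This is what makes the
class stable under products. -/
lemma normWeight_mul_le {M : ℕ → ℝ} (hM : ∀ n, 0 < M n) (hreg : IsRegularCarleman M) (i j : ℕ) :
    normWeight M i * normWeight M j ≤ normWeight M 0 * normWeight M (i + j) := by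
  induction i with
  | zero => simp
  | succ i ih =>
    rw [normWeight_succ hM, show i + 1 + j = (i + j) + 1 by ring, normWeight_succ hM]
    have h1 := weightRatio_mono hM hreg (Nat.le_add_right i j)
    have h2 := weightRatio_pos hM i
    have h3 := normWeight_pos hM 0
    have h4 := normWeight_pos hM (i + j)
    calc normWeight M i * weightRatio M i * normWeight M j
        = normWeight M i * normWeight M j * weightRatio M i := by ring
      _ ≤ normWeight M 0 * normWeight M (i + j) * weightRatio M (i + j) := by gcongr
      _ = _ := by ring

/-- Every quotient is at least the first one. Through Cauchy's estimates this places analytic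
functions in the class. -/
lemma pow_le_normWeight {M : ℕ → ℝ} (hM : ∀ n, 0 < M n) (hreg : IsRegularCarleman M) (n : ℕ) :
    normWeight M 0 * weightRatio M 0 ^ n ≤ normWeight M n := by
  induction n with
  | zero => simp
  | succ n ih =>
    rw [normWeight_succ hM, pow_succ, ← mul_assoc]
    have h1 := weightRatio_mono hM hreg (Nat.zero_le n)
    have h2 := weightRatio_pos hM 0
    have h3 := normWeight_pos hM n
    gcongr

/-! ### Local membership in a Carleman class -/

/-- `f` belongs to the Carleman class of `M` near `x₀`. -/
def CarlemanAt (M : ℕ → ℝ) (f : ℝ → ℂ) (x₀ : ℝ) : Prop :=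
  ∃ C > 0, ∃ ρ > 0, ∀ᶠ x in 𝓝 x₀, ContDiffAt ℝ ∞ f x ∧
    ∀ n, ‖iteratedDeriv n f x‖ ≤ C * ρ ^ n * M n

/-- The local form lets the constants vary from point to point; compactness of `[a, b]` restores
uniform constants as maxima over a finite cover. -/
lemma mem_carlemanClass_of_carlemanAt {M : ℕ → ℝ} (hM : ∀ n, 0 < M n) {f : ℝ → ℂ}
    (hf : ∀ x, CarlemanAt M f x) : f ∈ carlemanClass M := by
  refine ⟨contDiff_iff_contDiffAt.2 fun x => ?_, fun a b => ?_⟩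
  · obtain ⟨C, hC, ρ, hρ, h⟩ := hf x
    exact h.self_of_nhds.1
  · refine isCompact_Icc.induction_on (p := fun s => ∃ C > 0, ∃ ρ > 0,
      ∀ n : ℕ, ∀ x ∈ s, ‖iteratedDeriv n f x‖ ≤ C * ρ ^ n * M n) ?_ ?_ ?_ ?_
    · exact ⟨1, one_pos, 1, one_pos, fun n x hx => hx.elim⟩
    · rintro s t hst ⟨C, hC, ρ, hρ, h⟩
      exact ⟨C, hC, ρ, hρ, fun n x hx => h n x (hst hx)⟩
    · rintro s t ⟨C, hC, ρ, hρ, h⟩ ⟨C', hC', ρ', hρ', h'⟩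
      refine ⟨max C C', by positivity, max ρ ρ', by positivity, fun n x hx => ?_⟩
      have := (hM n).le
      rcases hx with hx | hx
      · refine (h n x hx).trans ?_
        gcongr
        · exact le_max_left _ _
        · exact le_max_left _ _
      · refine (h' n x hx).trans ?_
        gcongr
        · exact le_max_right _ _
        · exact le_max_right _ _
    · intro x _
      obtain ⟨C, hC, ρ, hρ, h⟩ := hf x
      exact ⟨_, mem_nhdsWithin_of_mem_nhds h, C, hC, ρ, hρ, fun n x hx => hx.2 n⟩

lemma CarlemanAt.continuousAt {M : ℕ → ℝ} {f : ℝ → ℂ} {x : ℝ} (h : CarlemanAt M f x) :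
    ContinuousAt f x := by
  obtain ⟨C, hC, ρ, hρ, h⟩ := h
  exact h.self_of_nhds.1.continuousAt

lemma CarlemanAt.congr {M : ℕ → ℝ} {f g : ℝ → ℂ} {x : ℝ} (hf : CarlemanAt M f x)
    (h : f =ᶠ[𝓝 x] g) : CarlemanAt M g x := by
  obtain ⟨C, hC, ρ, hρ, hf⟩ := hf
  refine ⟨C, hC, ρ, hρ, ?_⟩
  filter_upwards [hf, h.eventually_nhds] with y hy hfg'
  have hfg : f =ᶠ[𝓝 y] g := hfg'
  exact ⟨hy.1.congr_of_eventuallyEq hfg.symm, fun n => by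
    rw [← hfg.iteratedDeriv_eq n]; exact hy.2 n⟩

lemma CarlemanAt.add {M : ℕ → ℝ} (hM : ∀ n, 0 < M n) {f g : ℝ → ℂ} {x : ℝ} (hf : CarlemanAt M f x)
    (hg : CarlemanAt M g x) : CarlemanAt M (fun y => f y + g y) x := by
  obtain ⟨C, hC, ρ, hρ, hf⟩ := hf
  obtain ⟨C', hC', ρ', hρ', hg⟩ := hg
  refine ⟨C + C', by positivity, max ρ ρ', by positivity, ?_⟩
  filter_upwards [hf, hg] with y hy hy'
  refine ⟨hy.1.add hy'.1, fun n => ?_⟩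
  have e : iteratedDeriv n (fun y => f y + g y) y = iteratedDeriv n f y + iteratedDeriv n g y :=
    iteratedDeriv_add (hy.1.of_le (mod_cast le_top)) (hy'.1.of_le (mod_cast le_top))
  rw [e]
  have h1 : C * ρ ^ n * M n ≤ C * (max ρ ρ') ^ n * M n := by
    have := (hM n).le
    gcongr
    exact le_max_left _ _
  have h2 : C' * ρ' ^ n * M n ≤ C' * (max ρ ρ') ^ n * M n := by
    have := (hM n).le
    gcongr
    exact le_max_right _ _
  calc _ ≤ ‖iteratedDeriv n f y‖ + ‖iteratedDeriv n g y‖ := norm_add_le _ _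
    _ ≤ _ := add_le_add ((hy.2 n).trans h1) ((hy'.2 n).trans h2)
    _ = _ := by ring

/-- In Leibniz' formula `normWeight_mul_le` bounds `(n choose i) M_i M_{n-i}` by `m_0 M_n`. The `n +
1 ≤ 2 ^ n` summands cost a factor `2` in `ρ`. -/
lemma CarlemanAt.mul {M : ℕ → ℝ} (hM : ∀ n, 0 < M n) (hreg : IsRegularCarleman M) {f g : ℝ → ℂ}
    {x : ℝ} (hf : CarlemanAt M f x) (hg : CarlemanAt M g x) :
    CarlemanAt M (fun y => f y * g y) x := by
  obtain ⟨C, hC, ρ, hρ, hf⟩ := hf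
  obtain ⟨C', hC', ρ', hρ', hg⟩ := hg
  have hm0 := normWeight_pos hM 0
  refine ⟨C * C' * normWeight M 0, by positivity, 2 * max ρ ρ', by positivity, ?_⟩
  filter_upwards [hf, hg] with y hy hy'
  refine ⟨hy.1.mul hy'.1, fun n => ?_⟩
  have e := iteratedDeriv_fun_mul (n := n) (hy.1.of_le (mod_cast le_top))
    (hy'.1.of_le (mod_cast le_top))
  rw [e]
  have key : ∀ i ∈ Finset.range (n + 1),
      ‖(n.choose i : ℂ) * iteratedDeriv i f y * iteratedDeriv (n - i) g y‖
        ≤ C * C' * normWeight M 0 * (max ρ ρ') ^ n * M n := by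
    intro i hi
    have hin : i ≤ n := by simpa [Nat.lt_succ_iff] using hi
    rw [norm_mul, norm_mul, Complex.norm_natCast]
    have h1 : ‖iteratedDeriv i f y‖ ≤ C * (max ρ ρ') ^ i * M i := by
      refine (hy.2 i).trans ?_
      have := (hM i).le
      gcongr
      exact le_max_left _ _
    have h2 : ‖iteratedDeriv (n - i) g y‖ ≤ C' * (max ρ ρ') ^ (n - i) * M (n - i) := by
      refine (hy'.2 (n - i)).trans ?_
      have := (hM (n - i)).le
      gcongr
      exact le_max_right _ _
    have h3 : (n.choose i : ℝ) * (M i * M (n - i)) ≤ normWeight M 0 * M n := by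
      have h4 := normWeight_mul_le hM hreg i (n - i)
      rw [Nat.add_sub_cancel' hin] at h4
      have h5 : (n.choose i : ℝ) * i.factorial * (n - i).factorial = n.factorial := by
        exact_mod_cast Nat.choose_mul_factorial_mul_factorial hin
      rw [weight_eq M i, weight_eq M (n - i), weight_eq M n]
      calc _ = ((n.choose i : ℝ) * i.factorial * (n - i).factorial) *
            (normWeight M i * normWeight M (n - i)) := by ring
        _ ≤ n.factorial * (normWeight M 0 * normWeight M n) := by rw [h5]; gcongr
        _ = _ := by ring
    have hMi := hM i
    have hMni := hM (n - i)
    calc _ ≤ (n.choose i : ℝ) * (C * (max ρ ρ') ^ i * M i) *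
          (C' * (max ρ ρ') ^ (n - i) * M (n - i)) := by gcongr
      _ = C * C' * ((max ρ ρ') ^ i * (max ρ ρ') ^ (n - i)) *
          ((n.choose i : ℝ) * (M i * M (n - i))) := by ring
      _ ≤ C * C' * ((max ρ ρ') ^ i * (max ρ ρ') ^ (n - i)) * (normWeight M 0 * M n) := by gcongr
      _ = _ := by rw [← pow_add, Nat.add_sub_cancel' hin]; ring
  refine (norm_sum_le _ _).trans ((Finset.sum_le_sum key).trans ?_)
  rw [Finset.sum_const, Finset.card_range, nsmul_eq_mul, mul_pow]
  have h6 : ((n + 1 : ℕ) : ℝ) ≤ 2 ^ n := by exact_mod_cast Nat.lt_two_pow_self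
  have hMn := hM n
  calc _ ≤ (2 : ℝ) ^ n * (C * C' * normWeight M 0 * max ρ ρ' ^ n * M n) := by gcongr
    _ = _ := by ring

lemma CarlemanAt.comp_add_const {M : ℕ → ℝ} {f : ℝ → ℂ} {x c : ℝ} (hf : CarlemanAt M f (x + c)) :
    CarlemanAt M (fun y => f (y + c)) x := by
  obtain ⟨C, hC, ρ, hρ, hf⟩ := hf
  refine ⟨C, hC, ρ, hρ, ?_⟩
  have ht : Tendsto (fun y : ℝ => y + c) (𝓝 x) (𝓝 (x + c)) := by
    exact (continuous_add_const c).tendsto x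
  filter_upwards [ht.eventually hf] with y hy
  refine ⟨?_, fun n => ?_⟩
  · exact ContDiffAt.comp y hy.1 (contDiff_id.add contDiff_const).contDiffAt
  · rw [iteratedDeriv_comp_add_const]; exact hy.2 n

lemma CarlemanAt.comp_neg {M : ℕ → ℝ} {f : ℝ → ℂ} {x : ℝ} (hf : CarlemanAt M f (-x)) :
    CarlemanAt M (fun y => f (-y)) x := by
  obtain ⟨C, hC, ρ, hρ, hf⟩ := hf
  refine ⟨C, hC, ρ, hρ, ?_⟩
  filter_upwards [(continuous_neg.tendsto x).eventually hf] with y hy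
  refine ⟨ContDiffAt.comp y hy.1 contDiff_neg.contDiffAt, fun n => ?_⟩
  rw [iteratedDeriv_comp_neg, norm_smul]
  simpa using hy.2 n

/-- A function with a chain of derivatives on an open set is smooth there. -/
lemma contDiffAt_and_iteratedDeriv_eq {U : Set ℝ} (hU : IsOpen U) {f : ℝ → ℂ} {g : ℕ → ℝ → ℂ}
    (h0 : ∀ x ∈ U, g 0 x = f x) (hg : ∀ n, ∀ x ∈ U, HasDerivAt (g n) (g (n + 1) x) x)
    {x : ℝ} (hx : x ∈ U) :
    ContDiffAt ℝ ∞ f x ∧ ∀ n, iteratedDeriv n f x = g n x := by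
  have h1 : ∀ n, ∀ x ∈ U, iteratedDeriv n f x = g n x := by
    intro n
    induction n with
    | zero => intro x hx; simp [h0 x hx]
    | succ n ih =>
      intro x hx
      rw [iteratedDeriv_succ]
      have : iteratedDeriv n f =ᶠ[𝓝 x] g n := by
        filter_upwards [hU.mem_nhds hx] with y hy using ih y hy
      rw [this.deriv_eq, (hg n x hx).deriv]
  refine ⟨?_, fun n => h1 n x hx⟩
  have h2 : ContDiffOn ℝ ∞ f U := by
    apply contDiffOn_of_differentiableOn_deriv
    intro n _
    have h3 : DifferentiableOn ℝ (g n) U :=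
      fun y hy => (hg n y hy).differentiableAt.differentiableWithinAt
    refine h3.congr fun y hy => ?_
    rw [iteratedDerivWithin_of_isOpen hU hy, h1 n y hy]
  exact h2.contDiffAt (hU.mem_nhds hx)

/-- Sums of functions holomorphic on shrinking neighbourhoods of the real axis. -/
lemma carlemanAt_tsum_of_holomorphic {M : ℕ → ℝ} {F : ℕ → ℂ → ℂ} {x₀ ε : ℝ}
    (hε : 0 < ε) {η b : ℕ → ℝ} (hη : ∀ j, 0 < η j)
    (hd : ∀ j, ∀ x ∈ Metric.ball x₀ ε, DifferentiableOn ℂ (F j) (Metric.ball (x : ℂ) (η j)))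
    (hb : ∀ j, ∀ x ∈ Metric.ball x₀ ε, ∀ z ∈ Metric.ball (x : ℂ) (η j), ‖F j z‖ ≤ b j)
    {C ρ : ℝ} (hC : 0 < C) (hρ : 0 < ρ)
    (hs : ∀ k : ℕ, Summable (fun j => b j / η j ^ k) ∧
      ∑' j, b j / η j ^ k ≤ C * ρ ^ k * normWeight M k) :
    CarlemanAt M (fun x : ℝ => ∑' j, F j x) x₀ := by
  have hcauchy : ∀ j k, ∀ x ∈ Metric.ball x₀ ε,
      ‖iteratedDeriv k (F j) (x : ℂ)‖ ≤ k.factorial * 2 ^ k * (b j / η j ^ k) := by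
    intro j k x hx
    have hηj := hη j
    -- Halving the radius keeps the closed disc inside the domain; the resulting `2 ^ k` goes into
    -- `ρ`.
    have hsub : Metric.closedBall (x : ℂ) (η j / 2) ⊆ Metric.ball (x : ℂ) (η j) :=
      Metric.closedBall_subset_ball (by linarith)
    have := Complex.norm_iteratedDeriv_le_of_forall_mem_sphere_norm_le (f := F j) (c := (x : ℂ))
      (R := η j / 2) (C := b j) k (by positivity)
      (DifferentiableOn.diffContOnCl (by
        refine (hd j x hx).mono ?_
        exact Metric.closure_ball_subset_closedBall.trans hsub))
      (fun z hz => hb j x hx z (hsub (Metric.sphere_subset_closedBall hz)))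
    refine this.trans (le_of_eq ?_)
    rw [div_pow]
    field_simp
  have hderiv : ∀ j k, ∀ x ∈ Metric.ball x₀ ε, HasDerivAt
      (fun y : ℝ => iteratedDeriv k (F j) (y : ℂ)) (iteratedDeriv (k + 1) (F j) (x : ℂ)) x := by
    intro j k x hx
    have hmem : (x : ℂ) ∈ Metric.ball (x : ℂ) (η j) := Metric.mem_ball_self (hη j)
    have h1 : AnalyticAt ℂ (F j) (x : ℂ) :=
      (hd j x hx).analyticAt (Metric.isOpen_ball.mem_nhds hmem)
    have h2 : DifferentiableAt ℂ (iteratedDeriv k (F j)) (x : ℂ) := by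
      rw [iteratedDeriv_eq_iterate]
      exact (h1.iterated_deriv k).differentiableAt
    have h3 := h2.hasDerivAt
    rw [← iteratedDeriv_succ] at h3
    exact h3.comp_ofReal
  -- Differentiation is termwise and along the real axis only: the discs may shrink with `j`, so the
  -- sum need not be holomorphic anywhere.
  have hsumg : ∀ k, ∀ x ∈ Metric.ball x₀ ε, HasDerivAt
      (fun y : ℝ => ∑' j, iteratedDeriv k (F j) (y : ℂ))
      (∑' j, iteratedDeriv (k + 1) (F j) (x : ℂ)) x := by
    intro k x hx
    refine hasDerivAt_tsum_of_isPreconnected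
      (u := fun j => (k + 1).factorial * 2 ^ (k + 1) * (b j / η j ^ (k + 1)))
      ((hs (k + 1)).1.mul_left _) Metric.isOpen_ball (convex_ball x₀ ε).isPreconnected
      (fun j y hy => hderiv j k y hy) (fun j y hy => hcauchy j (k + 1) y hy) hx ?_ hx
    exact Summable.of_norm_bounded ((hs k).1.mul_left _) fun j => hcauchy j k x hx
  refine ⟨C, hC, 2 * ρ, by positivity, ?_⟩
  filter_upwards [Metric.ball_mem_nhds x₀ hε] with x hx
  obtain ⟨h1, h2⟩ := contDiffAt_and_iteratedDeriv_eq (U := Metric.ball x₀ ε) Metric.isOpen_ball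
    (f := fun x : ℝ => ∑' j, F j x) (g := fun k x => ∑' j, iteratedDeriv k (F j) (x : ℂ))
    (by intro y _; simp) hsumg hx
  refine ⟨h1, fun k => ?_⟩
  rw [h2]
  calc ‖∑' j, iteratedDeriv k (F j) (x : ℂ)‖
      ≤ ∑' j, k.factorial * 2 ^ k * (b j / η j ^ k) :=
        tsum_of_norm_bounded ((hs k).1.mul_left _).hasSum fun j => hcauchy j k x hx
    _ = k.factorial * 2 ^ k * ∑' j, b j / η j ^ k := tsum_mul_left
    _ ≤ k.factorial * 2 ^ k * (C * ρ ^ k * normWeight M k) := by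
        gcongr; exact (hs k).2
    _ = _ := by rw [weight_eq M k, mul_pow]; ring

/-- Cauchy's estimates on a fixed disc give geometric growth of the Taylor coefficients, which
`pow_le_normWeight` allows. -/
lemma carlemanAt_of_differentiableOn {M : ℕ → ℝ} (hM : ∀ n, 0 < M n) (hreg : IsRegularCarleman M)
    {U : Set ℂ} (hU : IsOpen U) {F : ℂ → ℂ} (hF : DifferentiableOn ℂ F U) {x₀ : ℝ}
    (hx : (x₀ : ℂ) ∈ U) : CarlemanAt M (fun x : ℝ => F x) x₀ := by
  obtain ⟨K, hK⟩ : ∃ K, ∀ᶠ z in 𝓝 (x₀ : ℂ), ‖F z‖ ≤ K := by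
    have := ((hF.differentiableAt (hU.mem_nhds hx)).continuousAt.norm).eventually
      (gt_mem_nhds (lt_add_one ‖F x₀‖))
    exact ⟨_, this.mono fun z hz => hz.le⟩
  obtain ⟨r, hr, hrU⟩ := Metric.mem_nhds_iff.1 (inter_mem hK (hU.mem_nhds hx))
  have hm0 := normWeight_pos hM 0
  have hμ := weightRatio_pos hM 0
  have hK0 : 0 ≤ K := (norm_nonneg _).trans (hrU (Metric.mem_ball_self hr)).1
  have hsub : ∀ x ∈ Metric.ball x₀ (r / 2), Metric.ball (x : ℂ) (r / 2) ⊆ Metric.ball (x₀ : ℂ) r := by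
    intro x hx
    apply Metric.ball_subset_ball'
    rw [Metric.mem_ball] at hx
    rw [Complex.dist_of_im_eq (by simp)]
    simp only [Complex.ofReal_re]
    linarith
  -- A single function is treated as a series whose only nonzero term has index `0`.
  have key := carlemanAt_tsum_of_holomorphic (M := M) (F := fun j z => if j = 0 then F z else 0)
    (x₀ := x₀) (ε := r / 2) (by positivity) (η := fun _ => r / 2)
    (b := fun j => if j = 0 then K else 0) (fun _ => by positivity)
    (C := (K + 1) / normWeight M 0) (ρ := 2 / (r * weightRatio M 0)) ?_ ?_ (by positivity)
    (by positivity) ?_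
  · refine key.congr (Eventually.of_forall fun x => ?_)
    simp
  · intro j x hx
    by_cases hj : j = 0
    · simp only [hj, if_true]
      exact hF.mono fun z hz => (hrU (hsub x hx hz)).2
    · simp [hj]
  · intro j x hx z hz
    by_cases hj : j = 0
    · simp only [hj, if_true]
      exact (hrU (hsub x hx hz)).1
    · simp [hj]
  · intro k
    have e : (fun j : ℕ => (if j = 0 then K else 0) / (r / 2) ^ k)
        = fun j => if j = 0 then K / (r / 2) ^ k else 0 := by
      ext j; split_ifs <;> simp
    rw [e]
    refine ⟨(hasSum_ite_eq 0 _).summable, ?_⟩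
    rw [tsum_ite_eq]
    have h1 := pow_le_normWeight hM hreg k
    calc K / (r / 2) ^ k ≤ (K + 1) / (r / 2) ^ k := by gcongr; linarith
      _ = (K + 1) / normWeight M 0 * (2 / (r * weightRatio M 0)) ^ k *
          (normWeight M 0 * weightRatio M 0 ^ k) := by
        rw [div_pow, div_pow, mul_pow]
        field_simp
      _ ≤ _ := by gcongr

lemma CarlemanAt.sum {M : ℕ → ℝ} (hM : ∀ n, 0 < M n) (hreg : IsRegularCarleman M) {ι : Type*}
    (s : Finset ι) {f : ι → ℝ → ℂ} {x : ℝ} (hf : ∀ i ∈ s, CarlemanAt M (f i) x) :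
    CarlemanAt M (fun y => ∑ i ∈ s, f i y) x := by
  classical
  induction s using Finset.induction_on with
  | empty =>
    have := carlemanAt_of_differentiableOn hM hreg isOpen_univ (F := fun _ => (0 : ℂ))
      (differentiableOn_const _) (Set.mem_univ (x : ℂ))
    simpa using this
  | insert i s hi ih =>
    simp only [Finset.sum_insert hi]
    exact (hf i (Finset.mem_insert_self i s)).add hM
      (ih fun j hj => hf j (Finset.mem_insert_of_mem hj))

lemma CarlemanAt.const_mul {M : ℕ → ℝ} (hM : ∀ n, 0 < M n) (hreg : IsRegularCarleman M)
    {f : ℝ → ℂ} {x : ℝ} (c : ℂ) (hf : CarlemanAt M f x) : CarlemanAt M (fun y => c * f y) x := by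
  refine CarlemanAt.mul hM hreg ?_ hf
  exact carlemanAt_of_differentiableOn hM hreg isOpen_univ (F := fun _ => c)
      (differentiableOn_const _) (Set.mem_univ (x : ℂ))

/-! ### The triangular difference equation `φ(y) = g(y) + ∑ c_j(y) φ(y - β_j)` -/

/-- Neumann series for a difference equation with contracting coefficients. -/
lemma exists_holomorphic_fixedPoint {Ω : Set ℂ} (hΩ : IsOpen Ω) {s : Finset ℕ} {β : ℕ → ℝ}
    (hβ : ∀ j ∈ s, ∀ z ∈ Ω, z - β j ∈ Ω) {c : ℕ → ℂ → ℂ} {G : ℂ → ℂ}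
    (hc : ∀ j ∈ s, DifferentiableOn ℂ (c j) Ω) (hG : DifferentiableOn ℂ G Ω)
    {W : ℂ → ℝ} (hW1 : ∀ z, W z ≤ 1) {K : ℝ} (hK : 0 ≤ K)
    (hGW : ∀ z ∈ Ω, ‖G z‖ ≤ K * W z)
    (hcW : ∀ z ∈ Ω, ∑ j ∈ s, ‖c j z‖ * W (z - β j) ≤ 1 / 2 * W z) :
    ∃ ψ : ℂ → ℂ, DifferentiableOn ℂ ψ Ω ∧
      ∀ z ∈ Ω, ψ z = G z + ∑ j ∈ s, c j z * ψ (z - β j) := by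
  -- `T n` is the `n`-th term of the Neumann series; the contraction hypothesis on `W` halves its
  -- weighted size at each step.
  obtain ⟨T, hT0, hT⟩ : ∃ T : ℕ → ℂ → ℂ, T 0 = G ∧
      ∀ n z, T (n + 1) z = ∑ j ∈ s, c j z * T n (z - β j) :=
    ⟨fun n => Nat.rec G (fun _ F z => ∑ j ∈ s, c j z * F (z - β j)) n, rfl, fun _ _ => rfl⟩
  have hd : ∀ n, DifferentiableOn ℂ (T n) Ω := by
    intro n
    induction n with
    | zero => exact hT0 ▸ hG
    | succ n ih =>
      rw [funext (hT n)]
      refine DifferentiableOn.fun_sum fun j hj => (hc j hj).mul ?_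
      exact ih.comp (differentiableOn_id.sub_const _) fun z hz => hβ j hj z hz
  have hb : ∀ n, ∀ z ∈ Ω, ‖T n z‖ ≤ (1 / 2) ^ n * K * W z := by
    intro n
    induction n with
    | zero => intro z hz; simpa [hT0] using hGW z hz
    | succ n ih =>
      intro z hz
      rw [hT]
      calc _ ≤ ∑ j ∈ s, ‖c j z * T n (z - β j)‖ := norm_sum_le _ _
        _ ≤ ∑ j ∈ s, (1 / 2) ^ n * K * (‖c j z‖ * W (z - β j)) := by
          refine Finset.sum_le_sum fun j hj => ?_
          rw [norm_mul]
          calc _ ≤ ‖c j z‖ * ((1 / 2) ^ n * K * W (z - β j)) := by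
                gcongr; exact ih _ (hβ j hj z hz)
            _ = _ := by ring
        _ = (1 / 2) ^ n * K * ∑ j ∈ s, (‖c j z‖ * W (z - β j)) := by rw [Finset.mul_sum]
        _ ≤ (1 / 2) ^ n * K * (1 / 2 * W z) := by gcongr; exact hcW z hz
        _ = _ := by ring
  have hb' : ∀ n, ∀ z ∈ Ω, ‖T n z‖ ≤ (1 / 2) ^ n * K := fun n z hz =>
    (hb n z hz).trans (mul_le_of_le_one_right (by positivity) (hW1 z))
  have hsum : Summable fun n : ℕ => (1 / 2 : ℝ) ^ n * K := summable_geometric_two.mul_right K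
  refine ⟨fun z => ∑' n, T n z, Complex.differentiableOn_tsum_of_summable_norm hsum hd hΩ hb', ?_⟩
  intro z hz
  have hs : ∀ z ∈ Ω, Summable fun n => T n z := fun z hz =>
    Summable.of_norm_bounded hsum fun n => hb' n z hz
  beta_reduce
  rw [(hs z hz).tsum_eq_zero_add, hT0]
  congr 1
  simp only [hT]
  rw [Summable.tsum_finsetSum]
  · refine Finset.sum_congr rfl fun j hj => ?_
    rw [tsum_mul_left]
  · intro j hj
    exact (hs _ (hβ j hj z hz)).mul_left _

/-- Continuation to the right of a solution given near `-∞`. -/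
lemma exists_carlemanAt_fixedPoint {M : ℕ → ℝ} (hM : ∀ n, 0 < M n) (hreg : IsRegularCarleman M)
    {s : Finset ℕ} {β : ℕ → ℝ} {d : ℝ} (hd : 0 < d) (hβ : ∀ j ∈ s, d ≤ β j)
    {c : ℕ → ℝ → ℂ} {g : ℝ → ℂ} (hc : ∀ j ∈ s, ∀ x, CarlemanAt M (c j) x)
    (hg : ∀ x, CarlemanAt M g x) {ψ : ℝ → ℂ} {L : ℝ} (hψ : ∀ x < L, CarlemanAt M ψ x)
    (hψe : ∀ x < L, ψ x = g x + ∑ j ∈ s, c j x * ψ (x - β j)) :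
    ∃ φ : ℝ → ℂ, (∀ x, CarlemanAt M φ x) ∧
      ∀ x, φ x = g x + ∑ j ∈ s, c j x * φ (x - β j) := by
  -- Here `T n` is the `n`-th iterate started from `ψ`. All shifts are at least `d`, so each
  -- iteration moves the domain of validity by `d` to the right.
  obtain ⟨T, hT0, hT⟩ : ∃ T : ℕ → ℝ → ℂ, T 0 = ψ ∧
      ∀ n z, T (n + 1) z = g z + ∑ j ∈ s, c j z * T n (z - β j) :=
    ⟨fun n => Nat.rec ψ (fun _ F z => g z + ∑ j ∈ s, c j z * F (z - β j)) n, rfl, fun _ _ => rfl⟩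
  have hC : ∀ n : ℕ, ∀ x < L + n * d, CarlemanAt M (T n) x := by
    intro n
    induction n with
    | zero => intro x hx; exact hT0 ▸ hψ x (by simpa using hx)
    | succ n ih =>
      intro x hx
      push_cast at hx
      rw [funext (hT n)]
      refine (hg x).add hM (CarlemanAt.sum hM hreg s fun j hj => (hc j hj x).mul hM hreg ?_)
      have h1 := ih (x - β j) (by linarith [hβ j hj])
      rw [sub_eq_add_neg] at h1
      simpa [sub_eq_add_neg] using h1.comp_add_const
  have hE : ∀ n : ℕ, ∀ x < L + n * d, T (n + 1) x = T n x := by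
    intro n
    induction n with
    | zero => intro x hx; rw [hT, hT0]; exact (hψe x (by simpa using hx)).symm
    | succ n ih =>
      intro x hx
      push_cast at hx
      rw [hT (n + 1), hT n]
      congr 1
      refine Finset.sum_congr rfl fun j hj => ?_
      rw [ih (x - β j) (by linarith [hβ j hj])]
  have hE' : ∀ n k : ℕ, n ≤ k → ∀ x < L + n * d, T k x = T n x := by
    intro n k hnk
    induction k, hnk using Nat.le_induction with
    | base => intro x _; rfl
    | succ k hk ih =>
      intro x hx
      rw [hE k x (hx.trans_le (by gcongr)), ih x hx]
  -- The `+ 1` gives the strict inequality `x < L + N x * d`, so that `T (N x)` is valid on a whole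
  -- neighbourhood of `x`.
  let N : ℝ → ℕ := fun x => ⌈(x - L) / d⌉₊ + 1
  have hN : ∀ x, x < L + N x * d := by
    intro x
    have h1 := Nat.le_ceil ((x - L) / d)
    have h2 : (x - L) / d < N x := by
      simp only [N]; push_cast; linarith
    rw [div_lt_iff₀ hd] at h2
    linarith
  have hφ : ∀ n : ℕ, ∀ x < L + n * d, T (N x) x = T n x := by
    intro n x hx
    rcases le_total n (N x) with h | h
    · exact hE' n _ h x hx
    · exact (hE' _ _ h x (hN x)).symm
  refine ⟨fun x => T (N x) x, fun x => ?_, fun x => ?_⟩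
  · refine (hC (N x) x (hN x)).congr ?_
    filter_upwards [gt_mem_nhds (hN x)] with y hy
    exact (hφ _ y hy).symm
  · have h1 := hN x
    beta_reduce
    rw [← hE (N x) x h1, hT]
    congr 1
    refine Finset.sum_congr rfl fun j hj => ?_
    rw [← hφ (N x) (x - β j) (by linarith [hβ j hj])]

/-- The gap `B - C ≥ 1` leaves a spare factor `exp v`, which absorbs all constants once `v` is
large. -/
lemma exp_exp_growth {B C t a : ℝ} (hC : 0 < C) (hB : C + 1 ≤ B) (ha : 0 < a) (b : ℝ) :
    ∃ L : ℝ, 1 ≤ L ∧ ∀ v, L ≤ v → Real.exp (C * (v + t)) + b ≤ a * Real.exp (B * v) := by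
  refine ⟨max 1 (Real.log ((Real.exp (C * t) + |b|) / a)), le_max_left _ _, fun v hv => ?_⟩
  have hv1 : 1 ≤ v := (le_max_left _ _).trans hv
  have h0 : 0 < Real.exp (C * t) + |b| := by positivity
  have h1 : (Real.exp (C * t) + |b|) / a ≤ Real.exp v := by
    rw [← Real.log_le_iff_le_exp (by positivity)]
    exact (le_max_right _ _).trans hv
  rw [div_le_iff₀ ha] at h1
  have h2 : 1 ≤ Real.exp (C * v) := Real.one_le_exp (by positivity)
  have h3 : Real.exp (C * v) * Real.exp v ≤ Real.exp (B * v) := by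
    rw [← Real.exp_add]
    apply Real.exp_le_exp.2
    nlinarith
  calc Real.exp (C * (v + t)) + b = Real.exp (C * v) * Real.exp (C * t) + b := by
        rw [← Real.exp_add]; ring_nf
    _ ≤ Real.exp (C * v) * Real.exp (C * t) + Real.exp (C * v) * |b| := by
        have : b ≤ Real.exp (C * v) * |b| :=
          (le_abs_self b).trans (le_mul_of_one_le_left (abs_nonneg b) h2)
        linarith
    _ = Real.exp (C * v) * (Real.exp (C * t) + |b|) := by ring
    _ ≤ Real.exp (C * v) * (Real.exp v * a) := by gcongr
    _ = a * (Real.exp (C * v) * Real.exp v) := by ring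
    _ ≤ _ := by gcongr

/-- Solvability when the right hand side is holomorphic and double exponentially small
near `-∞`. -/
lemma exists_solution_of_left_decay {M : ℕ → ℝ} (hM : ∀ n, 0 < M n) (hreg : IsRegularCarleman M)
    {s : Finset ℕ} {p : ℕ} {α : ℕ → ℝ} (hα : ∀ j ∈ s, α j < α p) {δ : ℝ} (hδ : 0 < δ)
    {a : ℕ → ℂ → ℂ} (ha : ∀ j ∈ s, DifferentiableOn ℂ (a j) (strip δ))
    (hap : DifferentiableOn ℂ (a p) (strip δ)) (hap0 : ∀ z ∈ strip δ, a p z ≠ 0)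
    {K C : ℝ} (hC : 0 < C)
    (hK : ∀ j ∈ s, ∀ z ∈ strip δ, ‖a j z / a p z‖ ≤ K * Real.exp (Real.exp (C * |z.re|)))
    (hK1 : ∀ z ∈ strip δ, 1 / ‖a p z‖ ≤ K * Real.exp (Real.exp (C * |z.re|)))
    {B : ℝ} (hB : C + 1 ≤ B) {w : ℝ} (hw : 0 < w) (hwδ : w ≤ δ) {χ : ℝ → ℂ}
    (hχ : ∀ x, CarlemanAt M χ x) {H : ℂ → ℂ} {K' : ℝ}
    (hH : DifferentiableOn ℂ H {z | z.re < -1 ∧ |z.im| < w})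
    (hHχ : ∀ x : ℝ, x < -1 → H x = χ x)
    (hHb : ∀ z : ℂ, z.re < -1 → |z.im| < w →
      ‖H z‖ ≤ K' * Real.exp (-(1 / 2) * Real.exp (-B * z.re))) :
    ∃ φ : ℝ → ℂ, (∀ x, CarlemanAt M φ x) ∧
      ∀ x : ℝ, a p x * φ (x + α p) + ∑ j ∈ s, a j x * φ (x + α j) = χ x := by
  have hso : IsOpen (strip δ) := isOpen_lt (by fun_prop) (by fun_prop)
  have hreal : ∀ x : ℝ, (x : ℂ) ∈ strip δ := fun x => by simpa [strip] using hδ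
  have hK0 : 0 < K := by
    have h1 := hK1 0 (hreal 0)
    have h2 : 0 < 1 / ‖a p 0‖ := by
      have := norm_pos_iff.2 (hap0 0 (hreal 0)); positivity
    have h3 := h2.trans_le h1
    exact pos_of_mul_pos_left h3 (Real.exp_pos _).le
  have hK'0 : 0 ≤ K' := by
    have h1 := hHb (-2 : ℝ) (by norm_num) (by simpa using hw)
    have h2 := (norm_nonneg _).trans h1
    exact nonneg_of_mul_nonneg_left h2 (Real.exp_pos _)
  have hBpos : 0 < B := by linarith
  obtain ⟨d, hd, hdβ⟩ : ∃ d > 0, ∀ j ∈ s, d ≤ α p - α j := by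
    rcases s.eq_empty_or_nonempty with rfl | hs
    · exact ⟨1, one_pos, by simp⟩
    · obtain ⟨i, hi, hmin⟩ := s.exists_min_image (fun j => α p - α j) hs
      exact ⟨_, sub_pos.2 (hα i hi), hmin⟩
  set t := |α p| with ht
  -- After the shift by `α p`, the decay of `H` reads `exp (-2 θ exp (-B Re z))`. One `θ` becomes
  -- the rate of the weight `W`, the other pays for the growth of `1 / a p`.
  set θ : ℝ := 1 / 4 * Real.exp (B * α p) with hθ
  have hθ0 : 0 < θ := by positivity
  have hd1 : 0 < Real.exp (B * d) - 1 := by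
    have := Real.add_one_lt_exp (x := B * d) (by positivity); nlinarith [mul_pos hBpos hd]
  -- `L₁` makes the coefficients contract in the weight `W`, the logarithm accounting for `K` and
  -- for the number of terms. `L₂` lets the spare `θ` dominate `1 / a p`. The bound `1 + t` in `L`
  -- keeps `z - α p` to the left of `-1`, where `H` is known.
  obtain ⟨L₁, hL₁, hg₁⟩ := exp_exp_growth (t := t) hC hB (mul_pos hθ0 hd1)
    (Real.log (2 * K * (s.card + 1)))
  obtain ⟨L₂, hL₂, hg₂⟩ := exp_exp_growth (t := t) hC hB hθ0 0
  set L := max (max L₁ L₂) (1 + t) with hL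
  have hLL₁ : L₁ ≤ L := (le_max_left _ _).trans (le_max_left _ _)
  have hLL₂ : L₂ ≤ L := (le_max_right _ _).trans (le_max_left _ _)
  have hLt : 1 + t ≤ L := le_max_right _ _
  have htα : -t ≤ α p ∧ α p ≤ t := abs_le.1 le_rfl
  let c : ℕ → ℂ → ℂ := fun j z => -(a j (z - α p) / a p (z - α p))
  let G : ℂ → ℂ := fun z => H (z - α p) / a p (z - α p)
  let Ω : Set ℂ := {z | z.re < -L ∧ |z.im| < w}
  have hΩ : IsOpen Ω := (isOpen_lt Complex.continuous_re continuous_const).inter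
    (isOpen_lt Complex.continuous_im.abs continuous_const)
  have hΩs : ∀ z ∈ Ω, z - α p ∈ strip δ := fun z hz => by
    simpa [strip] using hz.2.trans_le hwδ
  have hcd : ∀ j ∈ s, DifferentiableOn ℂ (c j) (strip δ) := by
    intro j hj
    have hm : Set.MapsTo (fun z : ℂ => z - α p) (strip δ) (strip δ) := fun z hz => by
      simpa [strip] using hz
    refine DifferentiableOn.neg (DifferentiableOn.div ?_ ?_ fun z hz => hap0 _ (hm hz))
    · exact (ha j hj).comp (differentiableOn_id.sub_const _) hm
    · exact hap.comp (differentiableOn_id.sub_const _) hm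
  have hre : ∀ z ∈ Ω, |(z - α p).re| ≤ -z.re + t := by
    intro z hz
    have h1 : z.re < -L := hz.1
    simp only [Complex.sub_re, Complex.ofReal_re]
    rw [abs_le]; constructor <;> linarith
  have hExp : ∀ z ∈ Ω, Real.exp (Real.exp (C * |(z - α p).re|))
      ≤ Real.exp (Real.exp (C * (-z.re + t))) := by
    intro z hz
    have := hre z hz
    gcongr
  obtain ⟨ψ, hψd, hψe⟩ := exists_holomorphic_fixedPoint hΩ (s := s) (β := fun j => α p - α j)
    (c := c) (G := G) (W := fun z => Real.exp (-θ * Real.exp (-B * z.re))) (K := K * K')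
    (fun j hj z hz => by
      have h1 := hdβ j hj
      refine ⟨?_, ?_⟩
      · have : z.re < -L := hz.1
        simp only [Complex.sub_re, Complex.ofReal_re]
        linarith
      · simpa using hz.2)
    (fun j hj => (hcd j hj).mono fun z hz => by simpa [strip] using hz.2.trans_le hwδ)
    (by
      refine DifferentiableOn.div ?_ ?_ fun z hz => hap0 _ (hΩs z hz)
      · refine hH.comp (differentiableOn_id.sub_const _) fun z hz => ?_
        have : z.re < -L := hz.1
        refine ⟨?_, ?_⟩
        · simp only [Complex.sub_re, Complex.ofReal_re]; linarith
        · simpa using hz.2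
      · exact hap.comp (differentiableOn_id.sub_const _) fun z hz => hΩs z hz)
    (fun z => Real.exp_le_one_iff.2 (by
      have := Real.exp_pos (-B * z.re); nlinarith))
    (by positivity)
    (by
      intro z hz
      have hz1 : z.re < -L := hz.1
      have h1 := hHb (z - α p) (by simp only [Complex.sub_re, Complex.ofReal_re]; linarith)
        (by simpa using hz.2)
      have h2 := (hK1 _ (hΩs z hz)).trans (mul_le_mul_of_nonneg_left (hExp z hz) hK0.le)
      have h3 := hg₂ (-z.re) (by linarith)
      simp only [G, norm_div]
      have h4 : -(1 / 2) * Real.exp (-B * (z - α p).re) = -(2 * θ * Real.exp (B * -z.re)) := by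
        simp only [Complex.sub_re, Complex.ofReal_re, hθ]
        rw [show -B * (z.re - α p) = B * α p + B * -z.re by ring, Real.exp_add]; ring
      rw [h4] at h1
      calc ‖H (z - α p)‖ / ‖a p (z - α p)‖ = ‖H (z - α p)‖ * (1 / ‖a p (z - α p)‖) := by ring
        _ ≤ (K' * Real.exp (-(2 * θ * Real.exp (B * -z.re)))) *
            (K * Real.exp (Real.exp (C * (-z.re + t)))) := by gcongr
        _ = K * K' * (Real.exp (-(2 * θ * Real.exp (B * -z.re))) *
            Real.exp (Real.exp (C * (-z.re + t)))) := by ring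
        _ ≤ K * K' * Real.exp (-θ * Real.exp (-B * z.re)) := by
            rw [← Real.exp_add]
            gcongr
            rw [show -B * z.re = B * -z.re by ring]
            linarith)
    (by
      intro z hz
      have hz1 : z.re < -L := hz.1
      have h3 := hg₁ (-z.re) (by linarith)
      have key : ∀ j ∈ s, ‖c j z‖ * Real.exp (-θ * Real.exp (-B * (z - (α p - α j : ℝ)).re))
          ≤ 1 / (2 * (s.card + 1)) * Real.exp (-θ * Real.exp (-B * z.re)) := by
        intro j hj
        have h5 := (hK j hj _ (hΩs z hz)).trans (mul_le_mul_of_nonneg_left (hExp z hz) hK0.le)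
        have h6 : Real.exp (B * d) * Real.exp (B * -z.re) ≤
            Real.exp (-B * (z - (α p - α j : ℝ)).re) := by
          rw [← Real.exp_add]
          apply Real.exp_le_exp.2
          simp only [Complex.sub_re, Complex.ofReal_re]
          have := mul_le_mul_of_nonneg_left (hdβ j hj) hBpos.le
          linarith
        have hpos : (0 : ℝ) < 2 * K * (s.card + 1) := by positivity
        -- Writing `K` as an exponential allows the single inequality `h3` to absorb it. The share
        -- `1 / (2 (card + 1))` per term makes the whole sum at most half of the weight.
        have h7 : K = Real.exp (Real.log (2 * K * (s.card + 1))) * (1 / (2 * (s.card + 1))) := by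
          rw [Real.exp_log hpos, mul_one_div, eq_div_iff (by positivity)]; ring
        simp only [c, norm_neg]
        calc _ ≤ (K * Real.exp (Real.exp (C * (-z.re + t)))) *
              Real.exp (-θ * (Real.exp (B * d) * Real.exp (B * -z.re))) := by
              gcongr ?_ * ?_
              apply Real.exp_le_exp.2
              nlinarith
          _ = 1 / (2 * (s.card + 1)) * Real.exp (Real.log (2 * K * (s.card + 1)) +
              Real.exp (C * (-z.re + t)) + -θ * (Real.exp (B * d) * Real.exp (B * -z.re))) := by
              rw [Real.exp_add, Real.exp_add]
              exact (fun (l n E X : ℝ) (h : K = l * n) => by rw [h]; ring :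
                ∀ l n E X : ℝ, K = l * n → K * E * X = n * (l * E * X)) _ _ _ _ h7
          _ ≤ _ := by
              refine mul_le_mul_of_nonneg_left (Real.exp_le_exp.2 ?_)
                (div_nonneg zero_le_one (by linarith [Nat.cast_nonneg (α := ℝ) s.card]))
              rw [show -B * z.re = B * -z.re by ring]
              linarith
      refine (Finset.sum_le_sum key).trans ?_
      rw [Finset.sum_const, nsmul_eq_mul, ← mul_assoc]
      gcongr
      rw [mul_one_div, div_le_div_iff₀ (by positivity) (by norm_num)]
      linarith)
  have hxΩ : ∀ x : ℝ, x < -L → (x : ℂ) ∈ Ω := fun x hx => ⟨by simpa using hx, by simpa using hw⟩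
  have hinv : ∀ x, CarlemanAt M (fun x : ℝ => (a p ((x : ℂ) - α p))⁻¹) x := by
    intro x
    refine carlemanAt_of_differentiableOn hM hreg hso (F := fun z => (a p (z - α p))⁻¹) ?_ (hreal x)
    have hm : Set.MapsTo (fun z : ℂ => z - α p) (strip δ) (strip δ) := fun z hz => by
      simpa [strip] using hz
    exact (hap.comp (differentiableOn_id.sub_const _) hm).inv fun z hz => hap0 _ (hm hz)
  obtain ⟨φ, hφ, hφe⟩ := exists_carlemanAt_fixedPoint hM hreg hd hdβ
    (c := fun j x => c j x) (g := fun x => χ (x - α p) * (a p ((x : ℂ) - α p))⁻¹)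
    (fun j hj x => carlemanAt_of_differentiableOn hM hreg hso (hcd j hj) (hreal x))
    (fun x => by
      refine CarlemanAt.mul hM hreg ?_ (hinv x)
      have := (hχ (x + -α p)).comp_add_const
      simpa [sub_eq_add_neg] using this)
    (ψ := fun x => ψ x) (L := -L)
    (fun x hx => carlemanAt_of_differentiableOn hM hreg hΩ hψd (hxΩ x hx))
    (fun x hx => by
      have h1 := hψe x (hxΩ x hx)
      have h2 := hHχ (x - α p) (by linarith)
      rw [h1]
      simp only [G]
      push_cast at h2 ⊢
      rw [h2, div_eq_mul_inv])
  refine ⟨φ, hφ, fun x => ?_⟩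
  have h1 := hφe (x + α p)
  have h2 := hap0 x (hreal x)
  rw [h1]
  simp only [c]
  push_cast
  simp only [add_sub_cancel_right]
  rw [mul_add, Finset.mul_sum, add_assoc, ← Finset.sum_add_distrib]
  have h3 : a p x * (χ x * (a p x)⁻¹) = χ x := by field_simp
  rw [h3, Finset.sum_eq_zero, add_zero]
  intro j hj
  rw [show x + α p - (α p - α j) = x + α j by ring]
  field_simp
  ring

/-! ### Truncation orders for Taylor expansions -/

/-- Radii `R_j` and truncation orders `N_j` such that the first omitted term of order `N_j + 1`
is controlled by every weight at the scales `R_j` and `R_{j+1}`. -/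
lemma exists_truncation_orders {M : ℕ → ℝ} (hM : ∀ n, 0 < M n) (hreg : IsRegularCarleman M) :
    ∃ (R : ℕ → ℝ) (N : ℕ → ℕ), ∃ C > 0, ∃ ρ > 0, (∀ j, 0 < R j) ∧ (∀ j, R (j + 1) ≤ R j) ∧
      (∀ j, R j ≤ 2 * R (j + 1)) ∧ (∀ j, 1 ≤ N j) ∧ (∀ j, N (j + 1) = N j ∨ N (j + 1) = N j + 1) ∧
      ∀ j k : ℕ, ∀ r, r = R j ∨ r = R (j + 1) →
        ((N j : ℝ) + 1) * normWeight M (N j + 1) * r ^ N j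
          ≤ C * ρ ^ k * normWeight M k * (1 / 2) ^ j * r ^ k := by
  obtain ⟨A, hA1, hA⟩ := exists_weightRatio_le hM hreg
  have hmono := weightRatio_mono hM hreg
  have hμ := weightRatio_pos hM
  -- For `rad (n + 1) ≤ r ≤ rad n`, the index `n + 1` minimizes `m_i (4 r) ^ i`.
  let rad : ℕ → ℝ := fun n => 1 / (4 * weightRatio M n)
  have hrad : ∀ n, 0 < rad n := fun n => by have := hμ n; positivity
  have hradm : ∀ n, rad (n + 1) ≤ rad n := fun n => by
    have := hμ n
    have := hmono (Nat.le_succ n)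
    simp only [rad]
    gcongr
  -- The radius is halved until it is within a factor `2` of the next threshold; only then does it
  -- drop to that threshold and the order rise by one. Consecutive radii therefore have ratio at
  -- most `2`.
  let step : ℝ × ℕ → ℝ × ℕ := fun q =>
    if q.1 ≤ 2 * rad (q.2 + 1) then (rad (q.2 + 1), q.2 + 1) else (q.1 / 2, q.2)
  -- Starting at order `1` gives `1 ≤ N j`, which later cancels the singularity `1 / τ` of the
  -- kernel.
  obtain ⟨S, hS0, hS⟩ : ∃ S : ℕ → ℝ × ℕ, S 0 = (rad 1, 1) ∧ ∀ j, S (j + 1) = step (S j) :=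
    ⟨fun n => Nat.rec (rad 1, 1) (fun _ q => step q) n, rfl, fun _ => rfl⟩
  have hinv : ∀ j, rad ((S j).2 + 1) ≤ (S j).1 ∧ (S j).1 ≤ rad (S j).2 ∧ 1 ≤ (S j).2 := by
    intro j
    induction j with
    | zero => simp [hS0, hradm]
    | succ j ih =>
      rw [hS]
      simp only [step]
      split_ifs with h
      · exact ⟨hradm _, le_rfl, by simp⟩
      · push Not at h
        have := hrad ((S j).2 + 1)
        exact ⟨by linarith, by linarith [ih.1, ih.2.1], ih.2.2⟩
  have hpos : ∀ j, 0 < (S j).1 := fun j => (hrad _).trans_le (hinv j).1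
  have hstep : ∀ j, rad ((S j).2 + 1) ≤ (S (j + 1)).1 ∧ (S (j + 1)).1 ≤ (S j).1 ∧
      (S j).1 ≤ 2 * (S (j + 1)).1 ∧ ((S (j + 1)).2 = (S j).2 ∨ (S (j + 1)).2 = (S j).2 + 1) ∧
      (S (j + 1)).1 * (1 / 2) ^ (S (j + 1)).2 ≤ 1 / 2 * ((S j).1 * (1 / 2) ^ (S j).2) := by
    intro j
    have h1 := hpos j
    rw [hS]
    simp only [step]
    split_ifs with h
    · refine ⟨le_rfl, (hinv j).1, h, Or.inr rfl, ?_⟩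
      rw [pow_succ]
      have := (hinv j).1
      have h2 : (0 : ℝ) < (1 / 2) ^ (S j).2 := by positivity
      calc _ = 1 / 2 * (rad ((S j).2 + 1) * (1 / 2) ^ (S j).2) := by ring
        _ ≤ _ := by gcongr
    · push Not at h
      refine ⟨by linarith, by linarith, by linarith, Or.inl rfl, le_of_eq (by ring)⟩
  -- At each step the radius halves or the order rises, so `r 2^{-N}` at least halves. This quantity
  -- is the source of the factor `(1 / 2) ^ j`.
  have hgeo : ∀ j, (S j).1 * (1 / 2) ^ (S j).2 ≤ rad 1 * (1 / 2) ^ j := by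
    intro j
    induction j with
    | zero =>
      rw [hS0]
      have := hrad 1
      simp only [pow_zero, pow_one]
      linarith
    | succ j ih =>
      calc _ ≤ 1 / 2 * ((S j).1 * (1 / 2) ^ (S j).2) := (hstep j).2.2.2.2
        _ ≤ 1 / 2 * (rad 1 * (1 / 2) ^ j) := by gcongr
        _ = _ := by ring
  refine ⟨fun j => (S j).1, fun j => (S j).2, 16 * A ^ 3 * rad 1, by have := hrad 1; positivity,
    4 * A ^ 2, by positivity, hpos, fun j => (hstep j).2.1, fun j => (hstep j).2.2.1,
    fun j => (hinv j).2.2, fun j => (hstep j).2.2.2.1, ?_⟩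
  intro j k r hr
  obtain ⟨hr1, hr2⟩ : rad ((S j).2 + 1) ≤ r ∧ r ≤ (S j).1 := by
    rcases hr with rfl | rfl
    · exact ⟨(hinv j).1, le_rfl⟩
    · exact ⟨(hstep j).1, (hstep j).2.1⟩
  have hr0 : 0 < r := (hrad _).trans_le hr1
  set n := (S j).2 with hn
  -- The minimum is compared with index `k + 2`. In `4 ^ n` one factor `2 ^ n` absorbs `n + 1`, the
  -- other leaves `2^{-n}`. Of the two extra powers of `r`, one is cancelled at the end and the
  -- other joins `2^{-n}` to give `(1 / 2) ^ j`.
  have hKI := normWeight_mul_pow_le hM (t := 4 * r) (by positivity) (n := n + 1) (by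
      intro i hi
      have h1 : r ≤ rad n := hr2.trans (hinv j).2.1
      have h2 : weightRatio M i ≤ weightRatio M n := hmono (by omega)
      have h3 := hμ n
      simp only [rad] at h1
      rw [le_div_iff₀ (by positivity)] at h1
      nlinarith) (by
      intro i hi
      have h2 : weightRatio M (n + 1) ≤ weightRatio M i := hmono hi
      have h3 := hμ (n + 1)
      simp only [rad] at hr1
      rw [div_le_iff₀ (by positivity)] at hr1
      nlinarith) (k + 2)
  have hm2 : normWeight M (k + 2) ≤ normWeight M k * A ^ (2 * k + 3) := by
    rw [normWeight_succ hM (k + 1), normWeight_succ hM k]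
    have h1 := hA k
    have h2 := hA (k + 1)
    have h3 := normWeight_pos hM k
    have h4 := hμ k
    have h5 := hμ (k + 1)
    calc _ ≤ normWeight M k * A ^ (k + 1) * A ^ (k + 1 + 1) := by gcongr
      _ = _ := by rw [mul_assoc, ← pow_add]; congr 2; ring
  have hmn := normWeight_pos hM (n + 1)
  have hmk := normWeight_pos hM k
  have h2n : ((n : ℝ) + 1) ≤ 2 ^ n := by exact_mod_cast Nat.lt_two_pow_self
  have hg : r * (1 / 2) ^ n ≤ rad 1 * (1 / 2) ^ j :=
    (mul_le_mul_of_nonneg_right hr2 (by positivity)).trans (hgeo j)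
  have h4 : ((1 : ℝ) / 2) ^ n * (2 ^ n) = 1 := by rw [← mul_pow]; norm_num
  have h4n : (4 : ℝ) ^ n = 2 ^ n * 2 ^ n := by rw [← mul_pow]; norm_num
  have key : r * (((n : ℝ) + 1) * normWeight M (n + 1) * r ^ n) ≤
      r * (16 * A ^ 3 * rad 1 * (4 * A ^ 2) ^ k * normWeight M k * (1 / 2) ^ j * r ^ k) := by
    calc r * (((n : ℝ) + 1) * normWeight M (n + 1) * r ^ n)
        ≤ r * ((2 ^ n) * normWeight M (n + 1) * r ^ n) := by gcongr
      _ = (1 / 2) ^ n * 4⁻¹ * (normWeight M (n + 1) * (4 * r) ^ (n + 1)) := by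
          rw [mul_pow, pow_succ, pow_succ, h4n]
          linear_combination (-(r * 2 ^ n * normWeight M (n + 1) * r ^ n)) * h4
      _ ≤ (1 / 2) ^ n * 4⁻¹ * (normWeight M (k + 2) * (4 * r) ^ (k + 2)) := by gcongr
      _ ≤ (1 / 2) ^ n * 1 * ((normWeight M k * A ^ (2 * k + 3)) * (4 * r) ^ (k + 2)) := by
          have := normWeight_pos hM (k + 2)
          gcongr
          norm_num
      _ = (r * (1 / 2) ^ n) * (r * (16 * A ^ 3 * (4 * A ^ 2) ^ k * normWeight M k * r ^ k)) := by
          rw [mul_pow, mul_pow, ← pow_mul]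
          ring
      _ ≤ (rad 1 * (1 / 2) ^ j) *
          (r * (16 * A ^ 3 * (4 * A ^ 2) ^ k * normWeight M k * r ^ k)) := by
          gcongr
      _ = _ := by ring
  exact le_of_mul_le_mul_left key hr0

/-! ### Cauchy type integrals -/

/-- Convolution type integrals against a holomorphic kernel are holomorphic. -/
lemma differentiableOn_integral_kernel {X : Type*} [MeasurableSpace X] {μ : Measure X}
    {g Φ : X → ℂ} (hg : Integrable g μ) (hΦ : AEMeasurable Φ μ) {κ : ℂ → ℂ}
    (hκm : Measurable κ) {W U K : Set ℂ} (hW : IsOpen W) (hU : IsOpen U)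
    (hK : IsCompact K) (hκ : DifferentiableOn ℂ κ W) (hΦK : ∀ᵐ p ∂μ, Φ p ∈ K)
    (hUK : ∀ z ∈ U, ∀ ζ ∈ K, z - ζ ∈ W) :
    DifferentiableOn ℂ (fun z => ∫ p, g p * κ (z - Φ p) ∂μ) U := by
  intro z₀ hz₀
  obtain ⟨r, hr, hrU⟩ := Metric.nhds_basis_closedBall.mem_iff.1 (hU.mem_nhds hz₀)
  -- The arguments of the kernel for `z` near `z₀` fill a compact subset of `W`; uniform bounds for
  -- `κ` and its derivative there justify differentiation under the integral.
  set S : Set ℂ := (fun q : ℂ × ℂ => q.1 - q.2) '' (Metric.closedBall z₀ r ×ˢ K) with hS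
  have hSc : IsCompact S := ((isCompact_closedBall z₀ r).prod hK).image (by fun_prop)
  have hSW : S ⊆ W := by
    rintro _ ⟨⟨z, ζ⟩, ⟨hz, hζ⟩, rfl⟩
    exact hUK z (hrU hz) ζ hζ
  have hmem : ∀ z ∈ Metric.closedBall z₀ r, ∀ ζ ∈ K, z - ζ ∈ S := fun z hz ζ hζ =>
    ⟨(z, ζ), ⟨hz, hζ⟩, rfl⟩
  obtain ⟨D₀, hD₀⟩ := hSc.exists_bound_of_continuousOn (hκ.continuousOn.mono hSW)
  obtain ⟨D₁, hD₁⟩ := hSc.exists_bound_of_continuousOn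
    ((hκ.deriv hW).continuousOn.mono hSW)
  have hmeas : ∀ z, AEStronglyMeasurable (fun p => g p * κ (z - Φ p)) μ := fun z =>
    hg.1.mul (hκm.comp_aemeasurable (hΦ.const_sub z)).aestronglyMeasurable
  have h := hasDerivAt_integral_of_dominated_loc_of_deriv_le (μ := μ) (𝕜 := ℂ)
    (F := fun z p => g p * κ (z - Φ p)) (F' := fun z p => g p * deriv κ (z - Φ p))
    (x₀ := z₀) (s := Metric.closedBall z₀ r) (bound := fun p => ‖g p‖ * D₁)
    (Metric.closedBall_mem_nhds z₀ hr) (Eventually.of_forall hmeas)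
    ((hg.norm.mul_const D₀).mono' (hmeas z₀) (by
      filter_upwards [hΦK] with p hp
      rw [norm_mul]
      gcongr
      exact hD₀ _ (hmem z₀ (Metric.mem_closedBall_self hr.le) _ hp)))
    (hg.1.mul ((measurable_deriv κ).comp_aemeasurable (hΦ.const_sub z₀)).aestronglyMeasurable)
    (by
      filter_upwards [hΦK] with p hp z hz
      rw [norm_mul]
      gcongr
      exact hD₁ _ (hmem z hz _ hp))
    (hg.norm.mul_const D₁)
    (by
      filter_upwards [hΦK] with p hp z hz
      have h1 : HasDerivAt κ (deriv κ (z - Φ p)) (z - Φ p) :=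
        (hκ.differentiableAt (hW.mem_nhds (hUK z (hrU hz) _ hp))).hasDerivAt
      have h2 : HasDerivAt (fun z => κ (z - Φ p)) (deriv κ (z - Φ p)) z := by
        simpa using h1.comp_sub_const z (Φ p)
      exact h2.const_mul (g p))
  exact h.2.differentiableAt.differentiableWithinAt

/-! ### The damped Cauchy kernel. -/

/-- An entire function equal to `1` at the origin and double exponentially small far away from the
imaginary axis in a strip. -/
noncomputable def cutoffExp (B lam : ℝ) (w : ℂ) : ℂ :=
  Complex.exp (-(lam : ℂ) * (Complex.cosh (B * w) - 1))

/-- The Cauchy kernel damped by `cutoffExp`. -/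
noncomputable def cutoffKernel (B lam : ℝ) (w : ℂ) : ℂ := -(cutoffExp B lam w / w)

lemma differentiable_cutoffExp (B lam : ℝ) : Differentiable ℂ (cutoffExp B lam) := by
  unfold cutoffExp
  fun_prop

lemma cutoffExp_zero (B lam : ℝ) : cutoffExp B lam 0 = 1 := by simp [cutoffExp]

lemma differentiableOn_cutoffKernel (B lam : ℝ) :
    DifferentiableOn ℂ (cutoffKernel B lam) {0}ᶜ :=
  ((differentiable_cutoffExp B lam).differentiableOn.div differentiableOn_id fun _ h => h).neg

lemma measurable_cutoffKernel (B lam : ℝ) : Measurable (cutoffKernel B lam) :=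
  ((differentiable_cutoffExp B lam).continuous.measurable.div measurable_id).neg

/-- `Re cosh (x + iy) = cosh x cos y`, so the damping acts as long as `cos (B Im w)` is bounded
below. This is why `|B Im w| ≤ 1` is required in the estimates. -/
lemma norm_cutoffExp (B lam : ℝ) (w : ℂ) : ‖cutoffExp B lam w‖ =
    Real.exp (-lam * (Real.cosh (B * w.re) * Real.cos (B * w.im) - 1)) := by
  rw [cutoffExp, Complex.norm_exp]
  congr 1
  have h : (Complex.cosh (B * w)).re = Real.cosh (B * w.re) * Real.cos (B * w.im) := by
    conv_lhs => rw [← Complex.re_add_im w]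
    rw [mul_add, Complex.cosh_add, ← mul_assoc, Complex.cosh_mul_I, Complex.sinh_mul_I,
      ← Complex.ofReal_mul, ← Complex.ofReal_mul, ← Complex.ofReal_cosh, ← Complex.ofReal_cos,
      ← Complex.ofReal_sinh, ← Complex.ofReal_sin,
      Complex.add_re, ← Complex.ofReal_mul, Complex.ofReal_re, Complex.re_ofReal_mul,
      Complex.re_ofReal_mul, Complex.I_re]
    ring
  rw [← Complex.ofReal_neg, Complex.re_ofReal_mul, Complex.sub_re, h, Complex.one_re]

lemma half_le_cos {x : ℝ} (hx : |x| ≤ 1) : 1 / 2 ≤ Real.cos x := by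
  have h1 := Real.one_sub_sq_div_two_le_cos (x := x)
  have h2 : x ^ 2 ≤ 1 := by rwa [sq_le_one_iff_abs_le_one]
  linarith

lemma norm_cutoffExp_le {B lam : ℝ} (hl : 0 ≤ lam) {w : ℂ} (hw : |B * w.im| ≤ 1) :
    ‖cutoffExp B lam w‖ ≤ Real.exp lam := by
  rw [norm_cutoffExp]
  have h1 := half_le_cos hw
  have h2 := Real.cosh_pos (B * w.re)
  have h3 : 0 ≤ Real.cosh (B * w.re) * Real.cos (B * w.im) := by positivity
  apply Real.exp_le_exp.2
  nlinarith

/-- From `B D ≥ 4` one gets `cosh (B D) ≥ 4`, so the normalizing `-1` costs at most half of `cosh (B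
D) / 2`. -/
lemma norm_cutoffExp_le_of_far {B lam : ℝ} (hB : 4 ≤ B) (hl : 0 ≤ lam) {w : ℂ} {D : ℝ}
    (hw : |B * w.im| ≤ 1) (hD : 1 ≤ D) (hwD : D ≤ |w.re|) :
    ‖cutoffExp B lam w‖ ≤ Real.exp (-(lam / 4) * Real.cosh (B * D)) := by
  rw [norm_cutoffExp]
  have h1 := half_le_cos hw
  have h2 : Real.cosh (B * D) ≤ Real.cosh (B * w.re) := by
    rw [Real.cosh_le_cosh, abs_mul, abs_mul, abs_of_nonneg (by linarith : 0 ≤ D)]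
    gcongr
  have h3 : 4 ≤ Real.cosh (B * D) := by
    have h5 : 4 ≤ B * D := by nlinarith
    have h4 := Real.quadratic_le_exp_of_nonneg (x := B * D) (by linarith)
    rw [Real.cosh_eq]
    have := Real.exp_pos (-(B * D))
    nlinarith
  apply Real.exp_le_exp.2
  have h6 : 1 / 2 * Real.cosh (B * D) ≤ Real.cosh (B * w.re) * Real.cos (B * w.im) := by
    calc _ ≤ Real.cos (B * w.im) * Real.cosh (B * D) := by gcongr
      _ ≤ Real.cos (B * w.im) * Real.cosh (B * w.re) := by gcongr
      _ = _ := mul_comm _ _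
  nlinarith

lemma norm_cutoffKernel_le {B lam : ℝ} (hl : 0 ≤ lam) {w : ℂ} (hw : |B * w.im| ≤ 1) {η : ℝ}
    (hη : 0 < η) (hηw : η ≤ |w.im|) :
    ‖cutoffKernel B lam w‖ ≤ Real.exp lam / η := by
  rw [cutoffKernel, norm_neg, norm_div]
  have := norm_cutoffExp_le hl hw
  have := hηw.trans (Complex.abs_im_le_norm w)
  gcongr

lemma norm_cutoffKernel_le_of_far {B lam : ℝ} (hB : 4 ≤ B) (hl : 0 ≤ lam) {w : ℂ} {D : ℝ}
    (hw : |B * w.im| ≤ 1) (hD : 1 ≤ D) (hwD : D ≤ |w.re|) :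
    ‖cutoffKernel B lam w‖ ≤ Real.exp (-(lam / 4) * Real.cosh (B * D)) := by
  rw [cutoffKernel, norm_neg, norm_div]
  have h1 := norm_cutoffExp_le_of_far hB hl hw hD hwD
  have h2 : 1 ≤ ‖w‖ := hD.trans (hwD.trans (Complex.abs_re_le_norm w))
  exact (div_le_self (norm_nonneg _) h2).trans h1

/-! ### Almost holomorphic extensions by Taylor polynomials -/

/-- The point `t + i τ σ(t)`. -/
noncomputable def tilt (σ : ℝ → ℝ) (t τ : ℝ) : ℂ := t + Complex.I * (τ * σ t)

/-- The Taylor polynomial of order `N` of `f` at `t`, evaluated at `t + i τ σ(t)`. -/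
noncomputable def taylorExt (f : ℝ → ℂ) (σ : ℝ → ℝ) (N : ℕ) (t τ : ℝ) : ℂ :=
  ∑ n ∈ Finset.range (N + 1), iteratedDeriv n f t * (Complex.I * (τ * σ t)) ^ n / n.factorial

/-- The defect of holomorphy of `taylorExt`. -/
noncomputable def taylorDefect (f : ℝ → ℂ) (σ : ℝ → ℝ) (N : ℕ) (t τ : ℝ) : ℂ :=
  iteratedDeriv (N + 1) f t * (Complex.I * (τ * σ t)) ^ N / N.factorial * (Complex.I * σ t)

/-- Integral of `taylorExt` against `κ` along the curve of height `τ` over `[a, b]`. -/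
noncomputable def taylorCurveIntegral (f : ℝ → ℂ) (σ : ℝ → ℝ) (κ : ℂ → ℂ) (N : ℕ) (a b τ : ℝ) (z : ℂ) :
    ℂ :=
  ∫ t in a..b, taylorExt f σ N t τ * (1 + Complex.I * (τ * deriv σ t)) * κ (z - tilt σ t τ)

/-- Integral of `taylorDefect` against `κ` over the region between the heights `c` and `d`. -/
noncomputable def defectIntegral (f : ℝ → ℂ) (σ : ℝ → ℝ) (κ : ℂ → ℂ) (N : ℕ) (a b c d : ℝ)
    (z : ℂ) : ℂ :=
  ∫ p in Set.Icc (a, c) (b, d), taylorDefect f σ N p.1 p.2 * κ (z - tilt σ p.1 p.2)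

lemma continuous_tilt {σ : ℝ → ℝ} (hσ : ContDiff ℝ ∞ σ) :
    Continuous fun p : ℝ × ℝ => tilt σ p.1 p.2 := by
  have := hσ.continuous
  unfold tilt
  fun_prop

lemma continuous_taylorExt {f : ℝ → ℂ} {σ : ℝ → ℝ} (hf : ContDiff ℝ ∞ f) (hσ : ContDiff ℝ ∞ σ)
    (N : ℕ) : Continuous fun p : ℝ × ℝ => taylorExt f σ N p.1 p.2 := by
  have h1 := hσ.continuous
  have h2 : ∀ n, Continuous (iteratedDeriv n f) := fun n =>
    hf.continuous_iteratedDeriv n (by exact_mod_cast le_top)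
  unfold taylorExt
  refine continuous_finsetSum _ fun n _ => ?_
  have := h2 n
  fun_prop

lemma continuous_taylorDefect {f : ℝ → ℂ} {σ : ℝ → ℝ} (hf : ContDiff ℝ ∞ f) (hσ : ContDiff ℝ ∞ σ)
    (N : ℕ) : Continuous fun p : ℝ × ℝ => taylorDefect f σ N p.1 p.2 := by
  have h1 := hσ.continuous
  have h2 : Continuous (iteratedDeriv (N + 1) f) :=
    hf.continuous_iteratedDeriv _ (by exact_mod_cast le_top)
  unfold taylorDefect
  fun_prop

lemma differentiable_iteratedDeriv_of_smooth {f : ℝ → ℂ} (hf : ContDiff ℝ ∞ f) (n : ℕ) :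
    Differentiable ℝ (iteratedDeriv n f) :=
  hf.differentiable_iteratedDeriv n (by exact_mod_cast WithTop.coe_lt_top n)

lemma hasDerivAt_tilt_left {σ : ℝ → ℝ} (hσ : ContDiff ℝ ∞ σ) (t τ : ℝ) :
    HasDerivAt (fun t => tilt σ t τ) (1 + Complex.I * (τ * deriv σ t)) t := by
  have h : HasDerivAt σ (deriv σ t) t :=
    (hσ.differentiable (by simp)).differentiableAt.hasDerivAt
  exact (hasDerivAt_id t).ofReal_comp.add ((h.ofReal_comp.const_mul (τ : ℂ)).const_mul Complex.I)

lemma hasDerivAt_tilt_right (σ : ℝ → ℝ) (t τ : ℝ) :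
    HasDerivAt (fun τ => tilt σ t τ) (Complex.I * σ t) τ := by
  have h := (((hasDerivAt_id τ).ofReal_comp.mul_const (σ t : ℂ)).const_mul Complex.I).const_add
    (t : ℂ)
  simpa [tilt] using h

/-- The sum is a Taylor polynomial of `f'` of one order less, multiplied by the `t`-derivative of
`tilt`. The last summand is the failure of the chain rule. The `τ`-derivative has the same sum and
no such remainder, so this summand alone survives in Green's formula. -/
lemma hasDerivAt_taylorExt_left {f : ℝ → ℂ} {σ : ℝ → ℝ} (hf : ContDiff ℝ ∞ f)
    (hσ : ContDiff ℝ ∞ σ) (N : ℕ) (t τ : ℝ) :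
    HasDerivAt (fun t => taylorExt f σ N t τ)
      ((∑ n ∈ Finset.range N, iteratedDeriv (n + 1) f t * (Complex.I * (τ * σ t)) ^ n / n.factorial)
        * (1 + Complex.I * (τ * deriv σ t)) +
        iteratedDeriv (N + 1) f t * (Complex.I * (τ * σ t)) ^ N / N.factorial) t := by
  have hs : HasDerivAt σ (deriv σ t) t :=
    (hσ.differentiable (by simp)).differentiableAt.hasDerivAt
  have hw : HasDerivAt (fun t => Complex.I * ((τ : ℂ) * (σ t : ℂ)))
      (Complex.I * (τ * deriv σ t)) t := (hs.ofReal_comp.const_mul (τ : ℂ)).const_mul Complex.I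
  have hd : ∀ n, HasDerivAt (iteratedDeriv n f) (iteratedDeriv (n + 1) f t) t := fun n => by
    rw [iteratedDeriv_succ]
    exact (differentiable_iteratedDeriv_of_smooth hf n t).hasDerivAt
  induction N with
  | zero => simpa [taylorExt] using hd 0
  | succ N ih =>
    have h1 : (fun t => taylorExt f σ (N + 1) t τ) = fun t => taylorExt f σ N t τ +
        iteratedDeriv (N + 1) f t * (Complex.I * (τ * σ t)) ^ (N + 1) / (N + 1).factorial := by
      ext t; simp [taylorExt, Finset.sum_range_succ _ (N + 1)]
    rw [h1]
    have h2 := ih.add (((hd (N + 1)).mul (hw.pow (N + 1))).div_const ((N + 1).factorial : ℂ))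
    refine h2.congr_deriv ?_
    rw [Finset.sum_range_succ, Nat.factorial_succ]
    push_cast
    have h3 : (N.factorial : ℂ) ≠ 0 := by exact_mod_cast N.factorial_ne_zero
    have h4 : (N : ℂ) + 1 ≠ 0 := by exact_mod_cast N.succ_ne_zero
    simp only [Pi.pow_apply]
    field_simp
    ring

lemma hasDerivAt_taylorExt_right (f : ℝ → ℂ) (σ : ℝ → ℝ) (N : ℕ) (t τ : ℝ) :
    HasDerivAt (fun τ => taylorExt f σ N t τ)
      ((∑ n ∈ Finset.range N, iteratedDeriv (n + 1) f t * (Complex.I * (τ * σ t)) ^ n / n.factorial)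
        * (Complex.I * σ t)) τ := by
  have hw : HasDerivAt (fun τ : ℝ => Complex.I * ((τ : ℂ) * (σ t : ℂ)))
      (Complex.I * σ t) τ := by
    simpa using ((hasDerivAt_id τ).ofReal_comp.mul_const (σ t : ℂ)).const_mul Complex.I
  induction N with
  | zero => simpa [taylorExt] using hasDerivAt_const τ (f t)
  | succ N ih =>
    have h1 : (fun τ => taylorExt f σ (N + 1) t τ) = fun τ => taylorExt f σ N t τ +
        iteratedDeriv (N + 1) f t * (Complex.I * (τ * σ t)) ^ (N + 1) / (N + 1).factorial := by
      ext t; simp [taylorExt, Finset.sum_range_succ _ (N + 1)]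
    rw [h1]
    have h2 := ih.add (((hw.pow (N + 1)).const_mul (iteratedDeriv (N + 1) f t)).div_const
      ((N + 1).factorial : ℂ))
    refine h2.congr_deriv ?_
    rw [Finset.sum_range_succ, Nat.factorial_succ]
    push_cast
    have h3 : (N.factorial : ℂ) ≠ 0 := by exact_mod_cast N.factorial_ne_zero
    have h4 : (N : ℂ) + 1 ≠ 0 := by exact_mod_cast N.succ_ne_zero
    field_simp

/-- Green's formula for `taylorExt` on a curved rectangle. -/
lemma green_taylorExt {f : ℝ → ℂ} {σ : ℝ → ℝ} (hf : ContDiff ℝ ∞ f) (hσ : ContDiff ℝ ∞ σ)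
    {κ : ℂ → ℂ} {z : ℂ} {a b c d : ℝ} (hab : a ≤ b) (hcd : c ≤ d)
    (hκ : ∀ t ∈ Set.Icc a b, ∀ τ ∈ Set.Icc c d, DifferentiableAt ℂ κ (z - tilt σ t τ)) (N : ℕ) :
    taylorCurveIntegral f σ κ N a b c z = taylorCurveIntegral f σ κ N a b d z
      - (∫ τ in c..d, taylorExt f σ N b τ * (Complex.I * σ b) * κ (z - tilt σ b τ))
      + (∫ τ in c..d, taylorExt f σ N a τ * (Complex.I * σ a) * κ (z - tilt σ a τ))
      + defectIntegral f σ κ N a b c d z := by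
  -- `Q` and `P` are, up to sign, the coefficients of the form `T κ(z - ζ) dζ` in the coordinates
  -- `(t, τ)`, where `ζ = tilt σ t τ` and `T` is the Taylor extension. As `κ` is holomorphic, their
  -- divergence reduces to the defect of `T`.
  set Q : ℝ × ℝ → ℂ := fun p => taylorExt f σ N p.1 p.2 * (Complex.I * σ p.1) *
    κ (z - tilt σ p.1 p.2) with hQ
  set P : ℝ × ℝ → ℂ := fun p => -(taylorExt f σ N p.1 p.2 * (1 + Complex.I * (p.2 * deriv σ p.1)) *
    κ (z - tilt σ p.1 p.2)) with hP
  have hσd : Differentiable ℝ σ := hσ.differentiable (by simp)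
  have hσ1 : ContDiff ℝ ∞ (deriv σ) := (contDiff_infty_iff_deriv.1 hσ).2
  have hσd' : Differentiable ℝ (deriv σ) := hσ1.differentiable (by simp)
  have hTd : Differentiable ℝ fun p : ℝ × ℝ => taylorExt f σ N p.1 p.2 := by
    unfold taylorExt
    refine Differentiable.fun_sum fun n _ => ?_
    have := differentiable_iteratedDeriv_of_smooth hf n
    have h1 : Differentiable ℝ fun p : ℝ × ℝ => iteratedDeriv n f p.1 :=
      this.comp differentiable_fst
    have h2 : Differentiable ℝ fun p : ℝ × ℝ => ((p.2 : ℂ)) :=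
      Complex.ofRealCLM.differentiable.comp differentiable_snd
    have h3 : Differentiable ℝ fun p : ℝ × ℝ => ((σ p.1 : ℝ) : ℂ) :=
      Complex.ofRealCLM.differentiable.comp (hσd.comp differentiable_fst)
    exact (h1.mul (((h2.mul h3).const_mul Complex.I).pow n)).mul_const _
  have h2 : Differentiable ℝ fun p : ℝ × ℝ => ((p.2 : ℂ)) :=
    Complex.ofRealCLM.differentiable.comp differentiable_snd
  have h3 : Differentiable ℝ fun p : ℝ × ℝ => ((σ p.1 : ℝ) : ℂ) :=
    Complex.ofRealCLM.differentiable.comp (hσd.comp differentiable_fst)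
  have h4 : Differentiable ℝ fun p : ℝ × ℝ => ((deriv σ p.1 : ℝ) : ℂ) :=
    Complex.ofRealCLM.differentiable.comp (hσd'.comp differentiable_fst)
  have h5 : Differentiable ℝ fun p : ℝ × ℝ => tilt σ p.1 p.2 :=
    (Complex.ofRealCLM.differentiable.comp differentiable_fst).add
      ((h2.mul h3).const_mul Complex.I)
  have hmemκ : ∀ p ∈ Set.Icc (a, c) (b, d), DifferentiableAt ℂ κ (z - tilt σ p.1 p.2) :=
    fun p hp => hκ p.1 ⟨hp.1.1, hp.2.1⟩ p.2 ⟨hp.1.2, hp.2.2⟩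
  have hκd : ∀ p ∈ Set.Icc (a, c) (b, d),
      DifferentiableAt ℝ (fun p : ℝ × ℝ => κ (z - tilt σ p.1 p.2)) p := fun p hp =>
    ((hmemκ p hp).restrictScalars ℝ).comp p (h5.differentiableAt.const_sub z)
  have hQd : ∀ p ∈ Set.Icc (a, c) (b, d), DifferentiableAt ℝ Q p := fun p hp =>
    (hTd.differentiableAt.mul (h3.differentiableAt.const_mul Complex.I)).mul (hκd p hp)
  have hPd : ∀ p ∈ Set.Icc (a, c) (b, d), DifferentiableAt ℝ P p := fun p hp =>
    ((hTd.differentiableAt.mul (((h2.mul h4).differentiableAt.const_mul Complex.I).const_add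
      1)).mul (hκd p hp)).neg
  have hdiv : ∀ p ∈ Set.Icc (a, c) (b, d), fderiv ℝ Q p (1, 0) + fderiv ℝ P p (0, 1) =
      taylorDefect f σ N p.1 p.2 * κ (z - tilt σ p.1 p.2) := by
    rintro ⟨t, τ⟩ hp
    have e1 : HasDerivAt (fun t => Q (t, τ)) (fderiv ℝ Q (t, τ) (1, 0)) t :=
      (hQd _ hp).hasFDerivAt.comp_hasDerivAt (f := fun t => (t, τ)) t ((hasDerivAt_id t).prodMk (hasDerivAt_const t τ))
    have e2 : HasDerivAt (fun τ => P (t, τ)) (fderiv ℝ P (t, τ) (0, 1)) τ :=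
      (hPd _ hp).hasFDerivAt.comp_hasDerivAt (f := fun τ => (t, τ)) τ ((hasDerivAt_const τ t).prodMk (hasDerivAt_id τ))
    have hs : HasDerivAt σ (deriv σ t) t := (hσd t).hasDerivAt
    have k0 := (hmemκ _ hp).hasDerivAt
    have k1 := HasDerivAt.scomp t k0 ((hasDerivAt_tilt_left hσ t τ).const_sub z)
    have k2 := HasDerivAt.scomp τ k0 ((hasDerivAt_tilt_right σ t τ).const_sub z)
    have l1 : HasDerivAt (fun τ : ℝ => (1 : ℂ) + Complex.I * ((τ : ℂ) * deriv σ t))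
        (Complex.I * ((deriv σ t : ℝ) : ℂ)) τ := by
      simpa using (((hasDerivAt_id τ).ofReal_comp.mul_const ((deriv σ t : ℝ) : ℂ)).const_mul
        Complex.I).const_add (1 : ℂ)
    have e1' := ((hasDerivAt_taylorExt_left hf hσ N t τ).mul
      (hs.ofReal_comp.const_mul Complex.I)).mul k1
    have e2' := (((hasDerivAt_taylorExt_right f σ N t τ).mul l1).mul k2).neg
    rw [e1.unique e1', e2.unique e2']
    simp only [taylorDefect, Function.comp, smul_eq_mul, Pi.mul_apply]
    ring
  have hcont : ContinuousOn (fun p : ℝ × ℝ => taylorDefect f σ N p.1 p.2 *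
      κ (z - tilt σ p.1 p.2)) (Set.Icc (a, c) (b, d)) :=
    (continuous_taylorDefect hf hσ N).continuousOn.mul fun p hp =>
      (hκd p hp).continuousAt.continuousWithinAt
  have hIoo : ∀ p ∈ Set.Ioo a b ×ˢ Set.Ioo c d, p ∈ Set.Icc (a, c) (b, d) := fun p hp =>
    ⟨⟨hp.1.1.le, hp.2.1.le⟩, ⟨hp.1.2.le, hp.2.2.le⟩⟩
  have key := integral_divergence_prod_Icc_of_hasFDerivAt_of_le Q P (fderiv ℝ Q) (fderiv ℝ P)
    (a, c) (b, d) ⟨hab, hcd⟩ (fun p hp => (hQd p hp).continuousAt.continuousWithinAt)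
    (fun p hp => (hPd p hp).continuousAt.continuousWithinAt)
    (fun p hp => (hQd p (hIoo p hp)).hasFDerivAt) (fun p hp => (hPd p (hIoo p hp)).hasFDerivAt)
    ((hcont.integrableOn_compact isCompact_Icc).congr_fun (fun p hp => (hdiv p hp).symm)
      measurableSet_Icc)
  rw [setIntegral_congr_fun measurableSet_Icc hdiv] at key
  simp only [hQ, hP, intervalIntegral.integral_neg] at key
  unfold taylorCurveIntegral defectIntegral
  rw [key]
  ring

/-! ### Layered extensions with varying truncation order -/

/-- The size `(N_j + 1) m_{N_j + 1} R_j ^ N_j` of the first omitted Taylor term in layer `j`. -/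
noncomputable def layerSize (M : ℕ → ℝ) (R : ℕ → ℝ) (N : ℕ → ℕ) (j : ℕ) : ℝ :=
  ((N j : ℝ) + 1) * normWeight M (N j + 1) * R j ^ N j

/-- Radii and truncation orders adapted to the weights `M`. -/
structure IsTruncation (M : ℕ → ℝ) (R : ℕ → ℝ) (N : ℕ → ℕ) (C ρ : ℝ) : Prop where
  C_pos : 0 < C
  rho_pos : 0 < ρ
  pos : ∀ j, 0 < R j
  succ_le : ∀ j, R (j + 1) ≤ R j
  le_two_mul : ∀ j, R j ≤ 2 * R (j + 1)
  one_le : ∀ j, 1 ≤ N j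
  step : ∀ j, N (j + 1) = N j ∨ N (j + 1) = N j + 1
  size_le : ∀ j k : ℕ, layerSize M R N j ≤ C * ρ ^ k * normWeight M k * (1 / 2) ^ j * R j ^ k

lemma IsTruncation.antitone {M R N C ρ} (h : IsTruncation M R N C ρ) : Antitone R :=
  antitone_nat_of_succ_le h.succ_le

lemma IsTruncation.layerSize_nonneg {M R N C ρ} (h : IsTruncation M R N C ρ) (hM : ∀ n, 0 < M n)
    (j : ℕ) : 0 ≤ layerSize M R N j := by
  have := h.pos j
  have := normWeight_pos hM (N j + 1)
  unfold layerSize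
  positivity

lemma IsTruncation.layerSize_le {M R N C ρ} (h : IsTruncation M R N C ρ) (j : ℕ) :
    layerSize M R N j ≤ C * normWeight M 0 * (1 / 2) ^ j := by
  simpa using h.size_le j 0

lemma IsTruncation.summable_layerSize {M R N C ρ} (h : IsTruncation M R N C ρ)
    (hM : ∀ n, 0 < M n) : Summable (layerSize M R N) :=
  Summable.of_nonneg_of_le (h.layerSize_nonneg hM) h.layerSize_le
    (summable_geometric_two.mul_left _)

/-- Bounds for `f` and the tilt function `σ` over the interval `[a, b]`. -/
structure IsTaylorCell (M : ℕ → ℝ) (f : ℝ → ℂ) (σ : ℝ → ℝ) (R₀ a b A c S s : ℝ) : Prop where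
  lt : a < b
  f_smooth : ContDiff ℝ ∞ f
  sigma_smooth : ContDiff ℝ ∞ σ
  A_nonneg : 0 ≤ A
  c_pos : 0 < c
  S_nonneg : 0 ≤ S
  s_pos : 0 < s
  -- The slope `σ` absorbs the geometric constant of the class, so Taylor terms at height `τ` have
  -- size `A m_n τ ^ n` and the same radii serve all cells.
  bound : ∀ n, ∀ t ∈ Set.Icc a b,
    ‖iteratedDeriv n f t‖ * |σ t| ^ n ≤ A * (n.factorial * normWeight M n)
  lower : ∀ t ∈ Set.Icc a b, c ≤ |σ t|
  upper : ∀ t ∈ Set.Icc a b, R₀ * |σ t| ≤ s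
  deriv_le : ∀ t ∈ Set.Icc a b, |deriv σ t| ≤ S

/-- The extension with truncation order `N_j` in the layer `R_{j+1} < τ ≤ R_j` for `j < J`. -/
noncomputable def layeredExt (f : ℝ → ℂ) (σ : ℝ → ℝ) (R : ℕ → ℝ) (N : ℕ → ℕ) (J : ℕ) (t τ : ℝ) :
    ℂ :=
  taylorExt f σ (N 0) t τ + ∑ j ∈ Finset.range J,
    if τ ≤ R (j + 1) then taylorExt f σ (N (j + 1)) t τ - taylorExt f σ (N j) t τ else 0

/-- The contribution of the layer `j` to the Cauchy integral representation. -/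
noncomputable def layerTerm (f : ℝ → ℂ) (σ : ℝ → ℝ) (κ : ℂ → ℂ) (R : ℕ → ℝ) (N : ℕ → ℕ) (a b : ℝ)
    (j : ℕ) (z : ℂ) : ℂ :=
  (∫ t in a..b, (taylorExt f σ (N (j + 1)) t (R (j + 1)) - taylorExt f σ (N j) t (R (j + 1))) *
      (1 + Complex.I * (R (j + 1) * deriv σ t)) * κ (z - tilt σ t (R (j + 1)))) +
    defectIntegral f σ κ (N j) a b (R (j + 1)) (R j) z

/-- Below `R J` every indicator is on and the sum telescopes. -/
lemma layeredExt_eq_of_le {f : ℝ → ℂ} {σ : ℝ → ℝ} {R : ℕ → ℝ} {N : ℕ → ℕ} (hR : Antitone R)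
    {J : ℕ} {t τ : ℝ} (hτ : τ ≤ R J) : layeredExt f σ R N J t τ = taylorExt f σ (N J) t τ := by
  have : ∀ j ∈ Finset.range J, (if τ ≤ R (j + 1) then
      taylorExt f σ (N (j + 1)) t τ - taylorExt f σ (N j) t τ else 0) =
      taylorExt f σ (N (j + 1)) t τ - taylorExt f σ (N j) t τ := fun j hj =>
    if_pos (hτ.trans (hR (Finset.mem_range.1 hj)))
  rw [layeredExt, Finset.sum_congr rfl this, Finset.sum_range_sub (fun j => taylorExt f σ (N j) t τ)]
  ring

lemma layeredExt_succ_of_lt {f : ℝ → ℂ} {σ : ℝ → ℝ} {R : ℕ → ℝ} {N : ℕ → ℕ}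
    {J : ℕ} {t τ : ℝ} (hτ : R (J + 1) < τ) :
    layeredExt f σ R N (J + 1) t τ = layeredExt f σ R N J t τ := by
  rw [layeredExt, layeredExt, Finset.sum_range_succ, if_neg (not_le.2 hτ), add_zero]

lemma measurable_layeredExt {f : ℝ → ℂ} {σ : ℝ → ℝ} (hf : ContDiff ℝ ∞ f) (hσ : ContDiff ℝ ∞ σ)
    (R : ℕ → ℝ) (N : ℕ → ℕ) (J : ℕ) (t : ℝ) : Measurable (layeredExt f σ R N J t) := by
  have h : ∀ n, Measurable fun τ => taylorExt f σ n t τ := fun n =>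
    ((continuous_taylorExt hf hσ n).comp (Continuous.prodMk_right t)).measurable
  refine (h _).add (Finset.measurable_fun_sum _ fun j _ => ?_)
  exact Measurable.ite measurableSet_Iic ((h _).sub (h _)) measurable_const

set_option maxHeartbeats 400000 in
/-- Cauchy integral representation on the layers above the height `ε`. -/
lemma taylorCurveIntegral_eq_layers {M R N C ρ} (h : IsTruncation M R N C ρ) {f : ℝ → ℂ}
    {σ : ℝ → ℝ} (hf : ContDiff ℝ ∞ f) (hσ : ContDiff ℝ ∞ σ) {κ : ℂ → ℂ} {z : ℂ} {a b : ℝ}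
    (hab : a ≤ b)
    (hκ : ∀ t ∈ Set.Icc a b, ∀ τ ∈ Set.Ioc 0 (R 0), DifferentiableAt ℂ κ (z - tilt σ t τ))
    (J : ℕ) {ε : ℝ} (hε : ε ∈ Set.Ioc 0 (R J)) :
    taylorCurveIntegral f σ κ (N J) a b ε z = taylorCurveIntegral f σ κ (N 0) a b (R 0) z
      + ∑ j ∈ Finset.range J, layerTerm f σ κ R N a b j z + defectIntegral f σ κ (N J) a b ε (R J) z
      - (∫ τ in ε..R 0, layeredExt f σ R N J b τ * (Complex.I * σ b) * κ (z - tilt σ b τ))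
      + (∫ τ in ε..R 0, layeredExt f σ R N J a τ * (Complex.I * σ a) * κ (z - tilt σ a τ)) := by
  have hR := h.antitone
  have hσ1 : Continuous (deriv σ) := (contDiff_infty_iff_deriv.1 hσ).2.continuous
  have hκc : ∀ t ∈ Set.Icc a b, ∀ c ∈ Set.Ioc 0 (R 0), ∀ d ∈ Set.Ioc 0 (R 0), c ≤ d →
      ContinuousOn (fun τ => κ (z - tilt σ t τ)) (Set.uIcc c d) := by
    intro t ht c hc d hd hcd τ hτ
    rw [Set.uIcc_of_le hcd] at hτ
    have h1 := (hκ t ht τ ⟨hc.1.trans_le hτ.1, hτ.2.trans hd.2⟩).continuousAt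
    have h2 : Continuous fun τ => tilt σ t τ :=
      (continuous_tilt hσ).comp (Continuous.prodMk_right t)
    exact (ContinuousAt.comp (f := fun τ => z - tilt σ t τ) (x := τ) h1
      (continuous_const.sub h2).continuousAt).continuousWithinAt
  have hκc' : ∀ τ ∈ Set.Ioc 0 (R 0), ContinuousOn (fun t => κ (z - tilt σ t τ)) (Set.uIcc a b) := by
    intro τ hτ t ht
    rw [Set.uIcc_of_le hab] at ht
    have h2 : Continuous fun t => tilt σ t τ :=
      (continuous_tilt hσ).comp (Continuous.prodMk_left τ)
    exact (ContinuousAt.comp (f := fun t => z - tilt σ t τ) (x := t) (hκ t ht τ hτ).continuousAt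
      (continuous_const.sub h2).continuousAt).continuousWithinAt
  have hTc : ∀ n t, Continuous fun τ => taylorExt f σ n t τ := fun n t =>
    Continuous.comp (g := fun p : ℝ × ℝ => taylorExt f σ n p.1 p.2) (f := fun τ => (t, τ))
      (continuous_taylorExt hf hσ n) (Continuous.prodMk_right t)
  have hTc' : ∀ n τ, Continuous fun t => taylorExt f σ n t τ := fun n τ =>
    Continuous.comp (g := fun p : ℝ × ℝ => taylorExt f σ n p.1 p.2) (f := fun t => (t, τ))
      (continuous_taylorExt hf hσ n) (Continuous.prodMk_left τ)
  have hint : ∀ t ∈ Set.Icc a b, ∀ n, ∀ c ∈ Set.Ioc 0 (R 0), ∀ d ∈ Set.Ioc 0 (R 0), c ≤ d →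
      IntervalIntegrable (fun τ => taylorExt f σ n t τ * (Complex.I * σ t) * κ (z - tilt σ t τ))
        volume c d := by
    intro t ht n c hc d hd hcd
    refine ContinuousOn.intervalIntegrable (ContinuousOn.mul ?_ (hκc t ht c hc d hd hcd))
    exact ((hTc n t).mul continuous_const).continuousOn
  have hmem : ∀ j, R j ∈ Set.Ioc 0 (R 0) := fun j => ⟨h.pos j, hR (Nat.zero_le j)⟩
  have hmain : (∀ t ∈ Set.Icc a b, IntervalIntegrable
        (fun τ => layeredExt f σ R N J t τ * (Complex.I * σ t) * κ (z - tilt σ t τ))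
        volume ε (R 0)) ∧ taylorCurveIntegral f σ κ (N J) a b ε z =
      taylorCurveIntegral f σ κ (N 0) a b (R 0) z
      + ∑ j ∈ Finset.range J, layerTerm f σ κ R N a b j z + defectIntegral f σ κ (N J) a b ε (R J) z
      - (∫ τ in ε..R 0, layeredExt f σ R N J b τ * (Complex.I * σ b) * κ (z - tilt σ b τ))
      + (∫ τ in ε..R 0, layeredExt f σ R N J a τ * (Complex.I * σ a) * κ (z - tilt σ a τ)) := by
    -- Green's formula handles the new bottom layer with its own order, and the induction hypothesis
    -- is used at height `R (J + 1)`. Integrability along the vertical sides is carried along so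
    -- that the pieces can be joined.
    induction J generalizing ε with
    | zero =>
      refine ⟨fun t ht => ?_, ?_⟩
      · simpa [layeredExt] using hint t ht (N 0) ε hε (R 0) (hmem 0) hε.2
      · rw [green_taylorExt hf hσ hab hε.2 (fun t ht τ hτ => hκ t ht τ
          ⟨hε.1.trans_le hτ.1, hτ.2⟩)]
        simp [layeredExt]
        ring
    | succ J ih =>
      obtain ⟨ih1, ih2⟩ := ih (ε := R (J + 1)) ⟨h.pos _, h.succ_le J⟩
      have hε0 : ε ∈ Set.Ioc 0 (R 0) := ⟨hε.1, hε.2.trans (hmem (J + 1)).2⟩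
      have e1 : ∀ t, ∀ τ ∈ Set.uIoc ε (R (J + 1)),
          taylorExt f σ (N (J + 1)) t τ * (Complex.I * σ t) * κ (z - tilt σ t τ) =
          layeredExt f σ R N (J + 1) t τ * (Complex.I * σ t) * κ (z - tilt σ t τ) := by
        intro t τ hτ
        rw [Set.uIoc_of_le hε.2] at hτ
        rw [layeredExt_eq_of_le hR hτ.2]
      have e2 : ∀ t, ∀ τ ∈ Set.uIoc (R (J + 1)) (R 0),
          layeredExt f σ R N J t τ * (Complex.I * σ t) * κ (z - tilt σ t τ) =
          layeredExt f σ R N (J + 1) t τ * (Complex.I * σ t) * κ (z - tilt σ t τ) := by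
        intro t τ hτ
        rw [Set.uIoc_of_le (hmem (J + 1)).2] at hτ
        rw [layeredExt_succ_of_lt hτ.1]
      have i1 : ∀ t ∈ Set.Icc a b, IntervalIntegrable
          (fun τ => layeredExt f σ R N (J + 1) t τ * (Complex.I * σ t) * κ (z - tilt σ t τ))
          volume ε (R (J + 1)) := fun t ht =>
        (hint t ht (N (J + 1)) ε hε0 _ (hmem _) hε.2).congr (e1 t)
      have i2 : ∀ t ∈ Set.Icc a b, IntervalIntegrable
          (fun τ => layeredExt f σ R N (J + 1) t τ * (Complex.I * σ t) * κ (z - tilt σ t τ))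
          volume (R (J + 1)) (R 0) := fun t ht => (ih1 t ht).congr (e2 t)
      refine ⟨fun t ht => (i1 t ht).trans (i2 t ht), ?_⟩
      rw [green_taylorExt hf hσ hab hε.2 (fun t ht τ hτ => hκ t ht τ
          ⟨hε.1.trans_le hτ.1, hτ.2.trans (hmem _).2⟩)]
      have ha : a ∈ Set.Icc a b := ⟨le_rfl, hab⟩
      have hb : b ∈ Set.Icc a b := ⟨hab, le_rfl⟩
      rw [← intervalIntegral.integral_add_adjacent_intervals (i1 a ha) (i2 a ha),
        ← intervalIntegral.integral_add_adjacent_intervals (i1 b hb) (i2 b hb),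
        ← intervalIntegral.integral_congr_ae (Eventually.of_forall (e1 a)),
        ← intervalIntegral.integral_congr_ae (Eventually.of_forall (e1 b)),
        ← intervalIntegral.integral_congr_ae (Eventually.of_forall (e2 a)),
        ← intervalIntegral.integral_congr_ae (Eventually.of_forall (e2 b)),
        Finset.sum_range_succ]
      -- The order changes at height `R (J + 1)`, and the mismatch of the two curve integrals is the
      -- first half of `layerTerm`.
      have hj : (∫ t in a..b, (taylorExt f σ (N (J + 1)) t (R (J + 1)) -
            taylorExt f σ (N J) t (R (J + 1))) *
            (1 + Complex.I * (R (J + 1) * deriv σ t)) * κ (z - tilt σ t (R (J + 1)))) =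
          taylorCurveIntegral f σ κ (N (J + 1)) a b (R (J + 1)) z -
            taylorCurveIntegral f σ κ (N J) a b (R (J + 1)) z := by
        unfold taylorCurveIntegral
        have hi : ∀ n, IntervalIntegrable (fun t => taylorExt f σ n t (R (J + 1)) *
            (1 + Complex.I * (R (J + 1) * deriv σ t)) * κ (z - tilt σ t (R (J + 1))))
            volume a b := fun n => by
          refine ContinuousOn.intervalIntegrable ?_
          refine ContinuousOn.mul (Continuous.continuousOn ?_) (hκc' _ (hmem _))
          have := hTc' n (R (J + 1))
          fun_prop
        rw [← intervalIntegral.integral_sub (hi _) (hi _)]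
        congr 1
        ext t
        ring
      rw [layerTerm, hj, ih2]
      ring
  exact hmain.2

/-! ### Estimates on a cell -/

section Estimates

variable {M : ℕ → ℝ} {R : ℕ → ℝ} {N : ℕ → ℕ} {C ρ : ℝ} {f : ℝ → ℂ} {σ : ℝ → ℝ}
  {a b A c S s : ℝ}

lemma norm_I_mul (τ : ℝ) (hτ : 0 ≤ τ) (x : ℝ) : ‖Complex.I * ((τ : ℂ) * (x : ℂ))‖ = τ * |x| := by
  simp [abs_of_nonneg hτ]

lemma IsTaylorCell.norm_term_le (hc : IsTaylorCell M f σ (R 0) a b A c S s) {t τ : ℝ}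
    (ht : t ∈ Set.Icc a b) (hτ : 0 ≤ τ) (n : ℕ) :
    ‖iteratedDeriv n f t * (Complex.I * (τ * σ t)) ^ n / n.factorial‖ ≤
      A * normWeight M n * τ ^ n := by
  rw [norm_div, norm_mul, norm_pow, norm_I_mul τ hτ, Complex.norm_natCast, mul_pow]
  have h1 := hc.bound n t ht
  have h2 : (0 : ℝ) < n.factorial := by positivity
  rw [div_le_iff₀ h2]
  calc _ = τ ^ n * (‖iteratedDeriv n f t‖ * |σ t| ^ n) := by ring
    _ ≤ τ ^ n * (A * (n.factorial * normWeight M n)) := by gcongr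
    _ = _ := by ring

lemma IsTaylorCell.norm_taylorDefect_le (hc : IsTaylorCell M f σ (R 0) a b A c S s) {t τ : ℝ}
    (ht : t ∈ Set.Icc a b) (hτ : 0 ≤ τ) (n : ℕ) :
    ‖taylorDefect f σ n t τ‖ ≤ A * ((n + 1) * normWeight M (n + 1)) * τ ^ n := by
  rw [taylorDefect, norm_mul, norm_div, norm_mul, norm_pow, norm_I_mul τ hτ, Complex.norm_natCast,
    norm_mul, Complex.norm_I, one_mul, Complex.norm_real, Real.norm_eq_abs, mul_pow]
  have h1 := hc.bound (n + 1) t ht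
  have h2 : (0 : ℝ) < n.factorial := by positivity
  rw [Nat.factorial_succ] at h1
  push_cast at h1
  rw [div_mul_eq_mul_div, div_le_iff₀ h2]
  calc _ = τ ^ n * (‖iteratedDeriv (n + 1) f t‖ * |σ t| ^ (n + 1)) := by ring
    _ ≤ τ ^ n * (A * ((n + 1) * n.factorial * normWeight M (n + 1))) := by gcongr
    _ = _ := by ring

lemma IsTaylorCell.norm_taylorDefect_layer_le (hM : ∀ n, 0 < M n)
    (hc : IsTaylorCell M f σ (R 0) a b A c S s)
    {t τ : ℝ} (ht : t ∈ Set.Icc a b) (hτ : 0 ≤ τ) {j : ℕ} (hτj : τ ≤ R j) :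
    ‖taylorDefect f σ (N j) t τ‖ ≤ A * layerSize M R N j := by
  refine (hc.norm_taylorDefect_le ht hτ (N j)).trans ?_
  have := hc.A_nonneg
  have := normWeight_pos hM (N j + 1)
  unfold layerSize
  rw [mul_assoc]
  gcongr

/-- Consecutive orders agree or differ by one, so at most a single Taylor term remains. One power of
the height is kept separate to offset the kernel later. -/
lemma IsTaylorCell.norm_sub_le (hM : ∀ n, 0 < M n) (h : IsTruncation M R N C ρ)
    (hc : IsTaylorCell M f σ (R 0) a b A c S s)
    {t τ : ℝ} (ht : t ∈ Set.Icc a b) (hτ : 0 ≤ τ) {j : ℕ} (hτj : τ ≤ R (j + 1)) :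
    ‖taylorExt f σ (N (j + 1)) t τ - taylorExt f σ (N j) t τ‖ ≤
      A * layerSize M R N j * R (j + 1) := by
  have hA := hc.A_nonneg
  have hm := normWeight_pos hM (N j + 1)
  have hL := h.layerSize_nonneg hM j
  have hR := h.pos (j + 1)
  rcases h.step j with e | e
  · rw [e, sub_self, norm_zero]; positivity
  · have e2 : taylorExt f σ (N (j + 1)) t τ - taylorExt f σ (N j) t τ =
        iteratedDeriv (N j + 1) f t * (Complex.I * (τ * σ t)) ^ (N j + 1) /
          (N j + 1).factorial := by
      rw [e, taylorExt, taylorExt, Finset.sum_range_succ _ (N j + 1)]; ring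
    rw [e2]
    refine (hc.norm_term_le ht hτ _).trans ?_
    have h3 : τ ≤ R j := hτj.trans (h.succ_le j)
    unfold layerSize
    rw [pow_succ]
    calc A * normWeight M (N j + 1) * (τ ^ N j * τ)
        ≤ A * normWeight M (N j + 1) * (R j ^ N j * R (j + 1)) := by
          have := h.pos j
          gcongr
      _ = A * (1 * normWeight M (N j + 1) * R j ^ N j) * R (j + 1) := by ring
      _ ≤ _ := by
          have := h.pos j
          gcongr
          have : (0 : ℝ) ≤ N j := Nat.cast_nonneg _
          linarith

lemma norm_one_add_I_mul_le {τ x S : ℝ} (hτ : 0 ≤ τ) (hx : |x| ≤ S) :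
    ‖1 + Complex.I * ((τ : ℂ) * (x : ℂ))‖ ≤ 1 + τ * S := by
  refine (norm_add_le _ _).trans ?_
  rw [norm_one, norm_I_mul τ hτ]
  gcongr

lemma norm_setIntegral_rect_le {g : ℝ × ℝ → ℂ} {a b c d K : ℝ} (hab : a ≤ b) (hcd : c ≤ d)
    (hg : ∀ p ∈ Set.Icc (a, c) (b, d), ‖g p‖ ≤ K) :
    ‖∫ p in Set.Icc (a, c) (b, d), g p‖ ≤ K * ((b - a) * (d - c)) := by
  have hv : volume (Set.Icc (a, c) (b, d)) = ENNReal.ofReal (b - a) * ENNReal.ofReal (d - c) := by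
    rw [Measure.volume_eq_prod, ← Set.Icc_prod_Icc, Measure.prod_prod, Real.volume_Icc,
      Real.volume_Icc]
  have h1 := norm_setIntegral_le_of_norm_le_const (μ := volume) (s := Set.Icc (a, c) (b, d))
    (by rw [hv]; exact ENNReal.mul_lt_top ENNReal.ofReal_lt_top ENNReal.ofReal_lt_top) hg
  rwa [Measure.real, hv, ENNReal.toReal_mul, ENNReal.toReal_ofReal (by linarith),
    ENNReal.toReal_ofReal (by linarith)] at h1

/-- Both the mismatch on the curve and the thickness of the layer supply a factor `R j`. It stays
explicit because near the real axis `E` may be comparable to `1 / R (j + 1)`. -/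
lemma IsTaylorCell.norm_layerTerm_le (hM : ∀ n, 0 < M n) (h : IsTruncation M R N C ρ)
    (hc : IsTaylorCell M f σ (R 0) a b A c S s) {κ : ℂ → ℂ} {z : ℂ} {E : ℝ} {j : ℕ}
    (hκ : ∀ t ∈ Set.Icc a b, ∀ τ ∈ Set.Icc (R (j + 1)) (R j), ‖κ (z - tilt σ t τ)‖ ≤ E) :
    ‖layerTerm f σ κ R N a b j z‖ ≤
      (b - a) * A * (2 + R 0 * S) * R j * E * layerSize M R N j := by
  have hA := hc.A_nonneg
  have hL := h.layerSize_nonneg hM j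
  have hab := hc.lt.le
  have hS := hc.S_nonneg
  have hR1 := h.pos (j + 1)
  have hRj := h.pos j
  have hR0 := h.pos 0
  have hRR := h.succ_le j
  have hR0' := h.antitone (Nat.zero_le (j + 1))
  have hE : 0 ≤ E := (norm_nonneg _).trans
    (hκ a ⟨le_rfl, hab⟩ (R j) ⟨hRR, le_rfl⟩)
  have h1 : ‖∫ t in a..b, (taylorExt f σ (N (j + 1)) t (R (j + 1)) -
      taylorExt f σ (N j) t (R (j + 1))) *
      (1 + Complex.I * (R (j + 1) * deriv σ t)) * κ (z - tilt σ t (R (j + 1)))‖ ≤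
      (A * layerSize M R N j * R j * (1 + R 0 * S) * E) * |b - a| := by
    refine intervalIntegral.norm_integral_le_of_norm_le_const fun t ht => ?_
    rw [Set.uIoc_of_le hab] at ht
    have ht' : t ∈ Set.Icc a b := ⟨ht.1.le, ht.2⟩
    rw [norm_mul, norm_mul]
    have h2 := hc.norm_sub_le hM h ht' hR1.le (le_refl (R (j + 1)))
    have h3 := norm_one_add_I_mul_le hR1.le (hc.deriv_le t ht')
    have h4 := hκ t ht' (R (j + 1)) ⟨le_rfl, hRR⟩
    calc _ ≤ A * layerSize M R N j * R (j + 1) * (1 + R (j + 1) * S) * E := by gcongr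
      _ ≤ _ := by gcongr
  have h2 : ‖defectIntegral f σ κ (N j) a b (R (j + 1)) (R j) z‖ ≤
      A * layerSize M R N j * E * ((b - a) * (R j - R (j + 1))) := by
    refine norm_setIntegral_rect_le hab hRR fun p hp => ?_
    have hp1 : p.1 ∈ Set.Icc a b := ⟨hp.1.1, hp.2.1⟩
    have hp2 : p.2 ∈ Set.Icc (R (j + 1)) (R j) := ⟨hp.1.2, hp.2.2⟩
    rw [norm_mul]
    have := hc.norm_taylorDefect_layer_le (N := N) hM hp1 (hR1.le.trans hp2.1) hp2.2
    have := hκ _ hp1 _ hp2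
    gcongr
  rw [abs_of_nonneg (by linarith)] at h1
  refine (norm_add_le _ _).trans ((add_le_add h1 h2).trans ?_)
  have h3 : A * layerSize M R N j * E * ((b - a) * (R j - R (j + 1))) ≤
      A * layerSize M R N j * E * ((b - a) * R j) := by
    have : 0 ≤ b - a := by linarith
    gcongr
    linarith
  calc _ ≤ A * layerSize M R N j * R j * (1 + R 0 * S) * E * (b - a) +
      A * layerSize M R N j * E * ((b - a) * R j) := by gcongr
    _ = _ := by ring

end Estimates

/-! ### Recovering boundary values from the Cauchy kernel -/

lemma contDiff_iteratedDeriv {f : ℝ → ℂ} (hf : ContDiff ℝ ∞ f) (n : ℕ) :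
    ContDiff ℝ ∞ (iteratedDeriv n f) := by
  induction n with
  | zero => simpa using hf
  | succ n ih =>
    rw [iteratedDeriv_succ]
    exact (contDiff_infty_iff_deriv.1 ih).2

lemma contDiff_tilt {σ : ℝ → ℝ} (hσ : ContDiff ℝ ∞ σ) :
    ContDiff ℝ ∞ fun p : ℝ × ℝ => tilt σ p.1 p.2 := by
  have h2 : ContDiff ℝ ∞ fun p : ℝ × ℝ => ((p.2 : ℂ)) :=
    Complex.ofRealCLM.contDiff.comp contDiff_snd
  have h3 : ContDiff ℝ ∞ fun p : ℝ × ℝ => ((σ p.1 : ℝ) : ℂ) :=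
    Complex.ofRealCLM.contDiff.comp (hσ.comp contDiff_fst)
  exact (Complex.ofRealCLM.contDiff.comp contDiff_fst).add (contDiff_const.mul (h2.mul h3))

lemma contDiff_taylorExt {f : ℝ → ℂ} {σ : ℝ → ℝ} (hf : ContDiff ℝ ∞ f) (hσ : ContDiff ℝ ∞ σ)
    (N : ℕ) : ContDiff ℝ ∞ fun p : ℝ × ℝ => taylorExt f σ N p.1 p.2 := by
  have h2 : ContDiff ℝ ∞ fun p : ℝ × ℝ => ((p.2 : ℂ)) :=
    Complex.ofRealCLM.contDiff.comp contDiff_snd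
  have h3 : ContDiff ℝ ∞ fun p : ℝ × ℝ => ((σ p.1 : ℝ) : ℂ) :=
    Complex.ofRealCLM.contDiff.comp (hσ.comp contDiff_fst)
  unfold taylorExt
  refine ContDiff.sum fun n _ => ?_
  have h1 : ContDiff ℝ ∞ fun p : ℝ × ℝ => iteratedDeriv n f p.1 :=
    (contDiff_iteratedDeriv hf n).comp contDiff_fst
  exact (h1.mul ((contDiff_const.mul (h2.mul h3)).pow n)).div_const _

lemma taylorExt_zero (f : ℝ → ℂ) (σ : ℝ → ℝ) (N : ℕ) (t : ℝ) : taylorExt f σ N t 0 = f t := by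
  rw [taylorExt, Finset.sum_range_succ']
  simp

lemma tilt_zero (σ : ℝ → ℝ) (t : ℝ) : tilt σ t 0 = t := by simp [tilt]

lemma tilt_re (σ : ℝ → ℝ) (t τ : ℝ) : (tilt σ t τ).re = t := by simp [tilt]

lemma tilt_im (σ : ℝ → ℝ) (t τ : ℝ) : (tilt σ t τ).im = τ * σ t := by simp [tilt]

lemma tilt_sub_mem_slitPlane {σ : ℝ → ℝ} {t τ : ℝ} (h : τ * σ t ≠ 0) (x : ℝ) :
    tilt σ t τ - x ∈ Complex.slitPlane := by
  rw [Complex.mem_slitPlane_iff]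
  right
  simpa [tilt_im] using h

/-- The part of the Cauchy integral that has the same limit from both sides. -/
lemma tendsto_taylorCurveIntegral_sub_log {f : ℝ → ℂ} {σ : ℝ → ℝ} (hf : ContDiff ℝ ∞ f)
    (hσ : ContDiff ℝ ∞ σ) {a b c : ℝ} (hab : a < b) (hc : 0 < c)
    (hσc : ∀ t ∈ Set.Icc a b, c ≤ |σ t|) (B lam : ℝ) (N : ℕ) (x : ℝ) :
    Tendsto (fun ε : ℝ => taylorCurveIntegral f σ (cutoffKernel B lam) N a b ε x -
        f x * (Complex.log (tilt σ b ε - x) - Complex.log (tilt σ a ε - x))) (𝓝[>] 0)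
      (𝓝 (∫ t in a..b, (f t * cutoffExp B lam (x - t) - f x) / (t - x))) := by
  set G : ℝ × ℝ → ℂ := fun p => taylorExt f σ N p.1 p.2 * cutoffExp B lam (x - tilt σ p.1 p.2)
    with hG
  have hGs : ContDiff ℝ ∞ G := by
    have h1 : ContDiff ℝ ∞ (cutoffExp B lam) :=
      ((differentiable_cutoffExp B lam).contDiff (n := ∞)).restrict_scalars ℝ
    exact (contDiff_taylorExt hf hσ N).mul (h1.comp (contDiff_const.sub (contDiff_tilt hσ)))
  have hG0 : ∀ t, G (t, 0) = f t * cutoffExp B lam (x - t) := fun t => by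
    simp [hG, taylorExt_zero, tilt_zero]
  have hGx : G (x, 0) = f x := by rw [hG0]; simp [cutoffExp_zero]
  set s : Set (ℝ × ℝ) := Set.Icc (min a x) (max b x) ×ˢ Set.Icc 0 1 with hs
  obtain ⟨K, hK⟩ := (hGs.of_le (m := 1) (by simp)).locallyLipschitz.locallyLipschitzOn
    |>.exists_lipschitzOnWith_of_compact (s := s) (isCompact_Icc.prod isCompact_Icc)
  have hxs : (x, (0 : ℝ)) ∈ s := ⟨⟨min_le_right _ _, le_max_right _ _⟩, by simp⟩
  have hσ1 : Continuous (deriv σ) := (contDiff_infty_iff_deriv.1 hσ).2.continuous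
  obtain ⟨S, hS⟩ := (isCompact_Icc (a := a) (b := b)).exists_bound_of_continuousOn
    hσ1.continuousOn
  have hS0 : 0 ≤ S := (norm_nonneg _).trans (hS a ⟨le_rfl, hab.le⟩)
  have hne : ∀ t ∈ Set.Icc a b, ∀ ε : ℝ, 0 < ε → ε * σ t ≠ 0 := fun t ht ε hε => by
    have h1 : σ t ≠ 0 := fun h0 => by
      have h2 := hσc t ht
      rw [h0, abs_zero] at h2
      linarith
    exact mul_ne_zero hε.ne' h1
  have hu : ∀ t ∈ Set.Icc a b, ∀ ε : ℝ, 0 < ε → tilt σ t ε - x ≠ 0 := fun t ht ε hε =>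
    Complex.slitPlane_ne_zero (tilt_sub_mem_slitPlane (hne t ht ε hε) x)
  -- A slope bounded away from zero makes `|ζ - x|`, with `ζ = tilt σ t ε`, comparable to the
  -- distance in parameters. The Lipschitz bound for `G` then bounds `(G - f x) / (ζ - x)` uniformly
  -- in `ε`.
  have hudist : ∀ t ∈ Set.Icc a b, ∀ ε : ℝ, 0 < ε →
      dist (t, ε) (x, (0 : ℝ)) ≤ (1 + 1 / c) * ‖tilt σ t ε - x‖ := by
    intro t ht ε hε
    have h1 := Complex.abs_re_le_norm (tilt σ t ε - x)
    have h2 := Complex.abs_im_le_norm (tilt σ t ε - x)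
    rw [Complex.sub_re, tilt_re, Complex.ofReal_re] at h1
    rw [Complex.sub_im, tilt_im, Complex.ofReal_im, sub_zero, abs_mul, abs_of_pos hε] at h2
    have h3 := hσc t ht
    have h4 : ε ≤ 1 / c * ‖tilt σ t ε - x‖ := by
      rw [one_div_mul_eq_div, le_div_iff₀ hc]
      exact (mul_le_mul_of_nonneg_left h3 hε.le).trans h2
    have h5 : 0 ≤ 1 / c := by positivity
    have h6 := norm_nonneg (tilt σ t ε - x)
    rw [Prod.dist_eq, Real.dist_eq, Real.dist_eq, sub_zero, abs_of_pos hε]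
    refine max_le ?_ ?_
    · nlinarith
    · linarith
  -- The limit does not involve `σ`, so it cancels when the curves above and below are compared.
  have hmain : Tendsto (fun ε : ℝ => ∫ t in a..b, (G (t, ε) - f x) / (tilt σ t ε - x) *
      (1 + Complex.I * (ε * deriv σ t))) (𝓝[>] 0)
      (𝓝 (∫ t in a..b, (f t * cutoffExp B lam (x - t) - f x) / (t - x))) := by
    refine intervalIntegral.tendsto_integral_filter_of_dominated_convergence
      (fun _ => K * (1 + 1 / c) * (1 + 1 * S)) ?_ ?_ intervalIntegrable_const ?_
    · filter_upwards [self_mem_nhdsWithin] with ε hε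
      rw [Set.uIoc_of_le hab.le]
      refine ContinuousOn.aestronglyMeasurable ?_ measurableSet_Ioc
      refine ContinuousOn.mul (ContinuousOn.div ?_ ?_ ?_) ?_
      · have := hGs.continuous
        fun_prop
      · have : Continuous fun t => tilt σ t ε :=
          (continuous_tilt hσ).comp (Continuous.prodMk_left ε)
        fun_prop
      · intro t ht
        exact hu t ⟨ht.1.le, ht.2⟩ ε hε
      · fun_prop
    · filter_upwards [Ioc_mem_nhdsGT (zero_lt_one' ℝ)] with ε hε
      refine Eventually.of_forall fun t ht => ?_
      rw [Set.uIoc_of_le hab.le] at ht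
      have ht' : t ∈ Set.Icc a b := ⟨ht.1.le, ht.2⟩
      have hts : (t, ε) ∈ s :=
        ⟨⟨(min_le_left _ _).trans ht'.1, ht'.2.trans (le_max_left _ _)⟩, hε.1.le, hε.2⟩
      have h1 := hK.dist_le_mul _ hts _ hxs
      rw [dist_eq_norm, hGx] at h1
      have h2 := norm_one_add_I_mul_le hε.1.le (hS t ht')
      rw [norm_mul, norm_div]
      have h3 : 0 < ‖tilt σ t ε - x‖ := norm_pos_iff.2 (hu t ht' ε hε.1)
      have h4 : ‖G (t, ε) - f x‖ / ‖tilt σ t ε - x‖ ≤ K * (1 + 1 / c) := by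
        rw [div_le_iff₀ h3]
        refine h1.trans ?_
        rw [mul_assoc]
        exact mul_le_mul_of_nonneg_left (hudist t ht' ε hε.1) K.2
      have h5 : 1 + ε * S ≤ 1 + 1 * S := by
        have := hε.2
        gcongr
      exact mul_le_mul h4 (h2.trans h5) (norm_nonneg _) ((by positivity : (0:ℝ) ≤ K * (1 + 1 / c)))
    · have hx : ∀ᵐ t : ℝ, t ≠ x := by simp [ae_iff]
      filter_upwards [hx] with t htx _
      have h1 : Continuous fun ε : ℝ => G (t, ε) := hGs.continuous.comp (Continuous.prodMk_right t)
      have h2 : Continuous fun ε : ℝ => tilt σ t ε :=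
        (continuous_tilt hσ).comp (Continuous.prodMk_right t)
      have h3 : Tendsto (fun ε : ℝ => (G (t, ε) - f x) / (tilt σ t ε - x) *
          (1 + Complex.I * (ε * deriv σ t))) (𝓝 0) (𝓝 ((G (t, 0) - f x) / (tilt σ t 0 - x) *
          (1 + Complex.I * ((0 : ℝ) * deriv σ t)))) := by
        refine Tendsto.mul (Tendsto.div ?_ ?_ ?_) ?_
        · exact (h1.sub continuous_const).tendsto 0
        · exact (h2.sub continuous_const).tendsto 0
        · rw [tilt_zero, sub_ne_zero]; exact_mod_cast htx
        · exact (by fun_prop : Continuous fun ε : ℝ =>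
            (1 + Complex.I * ((ε : ℂ) * deriv σ t) : ℂ)).tendsto 0
      rw [hG0, tilt_zero] at h3
      simpa using h3.mono_left nhdsWithin_le_nhds
  refine hmain.congr' ?_
  filter_upwards [self_mem_nhdsWithin] with ε hε
  have hε' : 0 < ε := hε
  have htc : Continuous fun t => tilt σ t ε := (continuous_tilt hσ).comp (Continuous.prodMk_left ε)
  have hlogi : IntervalIntegrable (fun t => (1 + Complex.I * (ε * deriv σ t)) / (tilt σ t ε - x))
      volume a b := by
    refine ContinuousOn.intervalIntegrable (ContinuousOn.div (by fun_prop) (by fun_prop) ?_)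
    rw [Set.uIcc_of_le hab.le]
    exact fun t ht => hu t ht ε hε
  -- The subtracted part is `f x` times the integral of `dζ / (ζ - x)`. The curve stays off the real
  -- axis, so the principal logarithm is a primitive.
  have hlog : ∫ t in a..b, (1 + Complex.I * (ε * deriv σ t)) / (tilt σ t ε - x) =
      Complex.log (tilt σ b ε - x) - Complex.log (tilt σ a ε - x) := by
    refine intervalIntegral.integral_eq_sub_of_hasDerivAt
      (f := fun t => Complex.log (tilt σ t ε - x)) (fun t ht => ?_) hlogi
    rw [Set.uIcc_of_le hab.le] at ht
    exact ((hasDerivAt_tilt_left hσ t ε).sub_const (x : ℂ)).clog_real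
      (tilt_sub_mem_slitPlane (hne t ht ε hε') x)
  rw [← hlog, ← intervalIntegral.integral_const_mul, taylorCurveIntegral,
    ← intervalIntegral.integral_sub]
  · refine intervalIntegral.integral_congr fun t ht => ?_
    rw [Set.uIcc_of_le hab.le] at ht
    have h1 := hu t ht ε hε'
    have h2 : (x : ℂ) - tilt σ t ε ≠ 0 := by
      rw [← neg_sub]; exact neg_ne_zero.2 h1
    simp only [hG, cutoffKernel]
    rw [← neg_sub (tilt σ t ε) (x : ℂ)]
    field_simp
  · refine ContinuousOn.intervalIntegrable (ContinuousOn.mul ?_ ?_)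
    · have : Continuous fun t => taylorExt f σ N t ε :=
        Continuous.comp (g := fun p : ℝ × ℝ => taylorExt f σ N p.1 p.2) (f := fun t => (t, ε))
          (continuous_taylorExt hf hσ N) (Continuous.prodMk_left ε)
      fun_prop
    · rw [Set.uIcc_of_le hab.le]
      refine (differentiableOn_cutoffKernel B lam).continuousOn.comp (by fun_prop) fun t ht => ?_
      have h1 := hu t ht ε hε'
      rw [Set.mem_compl_singleton_iff, ← neg_sub]
      exact neg_ne_zero.2 h1
  · exact hlogi.const_mul _

open ComplexConjugate in
/-- The jump of the logarithm across the negative axis. -/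
lemma tendsto_log_tilt_sub {σ : ℝ → ℝ} {t x : ℝ} (hσ : 0 < σ t) (htx : t ≠ x) :
    Tendsto (fun ε : ℝ => Complex.log (tilt (fun t => -σ t) t ε - x) -
        Complex.log (tilt σ t ε - x)) (𝓝[>] 0)
      (𝓝 (if t < x then -(2 * Real.pi * Complex.I) else 0)) := by
  -- The two tilted points are conjugate, so their logarithms differ by `-2 i arg`. Approached from
  -- above, the argument tends to `π` if `t < x` and to `0` if `t > x`.
  have hev : (fun ε : ℝ => -(2 * ((tilt σ t ε - x).arg : ℂ) * Complex.I)) =ᶠ[𝓝[>] 0]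
      (fun ε : ℝ => Complex.log (tilt (fun t => -σ t) t ε - x) -
        Complex.log (tilt σ t ε - x)) := by
    filter_upwards [self_mem_nhdsWithin] with ε hε
    have hε' : (0 : ℝ) < ε := hε
    have h1 : tilt (fun t => -σ t) t ε - x = conj (tilt σ t ε - x) := by
      apply Complex.ext
      · simp [tilt]
      · simp [tilt]
    have h2 : (tilt σ t ε - x).arg ≠ Real.pi := by
      have := tilt_sub_mem_slitPlane (σ := σ) (t := t) (τ := ε) (by positivity) x
      exact (Complex.mem_slitPlane_iff_arg.1 this).1
    rw [h1, Complex.log_conj _ h2]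
    apply Complex.ext
    · simp [Complex.log_re]
    · simp [Complex.log_im]; ring
  refine Tendsto.congr' hev ?_
  have htend : Tendsto (fun ε : ℝ => tilt σ t ε - x) (𝓝[>] 0) (𝓝 ((t : ℂ) - x)) := by
    have h2 : Continuous fun ε : ℝ => tilt σ t ε - (x : ℂ) := by unfold tilt; fun_prop
    have h3 := (h2.tendsto 0).mono_left (nhdsWithin_le_nhds (s := Set.Ioi 0))
    rwa [tilt_zero] at h3
  have harg : Tendsto (fun ε : ℝ => (tilt σ t ε - x).arg) (𝓝[>] 0)
      (𝓝 (if t < x then Real.pi else 0)) := by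
    split_ifs with h
    · refine (Complex.tendsto_arg_nhdsWithin_im_nonneg_of_re_neg_of_im_zero (z := (t : ℂ) - x)
        (by simpa using h) (by simp)).comp (tendsto_nhdsWithin_iff.2 ⟨htend, ?_⟩)
      filter_upwards [self_mem_nhdsWithin] with ε hε
      have hε' : (0 : ℝ) < ε := hε
      simp [tilt]
      positivity
    · have hpos : 0 < t - x := sub_pos.2 (lt_of_le_of_ne (not_lt.1 h) htx.symm)
      have h0 : ((t : ℂ) - x).arg = 0 := by
        rw [← Complex.ofReal_sub]; exact Complex.arg_ofReal_of_nonneg hpos.le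
      have h1 : ContinuousAt Complex.arg ((t : ℂ) - x) := by
        apply Complex.continuousAt_arg
        rw [← Complex.ofReal_sub, Complex.ofReal_mem_slitPlane]
        exact hpos
      have h2 := h1.tendsto
      rw [h0] at h2
      exact h2.comp htend
  have h4 := ((Complex.continuous_ofReal.tendsto _).comp harg).const_mul (2 : ℂ)
    |>.mul_const Complex.I |>.neg
  refine (h4.congr fun ε => rfl).trans (le_of_eq ?_)
  split_ifs <;> simp

/-- Plemelj type jump relation for the curve integrals from above and below. -/
lemma tendsto_taylorCurveIntegral_jump {f : ℝ → ℂ} {σ : ℝ → ℝ} (hf : ContDiff ℝ ∞ f)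
    (hσ : ContDiff ℝ ∞ σ) {a b c : ℝ} (hab : a < b) (hc : 0 < c)
    (hσc : ∀ t ∈ Set.Icc a b, c ≤ σ t) (B lam : ℝ) (N : ℕ) {x : ℝ} (hxa : x ≠ a) (hxb : x ≠ b) :
    Tendsto (fun ε : ℝ =>
        taylorCurveIntegral f (fun t => -σ t) (cutoffKernel B lam) N a b ε x -
        taylorCurveIntegral f σ (cutoffKernel B lam) N a b ε x) (𝓝[>] 0)
      (𝓝 (if a < x ∧ x < b then 2 * Real.pi * Complex.I * f x else 0)) := by
  have h1 := tendsto_taylorCurveIntegral_sub_log hf hσ hab hc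
    (fun t ht => (hσc t ht).trans (le_abs_self _)) B lam N x
  have h2 := tendsto_taylorCurveIntegral_sub_log hf hσ.neg hab hc
    (fun t ht => by rw [abs_neg]; exact (hσc t ht).trans (le_abs_self _)) B lam N x
  have ha := tendsto_log_tilt_sub (σ := σ) (t := a) (x := x)
    (hc.trans_le (hσc a ⟨le_rfl, hab.le⟩)) hxa.symm
  have hb := tendsto_log_tilt_sub (σ := σ) (t := b) (x := x)
    (hc.trans_le (hσc b ⟨hab.le, le_rfl⟩)) hxb.symm
  have h3 := (h2.sub h1).add ((hb.sub ha).const_mul (f x))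
  rw [sub_self, zero_add] at h3
  have e : f x * ((if b < x then -(2 * (Real.pi : ℂ) * Complex.I) else 0) -
      (if a < x then -(2 * (Real.pi : ℂ) * Complex.I) else 0)) =
      if a < x ∧ x < b then 2 * Real.pi * Complex.I * f x else 0 := by
    rcases lt_or_gt_of_ne hxa with h | h
    · have hb' : ¬ b < x := by linarith
      have ha' : ¬ a < x := by linarith
      simp [hb', ha']
    · rcases lt_or_gt_of_ne hxb with h' | h'
      · have hb' : ¬ b < x := by linarith
        simp [hb', h, h']
        ring
      · have hb' : ¬ x < b := by linarith
        simp [h, h', hb']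
  rw [e] at h3
  refine h3.congr fun ε => ?_
  ring

/-! ### The limit of the layered extensions -/

/-- The limit of `layeredExt` as the number of layers tends to infinity. -/
noncomputable def layeredLim (f : ℝ → ℂ) (σ : ℝ → ℝ) (R : ℕ → ℝ) (N : ℕ → ℕ) (t τ : ℝ) : ℂ :=
  taylorExt f σ (N 0) t τ + ∑' j,
    if τ ≤ R (j + 1) then taylorExt f σ (N (j + 1)) t τ - taylorExt f σ (N j) t τ else 0

/-- The holomorphic layers of the Cauchy integral over the cell `[a, b]`. -/
noncomputable def cellIntegral (f : ℝ → ℂ) (σ : ℝ → ℝ) (κ : ℂ → ℂ) (R : ℕ → ℝ) (N : ℕ → ℕ)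
    (a b : ℝ) (z : ℂ) : ℂ :=
  taylorCurveIntegral f σ κ (N 0) a b (R 0) z + ∑' j, layerTerm f σ κ R N a b j z

/-- The integral of the extension along the vertical segment above `t`. -/
noncomputable def edgeIntegral (f : ℝ → ℂ) (σ : ℝ → ℝ) (κ : ℂ → ℂ) (R : ℕ → ℝ) (N : ℕ → ℕ)
    (t : ℝ) (z : ℂ) : ℂ :=
  ∫ τ in (0 : ℝ)..R 0, layeredLim f σ R N t τ * (Complex.I * σ t) * κ (z - tilt σ t τ)

/-- A bound for the layered extensions of functions with normalized bounds. -/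
noncomputable def extBound (M : ℕ → ℝ) (R : ℕ → ℝ) (N : ℕ → ℕ) : ℝ :=
  ∑ n ∈ Finset.range (N 0 + 1), normWeight M n * R 0 ^ n + R 0 * ∑' j, layerSize M R N j

section Cell

variable {M : ℕ → ℝ} {R : ℕ → ℝ} {N : ℕ → ℕ} {C ρ : ℝ} {f : ℝ → ℂ} {σ : ℝ → ℝ}
  {a b A c S s : ℝ}

lemma IsTaylorCell.neg (hc : IsTaylorCell M f σ (R 0) a b A c S s) :
    IsTaylorCell M f (fun t => -σ t) (R 0) a b A c S s where
  lt := hc.lt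
  f_smooth := hc.f_smooth
  sigma_smooth := hc.sigma_smooth.neg
  A_nonneg := hc.A_nonneg
  c_pos := hc.c_pos
  S_nonneg := hc.S_nonneg
  s_pos := hc.s_pos
  bound n t ht := by simpa using hc.bound n t ht
  lower t ht := by simpa using hc.lower t ht
  upper t ht := by simpa using hc.upper t ht
  deriv_le t ht := by simpa [deriv.fun_neg] using hc.deriv_le t ht

lemma sum_normWeight_nonneg (hM : ∀ n, 0 < M n) (h : IsTruncation M R N C ρ) :
    0 ≤ ∑ n ∈ Finset.range (N 0 + 1), normWeight M n * R 0 ^ n :=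
  Finset.sum_nonneg fun n _ => mul_nonneg (normWeight_pos hM n).le (pow_nonneg (h.pos 0).le n)

lemma extBound_nonneg (hM : ∀ n, 0 < M n) (h : IsTruncation M R N C ρ) : 0 ≤ extBound M R N :=
  add_nonneg (sum_normWeight_nonneg hM h)
    (mul_nonneg (h.pos 0).le (tsum_nonneg (h.layerSize_nonneg hM)))

lemma IsTaylorCell.norm_taylorExt_le (hM : ∀ n, 0 < M n)
    (hc : IsTaylorCell M f σ (R 0) a b A c S s) {t τ : ℝ} (ht : t ∈ Set.Icc a b) (hτ : 0 ≤ τ)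
    (hτR : τ ≤ R 0) (n : ℕ) :
    ‖taylorExt f σ n t τ‖ ≤ A * ∑ i ∈ Finset.range (n + 1), normWeight M i * R 0 ^ i := by
  rw [taylorExt, Finset.mul_sum]
  refine norm_sum_le_of_le _ fun i _ => (hc.norm_term_le ht hτ i).trans ?_
  have := hc.A_nonneg
  have := normWeight_pos hM i
  rw [mul_assoc]
  gcongr

lemma IsTaylorCell.norm_ite_le (hM : ∀ n, 0 < M n) (h : IsTruncation M R N C ρ)
    (hc : IsTaylorCell M f σ (R 0) a b A c S s) {t τ : ℝ} (ht : t ∈ Set.Icc a b) (hτ : 0 ≤ τ)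
    (j : ℕ) : ‖if τ ≤ R (j + 1) then
      taylorExt f σ (N (j + 1)) t τ - taylorExt f σ (N j) t τ else 0‖ ≤
      A * R 0 * layerSize M R N j := by
  have hA := hc.A_nonneg
  have hL := h.layerSize_nonneg hM j
  have hR := h.pos 0
  have hR' := h.antitone (Nat.zero_le (j + 1))
  split_ifs with hj
  · refine (hc.norm_sub_le hM h ht hτ hj).trans ?_
    rw [mul_right_comm]
    gcongr
  · rw [norm_zero]; positivity

lemma IsTaylorCell.tendsto_layeredExt (hM : ∀ n, 0 < M n) (h : IsTruncation M R N C ρ)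
    (hc : IsTaylorCell M f σ (R 0) a b A c S s) {t τ : ℝ} (ht : t ∈ Set.Icc a b) (hτ : 0 ≤ τ) :
    Tendsto (fun J => layeredExt f σ R N J t τ) atTop (𝓝 (layeredLim f σ R N t τ)) := by
  have hs : Summable fun j => if τ ≤ R (j + 1) then
      taylorExt f σ (N (j + 1)) t τ - taylorExt f σ (N j) t τ else 0 :=
    Summable.of_norm_bounded ((h.summable_layerSize hM).mul_left (A * R 0))
      (hc.norm_ite_le hM h ht hτ)
  exact hs.hasSum.tendsto_sum_nat.const_add _

lemma IsTaylorCell.norm_layeredExt_le (hM : ∀ n, 0 < M n) (h : IsTruncation M R N C ρ)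
    (hc : IsTaylorCell M f σ (R 0) a b A c S s) {t τ : ℝ} (ht : t ∈ Set.Icc a b) (hτ : 0 ≤ τ)
    (hτR : τ ≤ R 0) (J : ℕ) : ‖layeredExt f σ R N J t τ‖ ≤ A * extBound M R N := by
  have hA := hc.A_nonneg
  have hR := h.pos 0
  rw [layeredExt, extBound, mul_add]
  refine (norm_add_le _ _).trans (add_le_add (hc.norm_taylorExt_le hM ht hτ hτR _) ?_)
  refine (norm_sum_le_of_le _ fun j _ => hc.norm_ite_le hM h ht hτ j).trans ?_
  rw [← Finset.mul_sum, ← mul_assoc]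
  gcongr
  exact (h.summable_layerSize hM).sum_le_tsum _ fun j _ => h.layerSize_nonneg hM j

lemma IsTaylorCell.norm_layeredLim_le (hM : ∀ n, 0 < M n) (h : IsTruncation M R N C ρ)
    (hc : IsTaylorCell M f σ (R 0) a b A c S s) {t τ : ℝ} (ht : t ∈ Set.Icc a b) (hτ : 0 ≤ τ)
    (hτR : τ ≤ R 0) : ‖layeredLim f σ R N t τ‖ ≤ A * extBound M R N :=
  le_of_tendsto (hc.tendsto_layeredExt hM h ht hτ).norm
    (Eventually.of_forall fun J => hc.norm_layeredExt_le hM h ht hτ hτR J)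

lemma IsTaylorCell.aestronglyMeasurable_layeredLim (hM : ∀ n, 0 < M n)
    (h : IsTruncation M R N C ρ) (hc : IsTaylorCell M f σ (R 0) a b A c S s) {t : ℝ}
    (ht : t ∈ Set.Icc a b) :
    AEStronglyMeasurable (layeredLim f σ R N t) (volume.restrict (Set.Ioc 0 (R 0))) := by
  refine aestronglyMeasurable_of_tendsto_ae atTop (f := fun J => layeredExt f σ R N J t)
    (fun J => (measurable_layeredExt hc.f_smooth hc.sigma_smooth R N J t).aestronglyMeasurable) ?_
  filter_upwards [ae_restrict_mem measurableSet_Ioc] with τ hτ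
  exact hc.tendsto_layeredExt hM h ht hτ.1.le

lemma IsTaylorCell.abs_sigma_le (hc : IsTaylorCell M f σ (R 0) a b A c S s) {t τ : ℝ} (ht : t ∈ Set.Icc a b) (hτ : 0 ≤ τ)
    (hτR : τ ≤ R 0) : |(tilt σ t τ).im| ≤ s := by
  rw [tilt_im, abs_mul, abs_of_nonneg hτ]
  exact (mul_le_mul_of_nonneg_right hτR (abs_nonneg _)).trans (hc.upper t ht)

/-- Vertical integrals converge when the number of layers grows. -/
lemma IsTaylorCell.tendsto_edgeIntegral (hM : ∀ n, 0 < M n) (h : IsTruncation M R N C ρ)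
    (hc : IsTaylorCell M f σ (R 0) a b A c S s) {t : ℝ} (ht : t ∈ Set.Icc a b) {κ : ℂ → ℂ} {z : ℂ}
    (hκ : Continuous fun τ => κ (z - tilt σ t τ)) :
    (∀ J, IntervalIntegrable (fun τ => layeredExt f σ R N J t τ * (Complex.I * σ t) *
      κ (z - tilt σ t τ)) volume 0 (R 0)) ∧
    IntervalIntegrable (fun τ => layeredLim f σ R N t τ * (Complex.I * σ t) *
      κ (z - tilt σ t τ)) volume 0 (R 0) ∧
    Tendsto (fun J => ∫ τ in (0 : ℝ)..R 0, layeredExt f σ R N J t τ * (Complex.I * σ t) *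
      κ (z - tilt σ t τ)) atTop (𝓝 (edgeIntegral f σ κ R N t z)) := by
  have hR0 := (h.pos 0).le
  obtain ⟨E, hE⟩ := (isCompact_Icc (a := (0 : ℝ)) (b := R 0)).exists_bound_of_continuousOn
    hκ.continuousOn
  have hm : ∀ J, AEStronglyMeasurable (fun τ => layeredExt f σ R N J t τ * (Complex.I * σ t) *
      κ (z - tilt σ t τ)) (volume.restrict (Set.Ioc 0 (R 0))) := fun J =>
    ((measurable_layeredExt hc.f_smooth hc.sigma_smooth R N J t).aestronglyMeasurable.mul_const
      _).mul hκ.aestronglyMeasurable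
  have hml : AEStronglyMeasurable (fun τ => layeredLim f σ R N t τ * (Complex.I * σ t) *
      κ (z - tilt σ t τ)) (volume.restrict (Set.Ioc 0 (R 0))) :=
    ((hc.aestronglyMeasurable_layeredLim hM h ht).mul_const _).mul hκ.aestronglyMeasurable
  have hbd : ∀ g : ℝ → ℂ, (∀ τ ∈ Set.Ioc 0 (R 0), ‖g τ‖ ≤ A * extBound M R N) →
      ∀ τ ∈ Set.Ioc 0 (R 0), ‖g τ * (Complex.I * σ t) * κ (z - tilt σ t τ)‖ ≤
      A * extBound M R N * ‖Complex.I * (σ t : ℂ)‖ * E := by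
    intro g hg τ hτ
    rw [norm_mul, norm_mul]
    have h1 := hg τ hτ
    have h2 := hE τ ⟨hτ.1.le, hτ.2⟩
    have h3 : 0 ≤ A * extBound M R N := mul_nonneg hc.A_nonneg (extBound_nonneg hM h)
    gcongr
  have hi : ∀ g : ℝ → ℂ, AEStronglyMeasurable (fun τ => g τ * (Complex.I * σ t) *
      κ (z - tilt σ t τ)) (volume.restrict (Set.Ioc 0 (R 0))) →
      (∀ τ ∈ Set.Ioc 0 (R 0), ‖g τ‖ ≤ A * extBound M R N) →
      IntervalIntegrable (fun τ => g τ * (Complex.I * σ t) * κ (z - tilt σ t τ))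
        volume 0 (R 0) := by
    intro g hg hgb
    rw [intervalIntegrable_iff_integrableOn_Ioc_of_le hR0]
    refine Integrable.mono' (g := fun _ => A * extBound M R N * ‖Complex.I * (σ t : ℂ)‖ * E)
      (integrableOn_const (by simp)) hg ?_
    filter_upwards [ae_restrict_mem measurableSet_Ioc] with τ hτ
    exact hbd g hgb τ hτ
  have hbJ : ∀ J, ∀ τ ∈ Set.Ioc 0 (R 0), ‖layeredExt f σ R N J t τ‖ ≤ A * extBound M R N :=
    fun J τ hτ => hc.norm_layeredExt_le hM h ht hτ.1.le hτ.2 J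
  refine ⟨fun J => hi _ (hm J) (hbJ J), hi _ hml fun τ hτ =>
    hc.norm_layeredLim_le hM h ht hτ.1.le hτ.2, ?_⟩
  refine intervalIntegral.tendsto_integral_filter_of_dominated_convergence
    (fun _ => A * extBound M R N * ‖Complex.I * (σ t : ℂ)‖ * E) ?_ ?_ intervalIntegrable_const ?_
  · refine Eventually.of_forall fun J => ?_
    rw [Set.uIoc_of_le hR0]
    exact hm J
  · refine Eventually.of_forall fun J => Eventually.of_forall fun τ hτ => ?_
    rw [Set.uIoc_of_le hR0] at hτ
    exact hbd _ (hbJ J) τ hτ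
  · refine Eventually.of_forall fun τ hτ => ?_
    rw [Set.uIoc_of_le hR0] at hτ
    exact ((hc.tendsto_layeredExt hM h ht hτ.1.le).mul_const _).mul_const _

lemma continuous_kernel_comp {κ : ℂ → ℂ} (hκ : DifferentiableOn ℂ κ {0}ᶜ) (σ : ℝ → ℝ) {t x : ℝ}
    (hx : x ≠ t) : Continuous fun τ : ℝ => κ (x - tilt σ t τ) := by
  refine hκ.continuousOn.comp_continuous (by unfold tilt; fun_prop) fun τ h0 => hx ?_
  have h1 := congrArg Complex.re (Set.mem_singleton_iff.1 h0)
  rw [Complex.sub_re, tilt_re] at h1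
  simpa [sub_eq_zero] using h1

/-- In the bottom strip the kernel can be as large as a multiple of `1 / τ`, and `1 ≤ N J` supplies
a power of `τ` to cancel it. The bound is uniform in `ε` and tends to zero as `J` grows. -/
lemma IsTaylorCell.norm_defectIntegral_le (hM : ∀ n, 0 < M n) (h : IsTruncation M R N C ρ)
    (hc : IsTaylorCell M f σ (R 0) a b A c S s) {B lam : ℝ} (hl : 0 ≤ lam) (hB : 0 ≤ B)
    (hBs : 2 * B * s ≤ 1) (x : ℝ) (J : ℕ) {ε : ℝ} (hε : ε ∈ Set.Ioc 0 (R J)) :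
    ‖defectIntegral f σ (cutoffKernel B lam) (N J) a b ε (R J) x‖ ≤
      A * Real.exp lam / c * (b - a) * layerSize M R N J := by
  have hA := hc.A_nonneg
  have hcp := hc.c_pos
  have hm := normWeight_pos hM (N J + 1)
  have hR := h.pos J
  have hab := hc.lt.le
  have hs := hc.s_pos
  obtain ⟨n, hn⟩ := Nat.exists_eq_add_of_le (h.one_le J)
  have key : ∀ p ∈ Set.Icc (a, ε) (b, R J), ‖taylorDefect f σ (N J) p.1 p.2 *
      cutoffKernel B lam (x - tilt σ p.1 p.2)‖ ≤
      A * Real.exp lam / c * ((N J + 1) * normWeight M (N J + 1) * R J ^ n) := by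
    rintro ⟨t, τ⟩ hp
    have ht : t ∈ Set.Icc a b := ⟨hp.1.1, hp.2.1⟩
    have hτ : 0 < τ := hε.1.trans_le hp.1.2
    have hτR : τ ≤ R J := hp.2.2
    have h1 := hc.norm_taylorDefect_le ht hτ.le (N J)
    have him : ((x : ℂ) - tilt σ t τ).im = -(τ * σ t) := by simp [tilt_im]
    have h2 := norm_cutoffKernel_le (B := B) hl (w := x - tilt σ t τ) (η := τ * c) (by
      have h3 := hc.abs_sigma_le ht hτ.le (hτR.trans (h.antitone (Nat.zero_le J)))
      rw [tilt_im] at h3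
      rw [him, abs_mul, abs_of_nonneg hB, abs_neg]
      nlinarith) (by positivity) (by
      rw [him, abs_neg, abs_mul, abs_of_pos hτ]
      have := hc.lower t ht
      gcongr)
    rw [norm_mul]
    calc _ ≤ A * ((N J + 1) * normWeight M (N J + 1)) * τ ^ N J * (Real.exp lam / (τ * c)) := by
          gcongr
      _ = A * Real.exp lam / c * ((N J + 1) * normWeight M (N J + 1) * τ ^ n) := by
          rw [hn, pow_add]; field_simp
      _ ≤ _ := by gcongr
  refine (norm_setIntegral_rect_le hab hε.2 key).trans ?_
  have h2 : 0 ≤ b - a := by linarith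
  have h3 : R J - ε ≤ R J := by linarith [hε.1]
  calc _ ≤ A * Real.exp lam / c * ((N J + 1) * normWeight M (N J + 1) * R J ^ n) *
        ((b - a) * R J) := by gcongr
    _ = _ := by rw [layerSize, hn, pow_add]; ring

/-- `R j ≤ 2 R (j + 1)` lets the factor `R j` compensate the kernel. Nonreal `z` are allowed, up to
half the height of the layer, because Cauchy's estimates will be applied there. -/
lemma IsTaylorCell.norm_layerTerm_cutoff_le (hM : ∀ n, 0 < M n) (h : IsTruncation M R N C ρ)
    (hc : IsTaylorCell M f σ (R 0) a b A c S s) {B lam : ℝ} (hl : 0 ≤ lam) (hB : 0 ≤ B)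
    (hBs : 2 * B * s ≤ 1) {z : ℂ} {j : ℕ} (hz : |z.im| ≤ c / 2 * R (j + 1)) :
    ‖layerTerm f σ (cutoffKernel B lam) R N a b j z‖ ≤
      (b - a) * A * (2 + R 0 * S) * (4 * (Real.exp lam / c)) * layerSize M R N j := by
  have hcp := hc.c_pos
  have hs := hc.s_pos
  have hR1 := h.pos (j + 1)
  have h1 := hc.norm_layerTerm_le hM h (κ := cutoffKernel B lam) (z := z) (j := j)
    (E := Real.exp lam / (c / 2 * R (j + 1))) fun t ht τ hτ => by
      have hτ0 : 0 < τ := hR1.trans_le hτ.1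
      have h3 := hc.abs_sigma_le ht hτ0.le (hτ.2.trans (h.antitone (Nat.zero_le j)))
      have h4 : c * R (j + 1) ≤ |(tilt σ t τ).im| := by
        rw [tilt_im, abs_mul, abs_of_pos hτ0, mul_comm]
        have := hc.lower t ht
        have := hτ.1
        gcongr
      refine norm_cutoffKernel_le hl ?_ (by positivity) ?_
      · rw [abs_mul, abs_of_nonneg hB, Complex.sub_im]
        have h5 := abs_sub z.im (tilt σ t τ).im
        nlinarith
      · rw [Complex.sub_im, abs_sub_comm]
        have h5 := abs_sub_abs_le_abs_sub (tilt σ t τ).im z.im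
        linarith
  refine h1.trans ?_
  have hA := hc.A_nonneg
  have hS := hc.S_nonneg
  have hR0 := h.pos 0
  have hab : 0 ≤ b - a := by linarith [hc.lt]
  have hL := h.layerSize_nonneg hM j
  have h2 : R j * (Real.exp lam / (c / 2 * R (j + 1))) ≤ 4 * (Real.exp lam / c) := by
    have : R j * (Real.exp lam / (c / 2 * R (j + 1))) = 2 * (R j / R (j + 1)) *
        (Real.exp lam / c) := by
      field_simp
    rw [this]
    gcongr
    have : R j / R (j + 1) ≤ 2 := by
      rw [div_le_iff₀ hR1]
      exact h.le_two_mul j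
    linarith
  rw [mul_assoc _ (R j)]
  gcongr

lemma IsTaylorCell.summable_layerTerm (hM : ∀ n, 0 < M n) (h : IsTruncation M R N C ρ)
    (hc : IsTaylorCell M f σ (R 0) a b A c S s) {B lam : ℝ} (hl : 0 ≤ lam) (hB : 0 ≤ B)
    (hBs : 2 * B * s ≤ 1) (x : ℝ) :
    Summable fun j => layerTerm f σ (cutoffKernel B lam) R N a b j x :=
  Summable.of_norm_bounded ((h.summable_layerSize hM).mul_left _) fun j =>
    hc.norm_layerTerm_cutoff_le hM h hl hB hBs (by
      have := hc.c_pos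
      have := h.pos (j + 1)
      rw [Complex.ofReal_im, abs_zero]
      positivity)

/-- The difference of the two boundary values of the Cauchy integral over a cell. -/
theorem IsTaylorCell.jump (hM : ∀ n, 0 < M n) (h : IsTruncation M R N C ρ)
    (hc : IsTaylorCell M f σ (R 0) a b A c S s) (hσ : ∀ t ∈ Set.Icc a b, 0 < σ t) {B lam : ℝ}
    (hl : 0 ≤ lam) (hB : 0 ≤ B) (hBs : 2 * B * s ≤ 1) {x : ℝ} (hxa : x ≠ a) (hxb : x ≠ b) :
    (cellIntegral f (fun t => -σ t) (cutoffKernel B lam) R N a b x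
      - edgeIntegral f (fun t => -σ t) (cutoffKernel B lam) R N b x
      + edgeIntegral f (fun t => -σ t) (cutoffKernel B lam) R N a x) -
    (cellIntegral f σ (cutoffKernel B lam) R N a b x
      - edgeIntegral f σ (cutoffKernel B lam) R N b x
      + edgeIntegral f σ (cutoffKernel B lam) R N a x) =
    if a < x ∧ x < b then 2 * Real.pi * Complex.I * f x else 0 := by
  set κ := cutoffKernel B lam with hκ
  have hab := hc.lt.le
  have ha : a ∈ Set.Icc a b := ⟨le_rfl, hab⟩
  have hb : b ∈ Set.Icc a b := ⟨hab, le_rfl⟩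
  have hκd : DifferentiableOn ℂ κ {0}ᶜ := differentiableOn_cutoffKernel B lam
  -- `P` is the representation by layers without the defect of the bottom strip. First `ε → 0` with
  -- `J` fixed, where the jump relation applies; then `J → ∞`, where the omitted defect vanishes.
  set P : (ℝ → ℝ) → ℕ → ℝ → ℂ := fun σ J ε => taylorCurveIntegral f σ κ (N 0) a b (R 0) x
      + ∑ j ∈ Finset.range J, layerTerm f σ κ R N a b j x
      - (∫ τ in ε..R 0, layeredExt f σ R N J b τ * (Complex.I * σ b) * κ (x - tilt σ b τ))
      + (∫ τ in ε..R 0, layeredExt f σ R N J a τ * (Complex.I * σ a) * κ (x - tilt σ a τ)) with hP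
  have main : ∀ σ' : ℝ → ℝ, IsTaylorCell M f σ' (R 0) a b A c S s →
      (∀ J, ∀ ε ∈ Set.Ioc 0 (R J), ‖taylorCurveIntegral f σ' κ (N J) a b ε x - P σ' J ε‖ ≤
        A * Real.exp lam / c * (b - a) * layerSize M R N J) ∧
      (∀ J, Tendsto (P σ' J) (𝓝[>] 0) (𝓝 (P σ' J 0))) ∧
      Tendsto (fun J => P σ' J 0) atTop (𝓝 (cellIntegral f σ' κ R N a b x
        - edgeIntegral f σ' κ R N b x + edgeIntegral f σ' κ R N a x)) := by
    intro σ' hc'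
    obtain ⟨ia, -, la⟩ := hc'.tendsto_edgeIntegral hM h ha (continuous_kernel_comp hκd σ' hxa)
    obtain ⟨ib, -, lb⟩ := hc'.tendsto_edgeIntegral hM h hb (continuous_kernel_comp hκd σ' hxb)
    refine ⟨fun J ε hε => ?_, fun J => ?_, ?_⟩
    · rw [taylorCurveIntegral_eq_layers h hc'.f_smooth hc'.sigma_smooth hab
        (fun t ht τ hτ => hκd.differentiableAt (isOpen_compl_singleton.mem_nhds fun h0 => ?_))
        J hε]
      · refine le_trans (le_of_eq ?_) (hc'.norm_defectIntegral_le hM h hl hB hBs x J hε)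
        simp only [hP]
        congr 1
        ring
      · have h1 := congrArg Complex.im (Set.mem_singleton_iff.1 h0)
        rw [Complex.sub_im, tilt_im] at h1
        have h2 := hc'.lower t ht
        have h3 := hc'.c_pos
        have h4 : τ * σ' t = 0 := by simpa using h1
        rcases mul_eq_zero.1 h4 with h5 | h5
        · exact hτ.1.ne' h5
        · rw [h5, abs_zero] at h2; linarith
    · have hcv : ∀ g : ℝ → ℂ, IntervalIntegrable g volume 0 (R 0) →
          Tendsto (fun ε => ∫ τ in ε..R 0, g τ) (𝓝[>] 0) (𝓝 (∫ τ in (0 : ℝ)..R 0, g τ)) := by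
        intro g hg
        have h1 := intervalIntegral.continuousOn_primitive_interval' hg
          (a := R 0) Set.right_mem_uIcc 0 Set.left_mem_uIcc
        rw [ContinuousWithinAt, Set.uIcc_of_le (h.pos 0).le] at h1
        have h2 := (h1.mono_left (nhdsWithin_le_of_mem
          (mem_of_superset (Ioc_mem_nhdsGT (h.pos 0)) Set.Ioc_subset_Icc_self))).neg
        rw [← intervalIntegral.integral_symm] at h2
        exact h2.congr fun ε => (intervalIntegral.integral_symm _ _).symm
      exact (tendsto_const_nhds.sub (hcv _ (ib J))).add (hcv _ (ia J))
    · exact (((hc'.summable_layerTerm hM h hl hB hBs x).hasSum.tendsto_sum_nat.const_add _).sub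
        lb).add la
  obtain ⟨p1, p2, p3⟩ := main σ hc
  obtain ⟨n1, n2, n3⟩ := main _ hc.neg
  set v : ℂ := if a < x ∧ x < b then 2 * Real.pi * Complex.I * f x else 0 with hv
  have hJ : ∀ J, ‖v - (P (fun t => -σ t) J 0 - P σ J 0)‖ ≤
      2 * (A * Real.exp lam / c * (b - a) * layerSize M R N J) := by
    intro J
    have hjump := tendsto_taylorCurveIntegral_jump hc.f_smooth hc.sigma_smooth hc.lt hc.c_pos
      (fun t ht => (hc.lower t ht).trans (abs_of_pos (hσ t ht)).le) B lam (N J) hxa hxb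
    refine le_of_tendsto (hjump.sub ((n2 J).sub (p2 J))).norm ?_
    filter_upwards [Ioc_mem_nhdsGT (h.pos J)] with ε hε
    have e1 := p1 J ε hε
    have e2 := n1 J ε hε
    rw [sub_sub_sub_comm, two_mul]
    exact (_root_.norm_sub_le _ _).trans (add_le_add e2 e1)
  have hz : Tendsto (fun J => 2 * (A * Real.exp lam / c * (b - a) * layerSize M R N J)) atTop
      (𝓝 0) := by
    simpa using ((h.summable_layerSize hM).tendsto_atTop_zero.const_mul
      (A * Real.exp lam / c * (b - a))).const_mul 2
  have hlim := le_of_tendsto_of_tendsto (tendsto_const_nhds.sub (n3.sub p3)).norm hz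
    (Eventually.of_forall hJ)
  exact (sub_eq_zero.1 (norm_le_zero_iff.1 hlim)).symm

end Cell

/-! ### Regularity and decay of cell and edge integrals -/

lemma differentiableOn_intervalIntegral_kernel {g Φ : ℝ → ℂ} {a b : ℝ} (hab : a ≤ b)
    (hg : IntervalIntegrable g volume a b) (hΦ : Continuous Φ) {κ : ℂ → ℂ} (hκm : Measurable κ)
    {W U : Set ℂ} (hW : IsOpen W) (hU : IsOpen U) (hκ : DifferentiableOn ℂ κ W)
    (hUW : ∀ z ∈ U, ∀ t ∈ Set.Icc a b, z - Φ t ∈ W) :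
    DifferentiableOn ℂ (fun z => ∫ t in a..b, g t * κ (z - Φ t)) U := by
  simp_rw [intervalIntegral.integral_of_le hab]
  refine differentiableOn_integral_kernel (K := Φ '' Set.Icc a b) hg.1 hΦ.aemeasurable hκm hW hU
    (isCompact_Icc.image hΦ) hκ ?_ ?_
  · filter_upwards [ae_restrict_mem measurableSet_Ioc] with t ht
    exact ⟨t, ⟨ht.1.le, ht.2⟩, rfl⟩
  · rintro z hz _ ⟨t, ht, rfl⟩
    exact hUW z hz t ht

lemma differentiableOn_taylorCurveIntegral {f : ℝ → ℂ} {σ : ℝ → ℝ} (hf : ContDiff ℝ ∞ f)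
    (hσ : ContDiff ℝ ∞ σ) {a b : ℝ} (hab : a ≤ b) {κ : ℂ → ℂ} (hκm : Measurable κ)
    {W U : Set ℂ} (hW : IsOpen W) (hU : IsOpen U) (hκ : DifferentiableOn ℂ κ W) {τ : ℝ}
    (hUW : ∀ z ∈ U, ∀ t ∈ Set.Icc a b, z - tilt σ t τ ∈ W) (n : ℕ) :
    DifferentiableOn ℂ (taylorCurveIntegral f σ κ n a b τ) U := by
  have hσ1 : Continuous (deriv σ) := (contDiff_infty_iff_deriv.1 hσ).2.continuous
  have h1 : Continuous fun t => taylorExt f σ n t τ :=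
    Continuous.comp (g := fun p : ℝ × ℝ => taylorExt f σ n p.1 p.2) (f := fun t => (t, τ))
      (continuous_taylorExt hf hσ n) (Continuous.prodMk_left τ)
  have h2 : Continuous fun t => tilt σ t τ :=
    Continuous.comp (g := fun p : ℝ × ℝ => tilt σ p.1 p.2) (f := fun t => (t, τ))
      (continuous_tilt hσ) (Continuous.prodMk_left τ)
  have h3 : Continuous fun t => taylorExt f σ n t τ * (1 + Complex.I * (τ * deriv σ t)) := by
    fun_prop
  exact differentiableOn_intervalIntegral_kernel hab (h3.intervalIntegrable _ _) h2 hκm hW hU hκ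
    hUW

lemma differentiableOn_defectIntegral {f : ℝ → ℂ} {σ : ℝ → ℝ} (hf : ContDiff ℝ ∞ f)
    (hσ : ContDiff ℝ ∞ σ) {a b c d : ℝ} {κ : ℂ → ℂ} (hκm : Measurable κ)
    {W U : Set ℂ} (hW : IsOpen W) (hU : IsOpen U) (hκ : DifferentiableOn ℂ κ W)
    (hUW : ∀ z ∈ U, ∀ t ∈ Set.Icc a b, ∀ τ ∈ Set.Icc c d, z - tilt σ t τ ∈ W) (n : ℕ) :
    DifferentiableOn ℂ (defectIntegral f σ κ n a b c d) U := by
  refine differentiableOn_integral_kernel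
    (K := (fun p : ℝ × ℝ => tilt σ p.1 p.2) '' Set.Icc (a, c) (b, d))
    ((continuous_taylorDefect hf hσ n).continuousOn.integrableOn_compact isCompact_Icc)
    (continuous_tilt hσ).aemeasurable hκm hW hU
    (isCompact_Icc.image (continuous_tilt hσ)) hκ ?_ ?_
  · filter_upwards [ae_restrict_mem measurableSet_Icc] with p hp
    exact ⟨p, hp, rfl⟩
  · rintro z hz _ ⟨p, hp, rfl⟩
    exact hUW z hz _ ⟨hp.1.1, hp.2.1⟩ _ ⟨hp.1.2, hp.2.2⟩

lemma differentiableOn_layerTerm {f : ℝ → ℂ} {σ : ℝ → ℝ} (hf : ContDiff ℝ ∞ f)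
    (hσ : ContDiff ℝ ∞ σ) {a b : ℝ} (hab : a ≤ b) {κ : ℂ → ℂ} (hκm : Measurable κ)
    {W U : Set ℂ} (hW : IsOpen W) (hU : IsOpen U) (hκ : DifferentiableOn ℂ κ W) {R : ℕ → ℝ}
    {j : ℕ} (hR : R (j + 1) ≤ R j)
    (hUW : ∀ z ∈ U, ∀ t ∈ Set.Icc a b, ∀ τ ∈ Set.Icc (R (j + 1)) (R j), z - tilt σ t τ ∈ W)
    (N : ℕ → ℕ) : DifferentiableOn ℂ (layerTerm f σ κ R N a b j) U := by
  have hσ1 : Continuous (deriv σ) := (contDiff_infty_iff_deriv.1 hσ).2.continuous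
  have h1 : ∀ n, Continuous fun t => taylorExt f σ n t (R (j + 1)) := fun n =>
    Continuous.comp (g := fun p : ℝ × ℝ => taylorExt f σ n p.1 p.2) (f := fun t => (t, R (j + 1)))
      (continuous_taylorExt hf hσ n) (Continuous.prodMk_left _)
  have h2 : Continuous fun t => tilt σ t (R (j + 1)) :=
    Continuous.comp (g := fun p : ℝ × ℝ => tilt σ p.1 p.2) (f := fun t => (t, R (j + 1)))
      (continuous_tilt hσ) (Continuous.prodMk_left _)
  have h3 : Continuous fun t => (taylorExt f σ (N (j + 1)) t (R (j + 1)) -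
      taylorExt f σ (N j) t (R (j + 1))) * (1 + Complex.I * (R (j + 1) * deriv σ t)) := by
    have := h1 (N (j + 1))
    have := h1 (N j)
    fun_prop
  exact (differentiableOn_intervalIntegral_kernel hab (h3.intervalIntegrable _ _) h2 hκm hW hU hκ
    fun z hz t ht => hUW z hz t ht _ ⟨le_rfl, hR⟩).add
    (differentiableOn_defectIntegral hf hσ hκm hW hU hκ hUW _)

/-- The constant in the estimates of cell integrals. -/
noncomputable def cellBound (M : ℕ → ℝ) (R : ℕ → ℝ) (N : ℕ → ℕ) (a b A S : ℝ) : ℝ :=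
  (b - a) * A * ((1 + R 0 * S) * ∑ n ∈ Finset.range (N 0 + 1), normWeight M n * R 0 ^ n +
    (2 + R 0 * S) * R 0 * ∑' j, layerSize M R N j)

section Cell

variable {M : ℕ → ℝ} {R : ℕ → ℝ} {N : ℕ → ℕ} {C ρ : ℝ} {f : ℝ → ℂ} {σ : ℝ → ℝ}
  {a b A c S s : ℝ}

lemma IsTaylorCell.norm_layerTerm_le' (hM : ∀ n, 0 < M n) (h : IsTruncation M R N C ρ)
    (hc : IsTaylorCell M f σ (R 0) a b A c S s) {κ : ℂ → ℂ} {z : ℂ} {E : ℝ}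
    (hκ : ∀ t ∈ Set.Icc a b, ∀ τ ∈ Set.Ioc 0 (R 0), ‖κ (z - tilt σ t τ)‖ ≤ E) (j : ℕ) :
    ‖layerTerm f σ κ R N a b j z‖ ≤
      (b - a) * A * (2 + R 0 * S) * R 0 * E * layerSize M R N j := by
  have hR0 := h.pos 0
  have hE : 0 ≤ E := (norm_nonneg _).trans (hκ a ⟨le_rfl, hc.lt.le⟩ (R 0) ⟨hR0, le_rfl⟩)
  have hRj := h.antitone (Nat.zero_le j)
  have h1 := hc.norm_layerTerm_le hM h (κ := κ) (z := z) (j := j) (E := E) fun t ht τ hτ =>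
    hκ t ht τ ⟨(h.pos _).trans_le hτ.1, hτ.2.trans hRj⟩
  refine h1.trans ?_
  have hA := hc.A_nonneg
  have hS := hc.S_nonneg
  have hab : 0 ≤ b - a := by linarith [hc.lt]
  have hL := h.layerSize_nonneg hM j
  gcongr

lemma IsTaylorCell.norm_cellIntegral_le (hM : ∀ n, 0 < M n) (h : IsTruncation M R N C ρ)
    (hc : IsTaylorCell M f σ (R 0) a b A c S s) {κ : ℂ → ℂ} {z : ℂ} {E : ℝ}
    (hκ : ∀ t ∈ Set.Icc a b, ∀ τ ∈ Set.Ioc 0 (R 0), ‖κ (z - tilt σ t τ)‖ ≤ E) :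
    ‖cellIntegral f σ κ R N a b z‖ ≤ cellBound M R N a b A S * E := by
  have hR0 := h.pos 0
  have hab := hc.lt.le
  have hE : 0 ≤ E := (norm_nonneg _).trans (hκ a ⟨le_rfl, hab⟩ (R 0) ⟨hR0, le_rfl⟩)
  have hT := sum_normWeight_nonneg hM h
  have hA := hc.A_nonneg
  have hS := hc.S_nonneg
  have h1 : ‖taylorCurveIntegral f σ κ (N 0) a b (R 0) z‖ ≤
      ((A * ∑ n ∈ Finset.range (N 0 + 1), normWeight M n * R 0 ^ n) * (1 + R 0 * S) * E) *
        |b - a| := by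
    refine intervalIntegral.norm_integral_le_of_norm_le_const fun t ht => ?_
    rw [Set.uIoc_of_le hab] at ht
    have ht' : t ∈ Set.Icc a b := ⟨ht.1.le, ht.2⟩
    rw [norm_mul, norm_mul]
    have h2 := hc.norm_taylorExt_le hM ht' hR0.le le_rfl (N 0)
    have h3 := norm_one_add_I_mul_le hR0.le (hc.deriv_le t ht')
    have h4 := hκ t ht' (R 0) ⟨hR0, le_rfl⟩
    gcongr
  have h2 : ‖∑' j, layerTerm f σ κ R N a b j z‖ ≤
      ∑' j, (b - a) * A * (2 + R 0 * S) * R 0 * E * layerSize M R N j :=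
    tsum_of_norm_bounded ((h.summable_layerSize hM).mul_left _).hasSum
      (hc.norm_layerTerm_le' hM h hκ)
  rw [tsum_mul_left] at h2
  rw [abs_of_nonneg (by linarith)] at h1
  refine (norm_add_le _ _).trans ((add_le_add h1 h2).trans (le_of_eq ?_))
  rw [cellBound]
  ring

lemma IsTaylorCell.differentiableOn_cellIntegral (hM : ∀ n, 0 < M n) (h : IsTruncation M R N C ρ)
    (hc : IsTaylorCell M f σ (R 0) a b A c S s) {κ : ℂ → ℂ} (hκm : Measurable κ)
    {W U : Set ℂ} (hW : IsOpen W) (hU : IsOpen U) (hκ : DifferentiableOn ℂ κ W) {E : ℝ}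
    (hUW : ∀ z ∈ U, ∀ t ∈ Set.Icc a b, ∀ τ ∈ Set.Ioc 0 (R 0), z - tilt σ t τ ∈ W)
    (hE : ∀ z ∈ U, ∀ t ∈ Set.Icc a b, ∀ τ ∈ Set.Ioc 0 (R 0), ‖κ (z - tilt σ t τ)‖ ≤ E) :
    DifferentiableOn ℂ (cellIntegral f σ κ R N a b) U := by
  refine (differentiableOn_taylorCurveIntegral hc.f_smooth hc.sigma_smooth hc.lt.le hκm hW hU hκ
    (fun z hz t ht => hUW z hz t ht _ ⟨h.pos 0, le_rfl⟩) _).add ?_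
  refine Complex.differentiableOn_tsum_of_summable_norm ((h.summable_layerSize hM).mul_left _)
    (fun j => ?_) hU fun j z hz => hc.norm_layerTerm_le' hM h (hE z hz) j
  exact differentiableOn_layerTerm hc.f_smooth hc.sigma_smooth hc.lt.le hκm hW hU hκ
    (h.succ_le j) (fun z hz t ht τ hτ => hUW z hz t ht τ ⟨(h.pos _).trans_le hτ.1,
      hτ.2.trans (h.antitone (Nat.zero_le j))⟩) N

/-- The leading integral is holomorphic near the real axis. The strips of holomorphy of the layers
shrink like `R (j + 1)`, and `size_le`, valid for every `k`, is exactly the summability that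
`carlemanAt_tsum_of_holomorphic` asks for. -/
lemma IsTaylorCell.carlemanAt_cellIntegral (hM : ∀ n, 0 < M n) (hreg : IsRegularCarleman M)
    (h : IsTruncation M R N C ρ)
    (hc : IsTaylorCell M f σ (R 0) a b A c S s) {B lam : ℝ} (hl : 0 ≤ lam) (hB : 0 ≤ B)
    (hBs : 2 * B * s ≤ 1) (x : ℝ) :
    CarlemanAt M (fun x : ℝ => cellIntegral f σ (cutoffKernel B lam) R N a b x) x := by
  have hcp := hc.c_pos
  have hA := hc.A_nonneg
  have hS := hc.S_nonneg
  have hR0 := h.pos 0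
  have hab : 0 ≤ b - a := by linarith [hc.lt]
  have him : ∀ (z : ℂ) (t : ℝ), t ∈ Set.Icc a b → ∀ (τ r : ℝ), r ≤ τ → 0 < r → |z.im| < c * r →
      z - tilt σ t τ ∈ ({0}ᶜ : Set ℂ) := by
    intro z t ht τ r hr hr0 hz h0
    have h1 := congrArg Complex.im (Set.mem_singleton_iff.1 h0)
    rw [Complex.sub_im, tilt_im, Complex.zero_im, sub_eq_zero] at h1
    rw [h1, abs_mul, abs_of_pos (hr0.trans_le hr)] at hz
    have h2 : c * r ≤ |σ t| * τ := mul_le_mul (hc.lower t ht) hr hr0.le (abs_nonneg _)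
    linarith
  have hopen : ∀ r : ℝ, IsOpen {z : ℂ | |z.im| < r} := fun r =>
    isOpen_lt (continuous_abs.comp Complex.continuous_im) continuous_const
  refine CarlemanAt.add hM ?_ ?_
  · refine carlemanAt_of_differentiableOn hM hreg (U := {z : ℂ | |z.im| < c * R 0}) (hopen _)
      (differentiableOn_taylorCurveIntegral hc.f_smooth hc.sigma_smooth hc.lt.le
        (measurable_cutoffKernel B lam) isOpen_compl_singleton (hopen _)
        (differentiableOn_cutoffKernel B lam) (fun z hz t ht => ?_) _) ?_
    · exact him z t ht _ _ le_rfl hR0 hz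
    · rw [Set.mem_ofPred_eq, Complex.ofReal_im, abs_zero]
      positivity
  · set K : ℝ := (b - a) * A * (2 + R 0 * S) * (4 * (Real.exp lam / c)) with hK
    have hK0 : 0 ≤ K := by positivity
    have hη : ∀ j, 0 < c / 2 * R (j + 1) := fun j => mul_pos (half_pos hcp) (h.pos _)
    have hball : ∀ j (x : ℝ), ∀ z ∈ Metric.ball (x : ℂ) (c / 2 * R (j + 1)),
        |z.im| < c / 2 * R (j + 1) := by
      intro j x z hz
      rw [Metric.mem_ball, dist_eq_norm] at hz
      have h1 := Complex.abs_im_le_norm (z - x)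
      rw [Complex.sub_im, Complex.ofReal_im, sub_zero] at h1
      linarith
    have hterm : ∀ j k : ℕ, K * layerSize M R N j / (c / 2 * R (j + 1)) ^ k ≤
        K * C * (4 / c * ρ) ^ k * normWeight M k * (1 / 2) ^ j := by
      intro j k
      rw [div_le_iff₀ (pow_pos (hη j) k)]
      have h1 : R j ≤ 4 / c * (c / 2 * R (j + 1)) := by
        have := h.le_two_mul j
        have e : 4 / c * (c / 2 * R (j + 1)) = 2 * R (j + 1) := by field_simp; ring
        rwa [e]
      have hρ := h.rho_pos
      have hC := h.C_pos
      have hm := normWeight_pos hM k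
      have hRj := h.pos j
      calc K * layerSize M R N j ≤ K * (C * ρ ^ k * normWeight M k * (1 / 2) ^ j * R j ^ k) := by
            gcongr; exact h.size_le j k
        _ ≤ K * (C * ρ ^ k * normWeight M k * (1 / 2) ^ j *
            (4 / c * (c / 2 * R (j + 1))) ^ k) := by gcongr
        _ = _ := by rw [mul_pow (4 / c), mul_pow (4 / c)]; ring
    have hC := h.C_pos
    have hρ := h.rho_pos
    refine carlemanAt_tsum_of_holomorphic one_pos (η := fun j => c / 2 * R (j + 1))
      (b := fun j => K * layerSize M R N j) hη (fun j x _ => ?_) (fun j x _ z hz => ?_)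
      (C := 2 * (K + 1) * C) (ρ := 4 / c * ρ) (by positivity) (by positivity) fun k => ?_
    · have h1 : DifferentiableOn ℂ (layerTerm f σ (cutoffKernel B lam) R N a b j)
          {z : ℂ | |z.im| < c * R (j + 1)} :=
        differentiableOn_layerTerm hc.f_smooth hc.sigma_smooth hc.lt.le
          (measurable_cutoffKernel B lam) isOpen_compl_singleton (hopen _)
          (differentiableOn_cutoffKernel B lam) (h.succ_le j)
          (fun z hz t ht τ hτ => him z t ht τ _ hτ.1 (h.pos _) hz) N
      refine h1.mono fun z hz => ?_
      have h2 := hball j x z hz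
      have h3 := hη j
      have e : c * R (j + 1) = c / 2 * R (j + 1) + c / 2 * R (j + 1) := by ring
      rw [Set.mem_ofPred_eq, e]
      linarith
    · exact hc.norm_layerTerm_cutoff_le hM h hl hB hBs (hball j x z hz).le
    · have hm := normWeight_pos hM k
      have hs := summable_geometric_two.mul_left (K * C * (4 / c * ρ) ^ k * normWeight M k)
      have h0 : ∀ j, 0 ≤ K * layerSize M R N j / (c / 2 * R (j + 1)) ^ k := fun j =>
        div_nonneg (mul_nonneg hK0 (h.layerSize_nonneg hM j)) (pow_nonneg (hη j).le k)
      have hs' := Summable.of_nonneg_of_le h0 (fun j => hterm j k) hs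
      refine ⟨hs', (hs'.tsum_le_tsum (fun j => hterm j k) hs).trans ?_⟩
      rw [tsum_mul_left, tsum_geometric_two]
      have : K * C * (4 / c * ρ) ^ k * normWeight M k * 2 =
          2 * K * C * (4 / c * ρ) ^ k * normWeight M k := by ring
      rw [this]
      gcongr
      linarith

lemma IsTaylorCell.norm_edgeIntegral_le (hM : ∀ n, 0 < M n) (h : IsTruncation M R N C ρ)
    (hc : IsTaylorCell M f σ (R 0) a b A c S s) {t : ℝ} (ht : t ∈ Set.Icc a b) {κ : ℂ → ℂ} {z : ℂ}
    {E : ℝ} (hκ : ∀ τ ∈ Set.Ioc 0 (R 0), ‖κ (z - tilt σ t τ)‖ ≤ E) :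
    ‖edgeIntegral f σ κ R N t z‖ ≤ A * extBound M R N * s * E := by
  have hR0 := h.pos 0
  have hE : 0 ≤ E := (norm_nonneg _).trans (hκ (R 0) ⟨hR0, le_rfl⟩)
  have h0 : 0 ≤ A * extBound M R N := mul_nonneg hc.A_nonneg (extBound_nonneg hM h)
  have h1 : ‖edgeIntegral f σ κ R N t z‖ ≤ (A * extBound M R N * |σ t| * E) * |R 0 - 0| := by
    refine intervalIntegral.norm_integral_le_of_norm_le_const fun τ hτ => ?_
    rw [Set.uIoc_of_le hR0.le] at hτ
    have h2 := hκ τ hτ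
    have h3 := hc.norm_layeredLim_le hM h ht hτ.1.le hτ.2
    rw [norm_mul, norm_mul, norm_mul, Complex.norm_I, one_mul, Complex.norm_real, Real.norm_eq_abs]
    gcongr
  have h4 := hc.upper t ht
  rw [sub_zero, abs_of_pos hR0] at h1
  calc _ ≤ A * extBound M R N * |σ t| * E * R 0 := h1
    _ = A * extBound M R N * (R 0 * |σ t|) * E := by ring
    _ ≤ _ := by gcongr

/-- The edge reaches the real axis at `τ = 0`, so a singular kernel would spoil regularity at `t`;
an entire one does not. This is applied to `kernelDiff`. -/
lemma IsTaylorCell.differentiable_edgeIntegral (hM : ∀ n, 0 < M n) (h : IsTruncation M R N C ρ)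
    (hc : IsTaylorCell M f σ (R 0) a b A c S s) {t : ℝ} (ht : t ∈ Set.Icc a b) {κ : ℂ → ℂ}
    (hκ : Differentiable ℂ κ) : Differentiable ℂ (edgeIntegral f σ κ R N t) := by
  rw [← differentiableOn_univ]
  have hR0 := h.pos 0
  have hΦ : Continuous fun τ => tilt σ t τ := by unfold tilt; fun_prop
  have hi := (hc.tendsto_edgeIntegral (N := N) hM h ht (κ := fun _ => 1) (z := 0)
    continuous_const).2.1
  simp only [mul_one] at hi
  exact differentiableOn_intervalIntegral_kernel hR0.le hi hΦ hκ.continuous.measurable isOpen_univ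
    isOpen_univ hκ.differentiableOn fun _ _ _ _ => Set.mem_univ _

/-- The difference of two damped Cauchy kernels, extended over the origin. -/
noncomputable def kernelDiff (B l₁ l₂ : ℝ) : ℂ → ℂ :=
  dslope (fun w => cutoffExp B l₂ w - cutoffExp B l₁ w) 0

/-- Both exponentials equal `1` at the origin, so the two poles cancel. -/
lemma differentiable_kernelDiff (B l₁ l₂ : ℝ) : Differentiable ℂ (kernelDiff B l₁ l₂) := by
  rw [← differentiableOn_univ, kernelDiff, Complex.differentiableOn_dslope univ_mem]
  exact ((differentiable_cutoffExp B l₂).sub (differentiable_cutoffExp B l₁)).differentiableOn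

lemma kernelDiff_of_ne (B l₁ l₂ : ℝ) {w : ℂ} (hw : w ≠ 0) :
    kernelDiff B l₁ l₂ w = cutoffKernel B l₁ w - cutoffKernel B l₂ w := by
  rw [kernelDiff, dslope_of_ne _ hw, slope_def_field, cutoffKernel, cutoffKernel, cutoffExp_zero,
    cutoffExp_zero]
  ring

lemma IsTaylorCell.edgeIntegral_kernelDiff (hM : ∀ n, 0 < M n) (h : IsTruncation M R N C ρ)
    (hc : IsTaylorCell M f σ (R 0) a b A c S s) {t : ℝ} (ht : t ∈ Set.Icc a b) (B l₁ l₂ : ℝ)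
    {x : ℝ} (hx : x ≠ t) :
    edgeIntegral f σ (kernelDiff B l₁ l₂) R N t x =
      edgeIntegral f σ (cutoffKernel B l₁) R N t x -
        edgeIntegral f σ (cutoffKernel B l₂) R N t x := by
  have hi := fun l => (hc.tendsto_edgeIntegral (N := N) hM h ht
    (continuous_kernel_comp (differentiableOn_cutoffKernel B l) σ hx)).2.1
  rw [edgeIntegral, edgeIntegral, edgeIntegral, ← intervalIntegral.integral_sub (hi l₁) (hi l₂)]
  refine intervalIntegral.integral_congr fun τ _ => ?_
  rw [kernelDiff_of_ne, mul_sub]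
  intro h0
  have h1 := congrArg Complex.re h0
  rw [Complex.sub_re, tilt_re] at h1
  exact hx (by simpa [sub_eq_zero] using h1)

lemma IsTaylorCell.norm_cutoffKernel_far_le (hc : IsTaylorCell M f σ (R 0) a b A c S s)
    {B lam : ℝ} (hl : 0 ≤ lam) (hB : 4 ≤ B) (hBs : 2 * B * s ≤ 1) {z : ℂ} (hz : |z.im| < s)
    {t τ D : ℝ} (ht : t ∈ Set.Icc a b) (hD : 1 ≤ D) (hzD : D ≤ |z.re - t|)
    (hτ : τ ∈ Set.Ioc 0 (R 0)) :
    ‖cutoffKernel B lam (z - tilt σ t τ)‖ ≤ Real.exp (-(lam / 4) * Real.cosh (B * D)) := by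
  refine norm_cutoffKernel_le_of_far hB hl ?_ hD ?_
  · have h3 := hc.abs_sigma_le ht hτ.1.le hτ.2
    rw [abs_mul, abs_of_nonneg (by linarith), Complex.sub_im]
    have h5 := abs_sub z.im (tilt σ t τ).im
    nlinarith
  · rwa [Complex.sub_re, tilt_re]

lemma sub_tilt_ne_zero_of_far {z : ℂ} {t τ D : ℝ} (hD : 1 ≤ D) (hzD : D ≤ |z.re - t|) :
    z - tilt σ t τ ≠ 0 := by
  intro h0
  have h1 := congrArg Complex.re h0
  rw [Complex.sub_re, tilt_re, Complex.zero_re] at h1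
  rw [h1, abs_zero] at hzD
  linarith

end Cell

/-! ### Series of functions attached to the unit cells -/

/-- Functions attached to the intervals `[n, n + 1]` that decay double exponentially to the left. -/
structure IsCellSeries (M : ℕ → ℝ) (G : ℕ → ℂ → ℂ) (s B : ℝ) : Prop where
  carlemanAt : ∀ n x, CarlemanAt M (fun x : ℝ => G n x) x
  differentiableOn : ∀ n : ℕ, DifferentiableOn ℂ (G n) {z | |z.im| < s ∧ z.re < n - 1}
  norm_le : ∀ (n : ℕ) (z : ℂ) (D : ℝ), |z.im| < s → 1 ≤ D → D ≤ n - z.re →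
    ‖G n z‖ ≤ (1 / 2) ^ n * Real.exp (-Real.cosh (B * D))

namespace IsCellSeries

variable {M : ℕ → ℝ} {G : ℕ → ℂ → ℂ} {s B : ℝ}

lemma norm_add_le (hG : IsCellSeries M G s B) {m : ℕ} {z : ℂ} (hz : |z.im| < s)
    (hzm : z.re < m - 1) (n : ℕ) : ‖G (n + m) z‖ ≤ (1 / 2) ^ n := by
  have hn : (0 : ℝ) ≤ n := Nat.cast_nonneg n
  refine (hG.norm_le (n + m) z 1 hz le_rfl (by push_cast; linarith)).trans ?_
  have h1 : Real.exp (-Real.cosh (B * 1)) ≤ 1 :=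
    Real.exp_le_one_iff.2 (neg_nonpos.2 (Real.cosh_pos _).le)
  have h2 : ((1 : ℝ) / 2) ^ (n + m) ≤ (1 / 2) ^ n :=
    pow_le_pow_of_le_one (by norm_num) (by norm_num) (Nat.le_add_right n m)
  calc _ ≤ ((1 : ℝ) / 2) ^ n * 1 := by gcongr
    _ = _ := mul_one _

lemma summable (hG : IsCellSeries M G s B) {z : ℂ} (hz : |z.im| < s) :
    Summable fun n => G n z := by
  obtain ⟨m, hm⟩ := exists_nat_gt (z.re + 1)
  rw [← summable_nat_add_iff m]
  exact Summable.of_norm_bounded summable_geometric_two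
    (hG.norm_add_le hz (by linarith))

lemma isOpen_left (s r : ℝ) : IsOpen {z : ℂ | |z.im| < s ∧ z.re < r} :=
  (isOpen_lt (continuous_abs.comp Complex.continuous_im) continuous_const).inter
    (isOpen_lt Complex.continuous_re continuous_const)

lemma differentiableOn_tsum_add (hG : IsCellSeries M G s B) (m : ℕ) :
    DifferentiableOn ℂ (fun z => ∑' n, G (n + m) z) {z | |z.im| < s ∧ z.re < m - 1} := by
  refine Complex.differentiableOn_tsum_of_summable_norm summable_geometric_two (fun n => ?_)
    (isOpen_left _ _) fun n z hz => hG.norm_add_le hz.1 hz.2 n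
  refine (hG.differentiableOn (n + m)).mono fun z hz => ⟨hz.1, ?_⟩
  have hn : (0 : ℝ) ≤ n := Nat.cast_nonneg n
  have := hz.2
  push_cast
  linarith

/-- Finitely many terms lie in the class, and the tail beyond `m > x + 1` is holomorphic near `x`.
-/
lemma carlemanAt_tsum (hM : ∀ n, 0 < M n) (hreg : IsRegularCarleman M) (hs : 0 < s)
    (hG : IsCellSeries M G s B) (x : ℝ) : CarlemanAt M (fun x : ℝ => ∑' n, G n x) x := by
  obtain ⟨m, hm⟩ := exists_nat_gt (x + 1)
  have h1 : CarlemanAt M (fun x : ℝ => ∑ n ∈ Finset.range m, G n x) x :=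
    CarlemanAt.sum hM hreg _ fun n _ => hG.carlemanAt n x
  have h2 := carlemanAt_of_differentiableOn hM hreg (isOpen_left s (m - 1))
    (hG.differentiableOn_tsum_add m) (x₀ := x) ⟨by simpa using hs, by simpa using by linarith⟩
  refine (h1.add hM h2).congr (Eventually.of_forall fun y => ?_)
  exact (hG.summable (z := y) (by simpa using hs)).sum_add_tsum_nat_add m

lemma differentiableOn_tsum (hG : IsCellSeries M G s B) :
    DifferentiableOn ℂ (fun z => ∑' n, G n z) {z | z.re < -1 ∧ |z.im| < s} :=
  (hG.differentiableOn_tsum_add 0).mono fun z hz => ⟨hz.2, by simpa using hz.1⟩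

/-- Take `D = -Re z` and `cosh ≥ exp / 2`; the constant `1 / 2` is the one expected by
`exists_solution_of_left_decay`. -/
lemma norm_tsum_le (hG : IsCellSeries M G s B) (z : ℂ) (hz : z.re < -1) (hzs : |z.im| < s) :
    ‖∑' n, G n z‖ ≤ 2 * Real.exp (-(1 / 2) * Real.exp (-B * z.re)) := by
  have h1 : ∀ n, ‖G n z‖ ≤ (1 / 2) ^ n * Real.exp (-(1 / 2) * Real.exp (-B * z.re)) := fun n => by
    have hn : (0 : ℝ) ≤ n := Nat.cast_nonneg n
    refine (hG.norm_le n z (-z.re) hzs (by linarith) (by linarith)).trans ?_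
    gcongr
    rw [Real.cosh_eq, mul_neg, neg_mul]
    have := Real.exp_pos (-(-(B * z.re)))
    rw [neg_mul]
    linarith
  have h2 := tsum_of_norm_bounded (summable_geometric_two.mul_right _).hasSum h1
  rwa [tsum_mul_right, tsum_geometric_two] at h2

end IsCellSeries

/-! ### Splitting a function of the Carleman class -/

/-- A smooth positive function below given bounds on the unit cells. -/
lemma exists_smooth_pos_le {y : ℤ → ℝ} (hy : ∀ k, 0 < y k) :
    ∃ σ : ℝ → ℝ, ContDiff ℝ ∞ σ ∧ (∀ t, 0 < σ t) ∧
      ∀ k : ℤ, ∀ t ∈ Set.Icc (k : ℝ) (k + 1), σ t ≤ y k := by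
  have key : ∃ g : ContMDiffMap (modelWithCornersSelf ℝ ℝ) (modelWithCornersSelf ℝ ℝ) ℝ ℝ (⊤ : ℕ∞),
      ∀ t, g t ∈ {c : ℝ | 0 < c ∧ ∀ k : ℤ, t ∈ Set.Icc (k : ℝ) (k + 1) → c ≤ y k} := by
    refine exists_contMDiffMap_forall_mem_convex_of_local_const _ (fun t => ?_) (fun t => ?_)
    · intro c₁ h₁ c₂ h₂ p r hp hr hpr
      have hmin : min c₁ c₂ ≤ p • c₁ + r • c₂ := by
        have := (convex_Ici (min c₁ c₂)) (Set.mem_Ici.2 (min_le_left c₁ c₂))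
          (Set.mem_Ici.2 (min_le_right c₁ c₂)) hp hr hpr
        exact this
      refine ⟨(lt_min h₁.1 h₂.1).trans_le hmin, fun k hk => ?_⟩
      exact (convex_Iic (y k)) (Set.mem_Iic.2 (h₁.2 k hk)) (Set.mem_Iic.2 (h₂.2 k hk)) hp hr hpr
    · have hne : (Finset.Icc (⌊t⌋ - 2) (⌊t⌋ + 2)).Nonempty := ⟨⌊t⌋, by simp⟩
      obtain ⟨k₀, -, hk₀⟩ := Finset.exists_min_image _ y hne
      refine ⟨y k₀, ?_⟩
      filter_upwards [Metric.ball_mem_nhds t one_pos] with u hu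
      refine ⟨hy k₀, fun k hk => hk₀ k ?_⟩
      rw [Metric.mem_ball, Real.dist_eq, abs_lt] at hu
      have h1 := Int.floor_le t
      have h2 := Int.lt_floor_add_one t
      rw [Finset.mem_Icc]
      constructor
      · have : ((⌊t⌋ - 3 : ℤ) : ℝ) < k := by push_cast; linarith [hk.2]
        have := Int.cast_lt.1 this
        omega
      · have : (k : ℝ) < (⌊t⌋ + 3 : ℤ) := by push_cast; linarith [hk.1]
        have := Int.cast_lt.1 this
        omega
  obtain ⟨g, hg⟩ := key
  exact ⟨g, g.contMDiff.contDiff, fun t => (hg t).1, fun k t ht => (hg t).2 k ht⟩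

/-! ### Unit cells, their edges and the telescoping sum. -/

/-- The constants needed to attach holomorphic layers to the unit cells. -/
structure IsCellSystem (M : ℕ → ℝ) (χ : ℝ → ℂ) (σ : ℝ → ℝ) (R : ℕ → ℝ) (N : ℕ → ℕ) (C ρ : ℝ)
    (A c S lam : ℤ → ℝ) (s B : ℝ) : Prop where
  trunc : IsTruncation M R N C ρ
  cell : ∀ k : ℤ, IsTaylorCell M χ σ (R 0) k (k + 1) (A k) (c k) (S k) s
  sigma_pos : ∀ t, 0 < σ t
  four_le : 4 ≤ B
  mul_le : 2 * B * s ≤ 1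
  eight_le : ∀ k, 8 ≤ lam k
  cell_le : ∀ k : ℤ, cellBound M R N k (k + 1) (A k) (S k) * Real.exp (-(lam k / 8)) ≤
    (1 / 2) ^ k.natAbs
  edge_le : ∀ k : ℤ, A k * extBound M R N * s * Real.exp (-(lam k / 8)) ≤ (1 / 2) ^ k.natAbs
  -- The left edge of cell `k` is also integrated against the kernel of cell `k - 1`, so `lam (k -
  -- 1)` must be large with respect to `A k`.
  edge_pred_le : ∀ k : ℤ, A k * extBound M R N * s * Real.exp (-(lam (k - 1) / 8)) ≤
    (1 / 2) ^ k.natAbs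

/-- The holomorphic part of the Cauchy integral over the cell `[k, k + 1]`, where the kernel on the
left edge is changed to the kernel of the preceding cell. -/
noncomputable def cellFun (χ : ℝ → ℂ) (σ : ℝ → ℝ) (R : ℕ → ℝ) (N : ℕ → ℕ) (B : ℝ) (lam : ℤ → ℝ)
    (k : ℤ) (z : ℂ) : ℂ :=
  (2 * Real.pi * Complex.I)⁻¹ *
    ((cellIntegral χ (fun t => -σ t) (cutoffKernel B (lam k)) R N k (k + 1) z +
      edgeIntegral χ (fun t => -σ t) (kernelDiff B (lam k) (lam (k - 1))) R N k z) -
    (cellIntegral χ σ (cutoffKernel B (lam k)) R N k (k + 1) z +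
      edgeIntegral χ σ (kernelDiff B (lam k) (lam (k - 1))) R N k z))

/-- The Cauchy integral over the left edge of the cell `[k, k + 1]` with the kernel of the preceding
cell. -/
noncomputable def edgeFun (χ : ℝ → ℂ) (σ : ℝ → ℝ) (R : ℕ → ℝ) (N : ℕ → ℕ) (B : ℝ) (lam : ℤ → ℝ)
    (k : ℤ) (z : ℂ) : ℂ :=
  (2 * Real.pi * Complex.I)⁻¹ *
    (edgeIntegral χ (fun t => -σ t) (cutoffKernel B (lam (k - 1))) R N k z -
      edgeIntegral χ σ (cutoffKernel B (lam (k - 1))) R N k z)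

namespace IsCellSystem

variable {M : ℕ → ℝ} {χ : ℝ → ℂ} {σ : ℝ → ℝ} {R : ℕ → ℝ} {N : ℕ → ℕ} {C ρ : ℝ}
    {A c S lam : ℤ → ℝ} {s B : ℝ}

/-- As `cosh ≥ 1` and `l ≥ 8`, half of the exponent gives a factor that a large `l` makes small; the
other half keeps a decay in `D` independent of `l`. -/
lemma exp_le {l D : ℝ} (hl : 8 ≤ l) (B : ℝ) : Real.exp (-(l / 4) * Real.cosh (B * D)) ≤
    Real.exp (-(l / 8)) * Real.exp (-Real.cosh (B * D)) := by
  rw [← Real.exp_add]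
  apply Real.exp_le_exp.2
  have := Real.one_le_cosh (B * D)
  nlinarith

lemma norm_two_pi_I_inv_mul_le {v w : ℂ} {E : ℝ} (hv : ‖v‖ ≤ 3 * E) (hw : ‖w‖ ≤ 3 * E) :
    ‖(2 * Real.pi * Complex.I)⁻¹ * (v - w)‖ ≤ E := by
  have h1 : ‖(2 * (Real.pi : ℂ) * Complex.I)‖ = 2 * Real.pi := by
    simp [abs_of_pos Real.pi_pos]
  rw [norm_mul, norm_inv, h1, inv_mul_le_iff₀ (by positivity)]
  have h2 := norm_sub_le v w
  have h3 := norm_nonneg v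
  have := Real.pi_gt_three
  nlinarith

lemma carlemanAt_cellFun (hM : ∀ n, 0 < M n) (hreg : IsRegularCarleman M)
    (h : IsCellSystem M χ σ R N C ρ A c S lam s B) (k : ℤ) (x : ℝ) :
    CarlemanAt M (fun x : ℝ => cellFun χ σ R N B lam k x) x := by
  have hB : 0 ≤ B := by linarith [h.four_le]
  have hl : 0 ≤ lam k := by linarith [h.eight_le k]
  have key : ∀ σ' : ℝ → ℝ, IsTaylorCell M χ σ' (R 0) k (k + 1) (A k) (c k) (S k) s →
      CarlemanAt M (fun x : ℝ => cellIntegral χ σ' (cutoffKernel B (lam k)) R N k (k + 1) x +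
        edgeIntegral χ σ' (kernelDiff B (lam k) (lam (k - 1))) R N k x) x := fun σ' hc =>
    (hc.carlemanAt_cellIntegral hM hreg h.trunc hl hB h.mul_le x).add hM
      (carlemanAt_of_differentiableOn hM hreg isOpen_univ
        (hc.differentiable_edgeIntegral hM h.trunc ⟨le_rfl, by linarith⟩
          (differentiable_kernelDiff B _ _)).differentiableOn (Set.mem_univ _))
  refine (((key _ (h.cell k).neg).add hM ((key _ (h.cell k)).const_mul hM hreg (-1))).const_mul
    hM hreg (2 * Real.pi * Complex.I)⁻¹).congr (Eventually.of_forall fun y => ?_)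
  simp only [neg_one_mul, ← sub_eq_add_neg, cellFun]

lemma differentiableOn_cellFun (hM : ∀ n, 0 < M n)
    (h : IsCellSystem M χ σ R N C ρ A c S lam s B) (k : ℤ) {U : Set ℂ} (hU : IsOpen U)
    (hUs : ∀ z ∈ U, |z.im| < s ∧ ∀ t ∈ Set.Icc (k : ℝ) (k + 1), 1 ≤ |z.re - t|) :
    DifferentiableOn ℂ (cellFun χ σ R N B lam k) U := by
  have hl : 0 ≤ lam k := by linarith [h.eight_le k]
  have key : ∀ σ' : ℝ → ℝ, IsTaylorCell M χ σ' (R 0) k (k + 1) (A k) (c k) (S k) s →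
      DifferentiableOn ℂ (fun z => cellIntegral χ σ' (cutoffKernel B (lam k)) R N k (k + 1) z +
        edgeIntegral χ σ' (kernelDiff B (lam k) (lam (k - 1))) R N k z) U := fun σ' hc => by
    refine DifferentiableOn.add ?_ (hc.differentiable_edgeIntegral hM h.trunc
      ⟨le_rfl, by linarith⟩ (differentiable_kernelDiff B _ _)).differentiableOn
    exact hc.differentiableOn_cellIntegral hM h.trunc (measurable_cutoffKernel B _)
      isOpen_compl_singleton hU (differentiableOn_cutoffKernel B _)
      (fun z hz t ht τ _ => sub_tilt_ne_zero_of_far le_rfl ((hUs z hz).2 t ht))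
      (fun z hz t ht τ hτ => hc.norm_cutoffKernel_far_le hl h.four_le h.mul_le (hUs z hz).1 ht
        le_rfl ((hUs z hz).2 t ht) hτ)
  exact ((key _ (h.cell k).neg).sub (key _ (h.cell k))).const_mul _

lemma norm_cellFun_le (hM : ∀ n, 0 < M n) (h : IsCellSystem M χ σ R N C ρ A c S lam s B) (k : ℤ)
    {z : ℂ} {D : ℝ} (hz : |z.im| < s) (hD : 1 ≤ D)
    (hzD : ∀ t ∈ Set.Icc (k : ℝ) (k + 1), D ≤ |z.re - t|) :
    ‖cellFun χ σ R N B lam k z‖ ≤ (1 / 2) ^ k.natAbs * Real.exp (-Real.cosh (B * D)) := by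
  have hl : ∀ k, 0 ≤ lam k := fun k => by linarith [h.eight_le k]
  have hk : (k : ℝ) ∈ Set.Icc (k : ℝ) (k + 1) := ⟨le_rfl, by linarith⟩
  have key : ∀ σ' : ℝ → ℝ, IsTaylorCell M χ σ' (R 0) k (k + 1) (A k) (c k) (S k) s →
      ‖cellIntegral χ σ' (cutoffKernel B (lam k)) R N k (k + 1) z +
        edgeIntegral χ σ' (kernelDiff B (lam k) (lam (k - 1))) R N k z‖ ≤
      3 * ((1 / 2) ^ k.natAbs * Real.exp (-Real.cosh (B * D))) := fun σ' hc => by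
    have e1 := hc.norm_cellIntegral_le (N := N) hM h.trunc (κ := cutoffKernel B (lam k)) (z := z)
      (E := Real.exp (-(lam k / 8)) * Real.exp (-Real.cosh (B * D))) fun t ht τ hτ =>
        (hc.norm_cutoffKernel_far_le (hl k) h.four_le h.mul_le hz ht hD (hzD t ht) hτ).trans
          (exp_le (h.eight_le k) B)
    have e2 := hc.norm_edgeIntegral_le (N := N) hM h.trunc hk
      (κ := kernelDiff B (lam k) (lam (k - 1))) (z := z)
      (E := (Real.exp (-(lam k / 8)) + Real.exp (-(lam (k - 1) / 8))) *
        Real.exp (-Real.cosh (B * D))) fun τ hτ => by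
        rw [kernelDiff_of_ne _ _ _ (sub_tilt_ne_zero_of_far hD (hzD _ hk)), add_mul]
        refine (norm_sub_le _ _).trans (add_le_add ?_ ?_)
        · exact (hc.norm_cutoffKernel_far_le (hl k) h.four_le h.mul_le hz hk hD (hzD _ hk)
            hτ).trans (exp_le (h.eight_le k) B)
        · exact (hc.norm_cutoffKernel_far_le (hl _) h.four_le h.mul_le hz hk hD (hzD _ hk)
            hτ).trans (exp_le (h.eight_le _) B)
    have f1 := mul_le_mul_of_nonneg_right (h.cell_le k) (Real.exp_pos (-Real.cosh (B * D))).le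
    have f2 := mul_le_mul_of_nonneg_right (h.edge_le k) (Real.exp_pos (-Real.cosh (B * D))).le
    have f3 := mul_le_mul_of_nonneg_right (h.edge_pred_le k)
      (Real.exp_pos (-Real.cosh (B * D))).le
    refine (norm_add_le _ _).trans ((add_le_add e1 e2).trans ?_)
    linarith
  exact norm_two_pi_I_inv_mul_le (key _ (h.cell k).neg) (key _ (h.cell k))

lemma norm_edgeFun_le (hM : ∀ n, 0 < M n) (h : IsCellSystem M χ σ R N C ρ A c S lam s B) (k : ℤ)
    {x : ℝ} (hx : 1 ≤ |x - k|) : ‖edgeFun χ σ R N B lam k x‖ ≤ (1 / 2) ^ k.natAbs := by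
  have hk : (k : ℝ) ∈ Set.Icc (k : ℝ) (k + 1) := ⟨le_rfl, by linarith⟩
  have key : ∀ σ' : ℝ → ℝ, IsTaylorCell M χ σ' (R 0) k (k + 1) (A k) (c k) (S k) s →
      ‖edgeIntegral χ σ' (cutoffKernel B (lam (k - 1))) R N k x‖ ≤
      3 * (1 / 2) ^ k.natAbs := fun σ' hc => by
    have e2 := hc.norm_edgeIntegral_le (N := N) hM h.trunc hk
      (κ := cutoffKernel B (lam (k - 1))) (z := x) (E := Real.exp (-(lam (k - 1) / 8)))
      fun τ hτ => by
        refine (hc.norm_cutoffKernel_far_le (by linarith [h.eight_le (k - 1)]) h.four_le h.mul_le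
          (by simpa using hc.s_pos) hk le_rfl (by simpa using hx) hτ).trans
          ((exp_le (h.eight_le (k - 1)) B).trans ?_)
        exact mul_le_of_le_one_right (Real.exp_pos _).le
          (Real.exp_le_one_iff.2 (neg_nonpos.2 (Real.cosh_pos _).le))
    have f3 := h.edge_pred_le k
    have : (0 : ℝ) < (1 / 2) ^ k.natAbs := by positivity
    linarith
  exact norm_two_pi_I_inv_mul_le (key _ (h.cell k).neg) (key _ (h.cell k))

/-- The right edge of cell `k` carries the kernel used in `edgeFun` at `k + 1`; on the left edge
`kernelDiff` trades the kernel of cell `k` for that of cell `k - 1`. Since `χ`, `σ`, `R` and `N` are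
common to all cells, the edge terms telescope. -/
lemma cellFun_eq (hM : ∀ n, 0 < M n) (h : IsCellSystem M χ σ R N C ρ A c S lam s B) (k : ℤ)
    {x : ℝ} (hx : x ≠ k) (hx' : x ≠ k + 1) : cellFun χ σ R N B lam k x =
      (if k < x ∧ x < k + 1 then χ x else 0) + edgeFun χ σ R N B lam (k + 1) x -
        edgeFun χ σ R N B lam k x := by
  have hk : (k : ℝ) ∈ Set.Icc (k : ℝ) (k + 1) := ⟨le_rfl, by linarith⟩
  have hj := (h.cell k).jump hM h.trunc (fun t _ => h.sigma_pos t) (B := B) (lam := lam k)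
    (by linarith [h.eight_le k]) (by linarith [h.four_le]) h.mul_le hx hx'
  have hpi : 2 * (Real.pi : ℂ) * Complex.I ≠ 0 := Complex.two_pi_I_ne_zero
  have hif : (if k < x ∧ x < k + 1 then χ x else 0) = (2 * Real.pi * Complex.I)⁻¹ *
      (if k < x ∧ x < k + 1 then 2 * Real.pi * Complex.I * χ x else 0) := by
    split_ifs
    · rw [inv_mul_cancel_left₀ hpi]
    · rw [mul_zero]
  rw [hif, ← hj, cellFun, edgeFun, edgeFun, (h.cell k).neg.edgeIntegral_kernelDiff hM h.trunc hk _
    _ _ hx, (h.cell k).edgeIntegral_kernelDiff hM h.trunc hk _ _ _ hx, add_sub_cancel_right]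
  push_cast
  ring

lemma isCellSeries_right (hM : ∀ n, 0 < M n) (hreg : IsRegularCarleman M)
    (h : IsCellSystem M χ σ R N C ρ A c S lam s B) :
    IsCellSeries M (fun n z => cellFun χ σ R N B lam n z) s B where
  carlemanAt n x := h.carlemanAt_cellFun hM hreg n x
  differentiableOn n := h.differentiableOn_cellFun hM n (IsCellSeries.isOpen_left _ _)
    fun z hz => ⟨hz.1, fun t ht => by
      have h1 := hz.2
      have h2 := ht.1
      push_cast at h2
      rw [abs_sub_comm]
      exact le_trans (by linarith) (le_abs_self _)⟩
  norm_le n z D hz hD hzD := by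
    refine h.norm_cellFun_le hM n hz hD fun t ht => ?_
    have h2 := ht.1
    push_cast at h2
    rw [abs_sub_comm]
    exact le_trans (by linarith) (le_abs_self _)

/-- Reflection in the origin carries the cell `[-(n + 1), -n]` to `[n, n + 1]`. -/
lemma isCellSeries_left (hM : ∀ n, 0 < M n) (hreg : IsRegularCarleman M)
    (h : IsCellSystem M χ σ R N C ρ A c S lam s B) :
    IsCellSeries M (fun n z => cellFun χ σ R N B lam (-(n + 1)) (-z)) s B where
  carlemanAt n x := by
    have := (h.carlemanAt_cellFun hM hreg (-(n + 1)) (-x)).comp_neg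
    exact this.congr (Eventually.of_forall fun y => by simp)
  differentiableOn n := by
    have h1 := h.differentiableOn_cellFun hM (-(n + 1))
      (U := {z | |(-z).im| < s ∧ (-z).re < n - 1})
      ((IsCellSeries.isOpen_left s (n - 1)).preimage continuous_neg) fun z hz => ⟨by
        simpa using hz.1, fun t ht => by
        have h1 := hz.2
        have h2 := ht.2
        push_cast at h2
        rw [Complex.neg_re] at h1
        exact le_trans (by linarith) (le_abs_self _)⟩
    exact h1.comp differentiable_neg.differentiableOn fun z hz => by
      rw [Set.mem_ofPred_eq, neg_neg]
      exact hz
  norm_le n z D hz hD hzD := by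
    have h1 := h.norm_cellFun_le hM (-(n + 1)) (z := -z) (by simpa using hz) hD fun t ht => by
      have h2 := ht.2
      push_cast at h2
      rw [Complex.neg_re]
      exact le_trans (by linarith) (le_abs_self _)
    refine h1.trans ?_
    have h2 : (-((n : ℤ) + 1)).natAbs = n + 1 := by omega
    rw [h2]
    have h3 : ((1 : ℝ) / 2) ^ (n + 1) ≤ (1 / 2) ^ n :=
      pow_le_pow_of_le_one (by norm_num) (by norm_num) (Nat.le_add_right n 1)
    gcongr

lemma sum_cellFun (hM : ∀ n, 0 < M n) (h : IsCellSystem M χ σ R N C ρ A c S lam s B)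
    {x : ℝ} (hx : ∀ k : ℤ, x ≠ k) (L : ℕ) :
    ∑ n ∈ Finset.range L, (cellFun χ σ R N B lam n x + cellFun χ σ R N B lam (-(n + 1)) x) =
      (if -(L : ℝ) < x ∧ x < L then χ x else 0) + edgeFun χ σ R N B lam L x -
        edgeFun χ σ R N B lam (-L) x := by
  induction L with
  | zero =>
    have : ¬ (0 < x ∧ x < 0) := fun h => lt_asymm h.1 h.2
    simp [this]
  | succ L ih =>
    have e1 := h.cellFun_eq hM L (hx _) (by exact_mod_cast hx (L + 1))
    have e2 := h.cellFun_eq hM (-(L + 1)) (hx _) (by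
      have := hx (-L)
      push_cast at this ⊢
      simpa using this)
    have e3 : -((L : ℤ) + 1) + 1 = -L := by ring
    rw [e3] at e2
    rw [Finset.sum_range_succ, ih, e1, e2]
    have hL : (0 : ℝ) ≤ L := Nat.cast_nonneg L
    have hi : (if -(L : ℝ) < x ∧ x < L then χ x else 0) +
        (if ((L : ℤ) : ℝ) < x ∧ x < (L : ℤ) + 1 then χ x else 0) +
        (if ((-((L : ℤ) + 1) : ℤ) : ℝ) < x ∧ x < (-((L : ℤ) + 1) : ℤ) + 1 then χ x else 0) =
        if -((L + 1 : ℕ) : ℝ) < x ∧ x < (L + 1 : ℕ) then χ x else 0 := by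
      have h1 := hx L
      have h2 := hx (-L)
      push_cast at h1 h2 ⊢
      rcases lt_or_gt_of_ne h1 with h1 | h1 <;> rcases lt_or_gt_of_ne h2 with h2 | h2
      · have a1 : ¬ -(L : ℝ) < x := by linarith
        have a2 : ¬ (L : ℝ) < x := by linarith
        have a3 : x < L + 1 := by linarith
        have a4 : x < -1 + -(L : ℝ) + 1 := by linarith
        simp [a1, a2, a3, h2]
      · have a2 : ¬ (L : ℝ) < x := by linarith
        have a3 : x < L + 1 := by linarith
        have a4 : ¬ x < -(L : ℝ) := by linarith
        have a5 : -1 + -(L : ℝ) < x := by linarith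
        simp [h1, h2, a2, a3, a4, a5]
      · linarith
      · have a1 : ¬ x < (L : ℝ) := by linarith
        have a2 : ¬ x < -(L : ℝ) := by linarith
        have a5 : -1 + -(L : ℝ) < x := by linarith
        simp [h1, a1, a2, a5]
    rw [← hi]
    push_cast
    ring

/-- The outer edge terms tend to zero, which gives the identity off the integers, where the jump
relation holds. Both sides are continuous, so it extends to the integers by density. -/
theorem tsum_add_tsum (hM : ∀ n, 0 < M n) (hreg : IsRegularCarleman M)
    (h : IsCellSystem M χ σ R N C ρ A c S lam s B) (x : ℝ) :
    ∑' n : ℕ, cellFun χ σ R N B lam n x + ∑' n : ℕ, cellFun χ σ R N B lam (-(n + 1)) x = χ x := by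
  have hs : 0 < s := (h.cell 0).s_pos
  have hr := h.isCellSeries_right hM hreg
  have hl := h.isCellSeries_left hM hreg
  have hsr : ∀ x : ℝ, Summable fun n : ℕ => cellFun χ σ R N B lam n x := fun x =>
    hr.summable (by simpa using hs)
  have hsl : ∀ x : ℝ, Summable fun n : ℕ => cellFun χ σ R N B lam (-(n + 1)) x := fun x => by
    simpa using hl.summable (z := -(x : ℂ)) (by simpa using hs)
  have hcl : Continuous fun x : ℝ => ∑' n : ℕ, cellFun χ σ R N B lam (-(n + 1)) x := by
    refine continuous_iff_continuousAt.2 fun x => ?_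
    have h1 := ((hl.carlemanAt_tsum hM hreg hs (-x)).comp_neg).continuousAt
    simpa using h1
  have hcr : Continuous fun x : ℝ => ∑' n : ℕ, cellFun χ σ R N B lam n x :=
    continuous_iff_continuousAt.2 fun x => (hr.carlemanAt_tsum hM hreg hs x).continuousAt
  have hd : Dense (Set.range ((↑) : ℤ → ℝ))ᶜ := (Set.countable_range _).dense_compl ℝ
  refine congrFun (Continuous.ext_on hd (hcr.add hcl) (h.cell 0).f_smooth.continuous
    fun x hx => ?_) x
  have hx' : ∀ k : ℤ, x ≠ k := fun k hk => hx ⟨k, hk.symm⟩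
  have h1 := (((hsr x).hasSum.add (hsl x).hasSum).tendsto_sum_nat).congr (h.sum_cellFun hM hx')
  have hgeo : Tendsto (fun L : ℕ => ((1 : ℝ) / 2) ^ L) atTop (𝓝 0) :=
    tendsto_pow_atTop_nhds_zero_of_lt_one (by norm_num) (by norm_num)
  obtain ⟨m, hm⟩ := exists_nat_gt (|x| + 1)
  have hbig : ∀ᶠ L : ℕ in atTop, |x| + 1 < L := by
    filter_upwards [eventually_ge_atTop m] with L hL
    exact hm.trans_le (by exact_mod_cast hL)
  have t1 : Tendsto (fun L : ℕ => edgeFun χ σ R N B lam L x) atTop (𝓝 0) := by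
    refine squeeze_zero_norm' ?_ hgeo
    filter_upwards [hbig] with L hL
    have := h.norm_edgeFun_le hM L (x := x) (by
      rw [abs_sub_comm]
      push_cast
      exact le_trans (by linarith [le_abs_self x]) (le_abs_self _))
    simpa using this
  have t2 : Tendsto (fun L : ℕ => edgeFun χ σ R N B lam (-L) x) atTop (𝓝 0) := by
    refine squeeze_zero_norm' ?_ hgeo
    filter_upwards [hbig] with L hL
    have := h.norm_edgeFun_le hM (-L) (x := x) (by
      push_cast
      exact le_trans (by linarith [neg_abs_le x]) (le_abs_self _))
    simpa using this
  have t3 : Tendsto (fun L : ℕ => if -(L : ℝ) < x ∧ x < L then χ x else 0) atTop (𝓝 (χ x)) := by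
    refine tendsto_const_nhds.congr' ?_
    filter_upwards [hbig] with L hL
    rw [if_pos ⟨by linarith [neg_abs_le x], by linarith [le_abs_self x]⟩]
  have h2 := (t3.add t1).sub t2
  rw [add_zero, sub_zero] at h2
  exact tendsto_nhds_unique h1 h2

end IsCellSystem

/-! ### Choice of the parameters and the splitting of the right-hand side. -/

lemma exists_eight_le_exp_le {K y : ℝ} (hy : 0 < y) : ∃ l₀, ∀ l, l₀ ≤ l →
    K * Real.exp (-(l / 8)) ≤ y := by
  have h1 : Tendsto (fun l : ℝ => K * Real.exp (-(l / 8))) atTop (𝓝 (K * 0)) :=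
    (Real.tendsto_exp_neg_atTop_nhds_zero.comp
      (tendsto_id.atTop_div_const (by norm_num : (0 : ℝ) < 8))).const_mul K
  rw [mul_zero] at h1
  obtain ⟨l₀, h⟩ := eventually_atTop.1 (h1.eventually (gt_mem_nhds hy))
  exact ⟨l₀, fun l hl => (h l hl).le⟩

lemma exists_isCellSystem {M : ℕ → ℝ} (hM : ∀ n, 0 < M n) (hreg : IsRegularCarleman M)
    {χ : ℝ → ℂ} (hχ : χ ∈ carlemanClass M) {B δ : ℝ} (hB : 4 ≤ B) (hδ : 0 < δ) :
    ∃ (σ : ℝ → ℝ) (R : ℕ → ℝ) (N : ℕ → ℕ) (C ρ : ℝ) (A c S lam : ℤ → ℝ) (s : ℝ),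
      s ≤ δ ∧ IsCellSystem M χ σ R N C ρ A c S lam s B := by
  obtain ⟨R, N, C, hC, ρ, hρ, hR, hR1, hR2, hN, hN1, hsize⟩ := exists_truncation_orders hM hreg
  have hT : IsTruncation M R N C ρ :=
    ⟨hC, hρ, hR, hR1, hR2, hN, hN1, fun j k => hsize j k (R j) (Or.inl rfl)⟩
  have hR0 := hR 0
  have hB0 : 0 < B := by linarith
  set s : ℝ := min δ (1 / (2 * B)) with hs
  have hs0 : 0 < s := lt_min hδ (by positivity)
  choose A hA r hr hbound using fun k : ℤ => hχ.2 k (k + 1)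
  -- `σ ≤ 1 / r k` absorbs the geometric constant on the cell, and `σ ≤ s / R 0` keeps the extension
  -- at height at most `s`.
  obtain ⟨σ, hσ, hσ0, hσy⟩ := exists_smooth_pos_le (y := fun k => min (1 / r k) (s / R 0))
    fun k => lt_min (one_div_pos.2 (hr k)) (by positivity)
  have hcS : ∀ k : ℤ, ∃ c S : ℝ, IsTaylorCell M χ σ (R 0) k (k + 1) (A k) c S s := by
    intro k
    obtain ⟨t₀, -, ht₀⟩ := (isCompact_Icc (a := (k : ℝ)) (b := k + 1)).exists_isMinOn
      ⟨k, le_rfl, by linarith⟩ hσ.continuous.continuousOn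
    obtain ⟨S, hS⟩ := (isCompact_Icc (a := (k : ℝ)) (b := k + 1)).exists_bound_of_continuousOn
      (contDiff_infty_iff_deriv.1 hσ).2.continuous.continuousOn
    refine ⟨σ t₀, S, by linarith, hχ.1, hσ, (hA k).le, hσ0 t₀,
      (norm_nonneg _).trans (hS k ⟨le_rfl, by linarith⟩), hs0, fun n t ht => ?_, fun t ht => ?_,
      fun t ht => ?_, hS⟩
    · have h1 := hbound k n t ht
      have h2 := (hσy k t ht).trans (min_le_left _ _)
      have h3 := hσ0 t
      have h4 : σ t ^ n ≤ (1 / r k) ^ n := by gcongr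
      have h5 := hr k
      have h6 := hA k
      have h7 := hM n
      rw [abs_of_pos h3]
      calc _ ≤ A k * r k ^ n * M n * (1 / r k) ^ n := by gcongr
        _ = A k * M n := by rw [one_div, inv_pow]; field_simp
        _ = _ := by rw [weight_eq M n]
    · rw [abs_of_pos (hσ0 t)]
      exact ht₀ ht
    · rw [abs_of_pos (hσ0 t), mul_comm, ← le_div_iff₀ hR0]
      exact (hσy k t ht).trans (min_le_right _ _)
  choose c S hcell using hcS
  have hy : ∀ k : ℤ, (0 : ℝ) < (1 / 2) ^ k.natAbs := fun k => by positivity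
  choose l₁ hl₁ using fun k : ℤ =>
    exists_eight_le_exp_le (K := cellBound M R N k (k + 1) (A k) (S k)) (hy k)
  choose l₂ hl₂ using fun k : ℤ =>
    exists_eight_le_exp_le (K := A k * extBound M R N * s) (hy k)
  refine ⟨σ, R, N, C, ρ, A, c, S,
    -- The entry `l₂ (k + 1)` is there for `edge_pred_le` at `k + 1`.
    fun k => max (max 8 (l₁ k)) (max (l₂ k) (l₂ (k + 1))), s, min_le_left _ _, hT, hcell, hσ0, hB,
    ?_, fun k => ?_, fun k => ?_, fun k => ?_, fun k => ?_⟩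
  · have h1 : s ≤ 1 / (2 * B) := min_le_right _ _
    rw [le_div_iff₀ (by positivity)] at h1
    linarith
  · exact (le_max_left _ _).trans (le_max_left _ _)
  · exact hl₁ k _ ((le_max_right _ _).trans (le_max_left _ _))
  · exact hl₂ k _ ((le_max_left _ _).trans (le_max_right _ _))
  · refine hl₂ k _ ?_
    rw [sub_add_cancel]
    exact (le_max_right _ _).trans (le_max_right _ _)

/-- Every function of the class is the sum of two functions of the class, each of which is
holomorphic with double exponential decay near one end of the real line. -/
theorem exists_cellSeries_decomposition {M : ℕ → ℝ} (hM : ∀ n, 0 < M n)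
    (hreg : IsRegularCarleman M) {χ : ℝ → ℂ} (hχ : χ ∈ carlemanClass M) {B δ : ℝ} (hB : 4 ≤ B)
    (hδ : 0 < δ) : ∃ (s : ℝ) (F G : ℕ → ℂ → ℂ), 0 < s ∧ s ≤ δ ∧ IsCellSeries M F s B ∧
      IsCellSeries M G s B ∧ ∀ x : ℝ, ∑' n, F n x + ∑' n, G n (-x) = χ x := by
  obtain ⟨σ, R, N, C, ρ, A, c, S, lam, s, hsδ, h⟩ := exists_isCellSystem hM hreg hχ hB hδ
  refine ⟨s, _, _, (h.cell 0).s_pos, hsδ, h.isCellSeries_right hM hreg,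
    h.isCellSeries_left hM hreg, fun x => ?_⟩
  simpa using h.tsum_add_tsum hM hreg x

/-! ### Solution of the difference equation. -/

/-- Solvability for right-hand sides with double exponential decay on the left. -/
lemma IsCellSeries.exists_solution {M : ℕ → ℝ} (hM : ∀ n, 0 < M n) (hreg : IsRegularCarleman M)
    {G : ℕ → ℂ → ℂ} {w B : ℝ} (hG : IsCellSeries M G w B) (hw : 0 < w) {δ : ℝ} (hwδ : w ≤ δ)
    {s : Finset ℕ} {p : ℕ} {α : ℕ → ℝ} (hα : ∀ j ∈ s, α j < α p) {a : ℕ → ℂ → ℂ}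
    (ha : ∀ j ∈ s, DifferentiableOn ℂ (a j) (strip δ)) (hap : DifferentiableOn ℂ (a p) (strip δ))
    (hap0 : ∀ z ∈ strip δ, a p z ≠ 0) {K C : ℝ} (hC : 0 < C)
    (hK : ∀ j ∈ s, ∀ z ∈ strip δ, ‖a j z / a p z‖ ≤ K * Real.exp (Real.exp (C * |z.re|)))
    (hK1 : ∀ z ∈ strip δ, 1 / ‖a p z‖ ≤ K * Real.exp (Real.exp (C * |z.re|))) (hB : C + 1 ≤ B) :
    ∃ φ : ℝ → ℂ, (∀ x, CarlemanAt M φ x) ∧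
      ∀ x : ℝ, a p x * φ (x + α p) + ∑ j ∈ s, a j x * φ (x + α j) = ∑' n, G n x :=
  exists_solution_of_left_decay hM hreg hα (hw.trans_le hwδ) ha hap hap0 hC hK hK1 hB hw hwδ
    (hG.carlemanAt_tsum hM hreg hw) hG.differentiableOn_tsum (fun _ _ => rfl) hG.norm_tsum_le

lemma neg_mem_strip {δ : ℝ} {z : ℂ} (hz : z ∈ strip δ) : -z ∈ strip δ := by
  simpa [strip] using hz

theorem theorem2 (M : ℕ → ℝ) (hM : ∀ n, 0 < M n)
    (hreg : IsRegularCarleman M) (hqa : IsQuasianalytic M)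
    (q : ℕ) (hq : 3 ≤ q) (α : ℕ → ℝ) (hα : StrictMonoOn α (Set.Icc 1 q))
    (δ : ℝ) (hδ : 0 < δ) (χ : ℝ → ℂ) (hχ : χ ∈ carlemanClass M)
    (a : ℕ → ℂ → ℂ) (ha : ∀ j ∈ Finset.Icc 1 q, DifferentiableOn ℂ (a j) (strip δ))
    (ha1 : ∀ z ∈ strip δ, a 1 z ≠ 0) (haq : ∀ z ∈ strip δ, a q z ≠ 0)
    (C : ℝ) (hC : 0 < C)
    (hgrowth : BddAbove ((fun z : ℂ =>
      (∑ j ∈ Finset.Icc 2 q, ‖a j z / a 1 z‖ + ∑ j ∈ Finset.Icc 1 (q - 1), ‖a j z / a q z‖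
        + 1 / ‖a 1 z‖ + 1 / ‖a q z‖) * Real.exp (-Real.exp (C * |z.re|))) '' strip δ)) :
    ∃ φ ∈ carlemanClass M,
      ∀ x : ℝ, ∑ j ∈ Finset.Icc 1 q, a j (x : ℂ) * φ (x + α j) = χ x := by
  obtain ⟨K, hK⟩ := hgrowth
  have hbound : ∀ z ∈ strip δ, ∑ j ∈ Finset.Icc 2 q, ‖a j z / a 1 z‖ +
      ∑ j ∈ Finset.Icc 1 (q - 1), ‖a j z / a q z‖ + 1 / ‖a 1 z‖ + 1 / ‖a q z‖ ≤
      K * Real.exp (Real.exp (C * |z.re|)) := fun z hz => by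
    have h := hK ⟨z, hz, rfl⟩
    simp only at h
    rw [Real.exp_neg, ← div_eq_mul_inv, div_le_iff₀ (Real.exp_pos _)] at h
    exact h
  have hs1 : ∀ z, 0 ≤ ∑ j ∈ Finset.Icc 2 q, ‖a j z / a 1 z‖ := fun z =>
    Finset.sum_nonneg fun _ _ => norm_nonneg _
  have hs2 : ∀ z, 0 ≤ ∑ j ∈ Finset.Icc 1 (q - 1), ‖a j z / a q z‖ := fun z =>
    Finset.sum_nonneg fun _ _ => norm_nonneg _
  have hi1 : ∀ z, 0 ≤ 1 / ‖a 1 z‖ := fun z => by positivity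
  have hi2 : ∀ z, 0 ≤ 1 / ‖a q z‖ := fun z => by positivity
  have hmem1 : 1 ∈ Finset.Icc 1 q := by rw [Finset.mem_Icc]; omega
  have hmemq : q ∈ Finset.Icc 1 q := by rw [Finset.mem_Icc]; omega
  -- The rate `max 4 (C + 1)` meets both demands on `B`: damping of the kernel and domination of the
  -- coefficients.
  obtain ⟨s, F, G, hs, hsδ, hF, hG, hFG⟩ := exists_cellSeries_decomposition hM hreg hχ
    (le_max_left 4 (C + 1)) hδ
  obtain ⟨φ, hφ, hφ'⟩ := hF.exists_solution hM hreg hs hsδ (s := Finset.Icc 1 (q - 1)) (p := q)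
    (α := α) (a := a) (K := K)
    (fun j hj => by
      rw [Finset.mem_Icc] at hj
      exact hα ⟨hj.1, by omega⟩ ⟨by omega, le_rfl⟩ (by omega))
    (fun j hj => ha j (by rw [Finset.mem_Icc] at hj ⊢; omega)) (ha q hmemq) haq hC
    (fun j hj z hz => by
      have h1 := Finset.single_le_sum (f := fun j => ‖a j z / a q z‖)
        (fun _ _ => norm_nonneg _) hj
      linarith [hbound z hz, hs1 z, hi1 z, hi2 z])
    (fun z hz => by linarith [hbound z hz, hs1 z, hs2 z, hi1 z]) (le_max_right _ _)
  -- In the reflected problem the shifts are `-α j`, so the largest belongs to `j = 1` and the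
  -- division is by `a 1`.
  obtain ⟨ψ, hψ, hψ'⟩ := hG.exists_solution hM hreg hs hsδ (s := Finset.Icc 2 q) (p := 1)
    (α := fun j => -α j) (a := fun j z => a j (-z)) (K := K)
    (fun j hj => by
      rw [Finset.mem_Icc] at hj
      exact neg_lt_neg (hα ⟨le_rfl, by omega⟩ ⟨by omega, hj.2⟩ (by omega)))
    (fun j hj => (ha j (by rw [Finset.mem_Icc] at hj ⊢; omega)).comp
      differentiable_neg.differentiableOn fun z => neg_mem_strip)
    ((ha 1 hmem1).comp differentiable_neg.differentiableOn fun z => neg_mem_strip)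
    (fun z hz => ha1 _ (neg_mem_strip hz)) hC
    (fun j hj z hz => by
      have h1 := Finset.single_le_sum (f := fun j => ‖a j (-z) / a 1 (-z)‖)
        (fun _ _ => norm_nonneg _) hj
      have h2 := hbound _ (neg_mem_strip hz)
      rw [Complex.neg_re, abs_neg] at h2
      linarith [hs2 (-z), hi1 (-z), hi2 (-z)])
    (fun z hz => by
      have h2 := hbound _ (neg_mem_strip hz)
      rw [Complex.neg_re, abs_neg] at h2
      linarith [hs1 (-z), hs2 (-z), hi2 (-z)]) (le_max_right _ _)
  refine ⟨fun y => φ y + ψ (-y), mem_carlemanClass_of_carlemanAt hM fun x =>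
    (hφ x).add hM (hψ (-x)).comp_neg, fun x => ?_⟩
  have e1 : ∑ j ∈ Finset.Icc 1 q, a j x * φ (x + α j) = ∑' n, F n x := by
    rw [← hφ' x, add_comm]
    obtain ⟨r, rfl⟩ : ∃ r, q = r + 1 := ⟨q - 1, by omega⟩
    rw [Finset.sum_Icc_succ_top (by omega), Nat.add_sub_cancel]
  have e2 : ∑ j ∈ Finset.Icc 1 q, a j x * ψ (-(x + α j)) = ∑' n, G n (-x) := by
    have h1 := hψ' (-x)
    simp only [Complex.ofReal_neg, neg_neg] at h1
    rw [← h1, ← Finset.insert_Icc_add_one_left_eq_Icc (by omega : 1 ≤ q), Finset.sum_insert (by simp)]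
    simp only [neg_add]
    rfl
  simp only [mul_add, Finset.sum_add_distrib]
  rw [e1, e2, hFG]
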